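/- A $3$-graph $H$ consists of a finite vertex set $V(H)$ and a set $E(H)$ of $3$-element subsets of $V(H)$, called edges. The degree $\deg(v)$ of a vertex $v$ is the number of edges containing $v$; a vertex is isolated if it lies in no edge; two distinct vertices are adjacent if some edge contains both of them. A perfect matching of $H$ is a set of pairwise disjoint edges of $H$ that together cover $V(H)$. For $n$ a positive multiple of $3$, let $H^2_{n,n/3}$ be the $3$-graph whose vertex set is the disjoint union of two sets $S$ and $T$ with $|S| = n/3+1$ and $|T| = 2n/3-1$, and whose edges are all the $3$-element sets of vertices with at least two elements in $T$. **Theorem 1.6.** For every real $\gamma > 0$ there is an $n_0 \in \mathbb{N}$ such that the following holds for every integer $n \ge n_0$ divisible by $3$. Let $H$ be a $3$-graph on $n$ vertices with no isolated vertex, and suppose that $$\deg(u) + \deg(v) > \left(\tfrac35 + \gamma\right) n^2$$ for every pair of adjacent vertices $u, v$ of $H$. Then $H$ has a perfect matching if and only if $H$ is not isomorphic to a subgraph of $H^2_{n,n/3}$ (that is, there is no injective map $V(H) \to V(H^2_{n,n/3})$ that sends every edge of $H$ to an edge of $H^2_{n,n/3}$). -/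

import Mathlib

namespace Hypergraph

/-- `H` is a `k`-graph: every edge has exactly `k` vertices. -/
def IsUniform {α : Type*} (H : Hypergraph α) (k : ℕ) : Prop :=
  ∀ e ∈ H.edgeSet, e.ncard = k

/-- The degree of a vertex: the number of edges containing it. -/
noncomputable def degree {α : Type*} (H : Hypergraph α) (v : α) : ℕ :=
  {e | e ∈ H.edgeSet ∧ v ∈ e}.ncard

/-- A matching of `H` is a set of pairwise disjoint edges of `H`. -/
def IsMatching {α : Type*} (H : Hypergraph α) (M : Set (Set α)) : Prop :=
  M ⊆ H.edgeSet ∧ M.PairwiseDisjoint id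

/-- A perfect matching of `H` is a matching that covers every vertex of `H`. -/
def IsPerfectMatching {α : Type*} (H : Hypergraph α) (M : Set (Set α)) : Prop :=
  H.IsMatching M ∧ ⋃₀ M = H.vertexSet

/-- `H` is (isomorphic to) a subgraph of `G`: some map that is injective on the vertices of `H`
sends vertices of `H` to vertices of `G` and edges of `H` to edges of `G`. -/
def IsSubgraphOf {α β : Type*} (H : Hypergraph α) (G : Hypergraph β) : Prop :=
  ∃ f : α → β, Set.InjOn f H.vertexSet ∧
    (H.image f).vertexSet ⊆ G.vertexSet ∧ (H.image f).edgeSet ⊆ G.edgeSet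

/-- The 3-graph `H^ℓ_{n,s}` on the vertex set `{0, …, n - 1}`, partitioned into
`T = {i | i < s ℓ - 1}` and its complement `S`, so that `|T| = s ℓ - 1` and `|S| = n - s ℓ + 1`
(for `1 ≤ s ℓ ≤ n + 1`); its edges are all the triples with at least `ℓ` vertices in `T`. -/
def extremal (ℓ n s : ℕ) : Hypergraph (Fin n) where
  vertexSet := Set.univ
  edgeSet := {e | e.ncard = 3 ∧ ℓ ≤ (e ∩ {i : Fin n | (i : ℕ) < s * ℓ - 1}).ncard}
  subset_vertexSet_of_mem_edgeSet' := fun _ _ => Set.subset_univ _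

end Hypergraph

/-! Count degrees by ordered pairs, so that adjacent u, v satisfy deg u + deg v ≥ (6/5 + γ)n². Let W
be the set of vertices of degree below (3/5 + γ/2)n². No two of them are adjacent, so every edge
meets W at most once. If |W| > n/3, then n/3 + 1 vertices of W can play the role of S and H embeds
in the extremal graph. That graph has no perfect matching, because n/3 disjoint edges would need
2n/3 vertices of T. What remains is to build a perfect matching when |W| ≤ n/3.

The core is the fractional statement `exists_decomposition`. By linear programming duality, if there
is no perfect fractional matching, then an optimal weight z ≥ -1, nonnegative on edges, has negative
total. By complementary slackness the uniform distribution is a mixture of tight triples: edges of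
weight 0, and constant triples at vertices of weight -1. The link of v only contains pairs with z a
+ z b ≥ -z v, and the number of such pairs is (n/3)² times an average over two independent tight
triples of the number of large entries in their 3 × 3 sum table. For a vertex of weight -1 and its
lightest neighbour, the two tables have at most 10 such entries in total, against the 54/5 that the
degrees demand. The only exception is a neighbour of weight 1/2 together with triples (-1, 1/2,
1/2), and a heavy vertex of nonpositive weight, which exists since |W| ≤ n/3, excludes that one.

The fractional result becomes an almost perfect matching by removing edges one at a time so that an
exponential potential keeps all link densities nearly unchanged; the remainder then always satisfies
the fractional hypotheses (`exists_almost_matching`). An absorbing set (`exists_absorber`) takes in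
the leftover vertices. Both probabilistic selections are derandomised by averaging.

Two cases finish the proof. If |W| is clearly below n/3 (`DegreeCond.matchable_of_card_le`),
reserved pairs outside W complete the leftover vertices of W to edges, and the absorber handles
triples outside W. If |W| is close to n/3 (`DegreeCond.matchable_of_le_card`), a few edges outside W
are removed so that W becomes exactly a third of the rest, and from then on only edges with exactly
one vertex in W are used. -/

/-! ### Sum tables of two triples -/

open scoped Classical in
/-- The indicator of a proposition, as a natural number. -/
noncomputable def ind (p : Prop) : ℕ := if p then 1 else 0

lemma ind_le_one (p : Prop) : ind p ≤ 1 := by unfold ind; split_ifs <;> omega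

lemma ind_of {p : Prop} (h : p) : ind p = 1 := if_pos h

lemma ind_of_not {p : Prop} (h : ¬ p) : ind p = 0 := if_neg h

lemma ind_mono {p q : Prop} (h : p → q) : ind p ≤ ind q := by
  by_cases hp : p
  · rw [ind_of hp, ind_of (h hp)]
  · rw [ind_of_not hp]; omega

lemma ind_add_le_one {p q : Prop} (h : p → q → False) : ind p + ind q ≤ 1 := by
  by_cases hp : p
  · rw [ind_of hp, ind_of_not (h hp)]
  · have := ind_le_one q
    rw [ind_of_not hp]; omega

lemma ind_add_add_le_two {p q r : Prop} (h : p → q → r → False) : ind p + ind q + ind r ≤ 2 := by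
  by_cases hp : p
  · have := ind_add_le_one (h hp)
    have := ind_le_one p
    omega
  · have := ind_le_one q
    have := ind_le_one r
    rw [ind_of_not hp]; omega

/-- The number of entries of the sum table of two triples that are at least `s`. -/
noncomputable def sumCount (s : ℝ) (e f : Fin 3 → ℝ) : ℕ := ∑ i, ∑ j, ind (s ≤ e i + f j)

/-- The number of entries of the sum table of two triples that are at least `1` and come from
summands that are at least `α`. -/
noncomputable def restrictedCount (α : ℝ) (e f : Fin 3 → ℝ) : ℕ :=
  ∑ i, ∑ j, ind (α ≤ e i ∧ α ≤ f j ∧ 1 ≤ e i + f j)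

/-- A triple is split if it is a permutation of `(-1, 1/2, 1/2)`. -/
def IsSplit (e : Fin 3 → ℝ) : Prop := ∃ i, e i = -1 ∧ ∀ j, j ≠ i → e j = 1 / 2

lemma sumCount_perm (s : ℝ) (e f : Fin 3 → ℝ) (σ τ : Equiv.Perm (Fin 3)) :
    sumCount s (e ∘ σ) (f ∘ τ) = sumCount s e f := by
  exact (Finset.sum_congr rfl fun i _ =>
    Equiv.sum_comp τ (fun j => ind (s ≤ e (σ i) + f j))).trans
    (Equiv.sum_comp σ fun i => ∑ j, ind (s ≤ e i + f j))

lemma restrictedCount_perm (s : ℝ) (e f : Fin 3 → ℝ) (σ τ : Equiv.Perm (Fin 3)) :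
    restrictedCount s (e ∘ σ) (f ∘ τ) = restrictedCount s e f := by
  exact (Finset.sum_congr rfl fun i _ =>
    Equiv.sum_comp τ (fun j => ind (s ≤ e (σ i) ∧ s ≤ f j ∧ 1 ≤ e (σ i) + f j))).trans
    (Equiv.sum_comp σ fun i => ∑ j, ind (s ≤ e i ∧ s ≤ f j ∧ 1 ≤ e i + f j))

lemma sumCount_comm (s : ℝ) (e f : Fin 3 → ℝ) : sumCount s e f = sumCount s f e := by
  unfold sumCount
  rw [Finset.sum_comm]
  simp only [add_comm]

lemma restrictedCount_comm (s : ℝ) (e f : Fin 3 → ℝ) :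
    restrictedCount s e f = restrictedCount s f e := by
  unfold restrictedCount
  rw [Finset.sum_comm]
  refine Finset.sum_congr rfl fun i _ => Finset.sum_congr rfl fun j _ => ?_
  congr 1
  rw [add_comm (e j)]
  apply propext
  tauto

/-- A sorted triple with entries at least `-1` and sum at most `0`. -/
structure SortedTriple (e : Fin 3 → ℝ) : Prop where
  le01 : e 0 ≤ e 1
  le12 : e 1 ≤ e 2
  low : -1 ≤ e 0
  sum : e 0 + e 1 + e 2 ≤ 0

lemma exists_perm_sortedTriple {e : Fin 3 → ℝ} (h1 : ∀ i, -1 ≤ e i) (h2 : ∑ i, e i ≤ 0) :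
    ∃ σ : Equiv.Perm (Fin 3), SortedTriple (e ∘ σ) := by
  refine ⟨Tuple.sort e, Tuple.monotone_sort e (by decide), Tuple.monotone_sort e (by decide),
    h1 _, ?_⟩
  have := Equiv.sum_comp (Tuple.sort e) e
  rw [Fin.sum_univ_three] at this
  simp only [Function.comp]
  linarith

lemma isSplit_perm {e : Fin 3 → ℝ} (σ : Equiv.Perm (Fin 3)) :
    IsSplit (e ∘ σ) ↔ IsSplit e := by
  constructor
  · rintro ⟨i, hi, h⟩
    refine ⟨σ i, hi, fun j hj => ?_⟩
    have := h (σ.symm j) (by rintro rfl; simp at hj)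
    simpa using this
  · rintro ⟨i, hi, h⟩
    refine ⟨σ.symm i, by simpa using hi, fun j hj => h _ ?_⟩
    rintro rfl
    simp at hj

lemma SortedTriple.isSplit_iff {e : Fin 3 → ℝ} (h : SortedTriple e) :
    IsSplit e ↔ e 0 = -1 ∧ e 1 = 1 / 2 ∧ e 2 = 1 / 2 := by
  obtain ⟨h1, h2, h3, h4⟩ := h
  constructor
  · rintro ⟨i, hi, hj⟩
    fin_cases i
    · exact ⟨hi, hj 1 (by decide), hj 2 (by decide)⟩
    · have := hj 0 (by decide)
      simp only [Fin.mk_one] at hi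
      linarith
    · have := hj 0 (by decide)
      simp only [Fin.reduceFinMk] at hi
      linarith
  · rintro ⟨a, b, c⟩
    refine ⟨0, a, fun j hj => ?_⟩
    fin_cases j
    · exact absurd rfl hj
    · exact b
    · exact c

lemma zero_perm {e : Fin 3 → ℝ} (σ : Equiv.Perm (Fin 3)) : e ∘ σ = 0 ↔ e = 0 := by
  constructor
  · intro h
    ext i
    have := congrFun h (σ.symm i)
    simpa using this
  · rintro rfl
    rfl

lemma sumCount_eq (s : ℝ) (e f : Fin 3 → ℝ) : sumCount s e f =
    ind (s ≤ e 0 + f 0) + ind (s ≤ e 0 + f 1) + ind (s ≤ e 0 + f 2) +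
    (ind (s ≤ e 1 + f 0) + ind (s ≤ e 1 + f 1) + ind (s ≤ e 1 + f 2)) +
    (ind (s ≤ e 2 + f 0) + ind (s ≤ e 2 + f 1) + ind (s ≤ e 2 + f 2)) := by
  simp only [sumCount, Fin.sum_univ_three]

lemma restrictedCount_eq (s : ℝ) (e f : Fin 3 → ℝ) : restrictedCount s e f =
    ind (s ≤ e 0 ∧ s ≤ f 0 ∧ 1 ≤ e 0 + f 0) + ind (s ≤ e 0 ∧ s ≤ f 1 ∧ 1 ≤ e 0 + f 1) +
    ind (s ≤ e 0 ∧ s ≤ f 2 ∧ 1 ≤ e 0 + f 2) +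
    (ind (s ≤ e 1 ∧ s ≤ f 0 ∧ 1 ≤ e 1 + f 0) + ind (s ≤ e 1 ∧ s ≤ f 1 ∧ 1 ≤ e 1 + f 1) +
      ind (s ≤ e 1 ∧ s ≤ f 2 ∧ 1 ≤ e 1 + f 2)) +
    (ind (s ≤ e 2 ∧ s ≤ f 0 ∧ 1 ≤ e 2 + f 0) + ind (s ≤ e 2 ∧ s ≤ f 1 ∧ 1 ≤ e 2 + f 1) +
      ind (s ≤ e 2 ∧ s ≤ f 2 ∧ 1 ≤ e 2 + f 2)) := by
  simp only [restrictedCount, Fin.sum_univ_three]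

lemma restrictedCount_le_sumCount (α : ℝ) (e f : Fin 3 → ℝ) :
    restrictedCount α e f ≤ sumCount 1 e f :=
  Finset.sum_le_sum fun _ _ => Finset.sum_le_sum fun _ _ => ind_mono fun h => h.2.2

/-- The facts that every sum table of two sorted triples satisfies. -/
lemma SortedTriple.monotone_table {e f : Fin 3 → ℝ} (he : SortedTriple e) (hf : SortedTriple f)
    (s : ℝ) :
    (ind (s ≤ e 0 + f 0) ≤ ind (s ≤ e 0 + f 1) ∧ ind (s ≤ e 0 + f 1) ≤ ind (s ≤ e 0 + f 2)) ∧
    (ind (s ≤ e 1 + f 0) ≤ ind (s ≤ e 1 + f 1) ∧ ind (s ≤ e 1 + f 1) ≤ ind (s ≤ e 1 + f 2)) ∧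
    (ind (s ≤ e 2 + f 0) ≤ ind (s ≤ e 2 + f 1) ∧ ind (s ≤ e 2 + f 1) ≤ ind (s ≤ e 2 + f 2)) ∧
    (ind (s ≤ e 0 + f 0) ≤ ind (s ≤ e 1 + f 0) ∧ ind (s ≤ e 1 + f 0) ≤ ind (s ≤ e 2 + f 0)) ∧
    (ind (s ≤ e 0 + f 1) ≤ ind (s ≤ e 1 + f 1) ∧ ind (s ≤ e 1 + f 1) ≤ ind (s ≤ e 2 + f 1)) ∧
    (ind (s ≤ e 0 + f 2) ≤ ind (s ≤ e 1 + f 2) ∧ ind (s ≤ e 1 + f 2) ≤ ind (s ≤ e 2 + f 2)) ∧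
    ind (s ≤ e 2 + f 2) ≤ 1 := by
  obtain ⟨h1, h2, h3, h4⟩ := he
  obtain ⟨h5, h6, h7, h8⟩ := hf
  refine ⟨⟨?_, ?_⟩, ⟨?_, ?_⟩, ⟨?_, ?_⟩, ⟨?_, ?_⟩, ⟨?_, ?_⟩, ⟨?_, ?_⟩, ind_le_one _⟩ <;>
    exact ind_mono fun h => by linarith

/-- The two entries would add up to at least 2, while e 1 + e 2 ≤ -e 0 ≤ 1 and f 0 + f 1 ≤ 0. -/
lemma SortedTriple.diag_one {e f : Fin 3 → ℝ} (he : SortedTriple e) (hf : SortedTriple f) :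
    ind (1 ≤ e 1 + f 1) + ind (1 ≤ e 2 + f 0) ≤ 1 := by
  obtain ⟨h1, h2, h3, h4⟩ := he
  obtain ⟨h5, h6, h7, h8⟩ := hf
  exact ind_add_le_one fun _ _ => by linarith

/-- The large entries form a staircase. If the middle entry is large, `diag_one` removes both
off-diagonal corners, leaving 4; otherwise the block of indices 0, 1 is empty, leaving 5. -/
lemma SortedTriple.sumCount_one_le {e f : Fin 3 → ℝ} (he : SortedTriple e)
    (hf : SortedTriple f) : sumCount 1 e f ≤ 5 := by
  have h1 := he.monotone_table hf 1
  have h2 := he.diag_one hf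
  have h3 := hf.diag_one he
  rw [add_comm (f 1), add_comm (f 2)] at h3
  rw [sumCount_eq]
  omega

/-- The antidiagonal of the table sums to at most 0, so its three entries cannot all be positive. -/
lemma SortedTriple.no_transversal {e f : Fin 3 → ℝ} (he : SortedTriple e) (hf : SortedTriple f)
    {s : ℝ} (hs : 0 < s) :
    ind (s ≤ e 0 + f 2) + ind (s ≤ e 1 + f 1) + ind (s ≤ e 2 + f 0) ≤ 2 := by
  obtain ⟨h1, h2, h3, h4⟩ := he
  obtain ⟨h5, h6, h7, h8⟩ := hf
  exact ind_add_add_le_two fun _ _ _ => by linarith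

lemma SortedTriple.sumCount_pos_le {e f : Fin 3 → ℝ} (he : SortedTriple e)
    (hf : SortedTriple f) {s : ℝ} (hs : 0 < s) : sumCount s e f ≤ 6 := by
  have h1 := he.monotone_table hf s
  have h2 := he.no_transversal hf hs
  rw [sumCount_eq]
  omega

/-- This serves a neighbour of negative weight -s of a vertex of weight -1. The separate bounds 5
and 6 only give 11; both cannot be attained at once. -/
lemma SortedTriple.sumCount_add_neg {e f : Fin 3 → ℝ} (he : SortedTriple e)
    (hf : SortedTriple f) {s : ℝ} (hs : 0 < s) (hs1 : s ≤ 1) :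
    sumCount 1 e f + sumCount s e f ≤ 10 := by
  have h1 := he.monotone_table hf 1
  have h2 := he.diag_one hf
  have h3 := hf.diag_one he
  rw [add_comm (f 1), add_comm (f 2)] at h3
  have h4 := he.monotone_table hf s
  have h5 := he.no_transversal hf hs
  have h6 : ∀ x : ℝ, ind (1 ≤ x) ≤ ind (s ≤ x) := fun x => ind_mono fun h => hs1.trans h
  have k1 := h6 (e 0 + f 0)
  have k2 := h6 (e 0 + f 1)
  have k3 := h6 (e 0 + f 2)
  have k4 := h6 (e 1 + f 0)
  have k5 := h6 (e 1 + f 1)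
  have k6 := h6 (e 1 + f 2)
  have k7 := h6 (e 2 + f 0)
  have k8 := h6 (e 2 + f 1)
  have k9 := h6 (e 2 + f 2)
  rw [sumCount_eq, sumCount_eq]
  generalize ind (1 ≤ e 0 + f 0) = x00 at *
  generalize ind (1 ≤ e 0 + f 1) = x01 at *
  generalize ind (1 ≤ e 0 + f 2) = x02 at *
  generalize ind (1 ≤ e 1 + f 0) = x10 at *
  generalize ind (1 ≤ e 1 + f 1) = x11 at *
  generalize ind (1 ≤ e 1 + f 2) = x12 at *
  generalize ind (1 ≤ e 2 + f 0) = x20 at *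
  generalize ind (1 ≤ e 2 + f 1) = x21 at *
  generalize ind (1 ≤ e 2 + f 2) = x22 at *
  generalize ind (s ≤ e 0 + f 0) = y00 at *
  generalize ind (s ≤ e 0 + f 1) = y01 at *
  generalize ind (s ≤ e 0 + f 2) = y02 at *
  generalize ind (s ≤ e 1 + f 0) = y10 at *
  generalize ind (s ≤ e 1 + f 1) = y11 at *
  generalize ind (s ≤ e 1 + f 2) = y12 at *
  generalize ind (s ≤ e 2 + f 0) = y20 at *
  generalize ind (s ≤ e 2 + f 1) = y21 at *
  generalize ind (s ≤ e 2 + f 2) = y22 at *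
  clear hs hs1 h6 he hf
  -- If the middle entry reaches s, the missing antidiagonal entry is one of the two corners.
  have : y11 = 0 ∨ (y11 = 1 ∧ y02 = 0) ∨ (y11 = 1 ∧ y20 = 0) := by omega
  rcases this with h | ⟨h, h'⟩ | ⟨h, h'⟩
  · omega
  · have : x11 = 0 ∨ x11 = 1 := by omega
    rcases this with h | h <;> omega
  · have : x11 = 0 ∨ x11 = 1 := by omega
    rcases this with h | h <;> omega

/-- The assumptions force α = 0 and e = 0. Only the largest entry of f can then contribute to the
restricted count, and in each row that contribution excludes the entry with f 0 from the second
count, so each row gives at most 3. -/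
lemma SortedTriple.count_le_of_le_zero {α : ℝ} (hα : 0 ≤ α) {e f : Fin 3 → ℝ}
    (he : SortedTriple e) (hf : SortedTriple f) (h0 : α ≤ e 0) :
    restrictedCount α e f + sumCount (-α) e f ≤ 10 := by
  obtain ⟨h1, h2, h3, h4⟩ := he
  obtain ⟨h5, h6, h7, h8⟩ := hf
  rw [restrictedCount_eq, sumCount_eq]
  have a00 := ind_of_not (p := α ≤ e 0 ∧ α ≤ f 0 ∧ 1 ≤ e 0 + f 0) (by rintro ⟨_, _, _⟩; linarith)
  have a10 := ind_of_not (p := α ≤ e 1 ∧ α ≤ f 0 ∧ 1 ≤ e 1 + f 0) (by rintro ⟨_, _, _⟩; linarith)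
  have a20 := ind_of_not (p := α ≤ e 2 ∧ α ≤ f 0 ∧ 1 ≤ e 2 + f 0) (by rintro ⟨_, _, _⟩; linarith)
  have a01 := ind_of_not (p := α ≤ e 0 ∧ α ≤ f 1 ∧ 1 ≤ e 0 + f 1) (by rintro ⟨_, _, _⟩; linarith)
  have a11 := ind_of_not (p := α ≤ e 1 ∧ α ≤ f 1 ∧ 1 ≤ e 1 + f 1) (by rintro ⟨_, _, _⟩; linarith)
  have a21 := ind_of_not (p := α ≤ e 2 ∧ α ≤ f 1 ∧ 1 ≤ e 2 + f 1) (by rintro ⟨_, _, _⟩; linarith)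
  have b0 : ind (α ≤ e 0 ∧ α ≤ f 2 ∧ 1 ≤ e 0 + f 2) + ind (-α ≤ e 0 + f 0) ≤ 1 :=
    ind_add_le_one fun ⟨_, _, _⟩ _ => by linarith
  have b1 : ind (α ≤ e 1 ∧ α ≤ f 2 ∧ 1 ≤ e 1 + f 2) + ind (-α ≤ e 1 + f 0) ≤ 1 :=
    ind_add_le_one fun ⟨_, _, _⟩ _ => by linarith
  have b2 : ind (α ≤ e 2 ∧ α ≤ f 2 ∧ 1 ≤ e 2 + f 2) + ind (-α ≤ e 2 + f 0) ≤ 1 :=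
    ind_add_le_one fun ⟨_, _, _⟩ _ => by linarith
  have c1 := ind_le_one (-α ≤ e 0 + f 1)
  have c2 := ind_le_one (-α ≤ e 0 + f 2)
  have c3 := ind_le_one (-α ≤ e 1 + f 1)
  have c4 := ind_le_one (-α ≤ e 1 + f 2)
  have c5 := ind_le_one (-α ≤ e 2 + f 1)
  have c6 := ind_le_one (-α ≤ e 2 + f 2)
  omega

/-- Apart from the previous case the restricted count lives on the indices 1, 2, and each of its
entries beyond (2, 2) must be paid for by small entries of the other table. -/
lemma SortedTriple.count_le_nonneg {α : ℝ} (hα : 0 ≤ α) {e f : Fin 3 → ℝ}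
    (he : SortedTriple e) (hf : SortedTriple f) :
    restrictedCount α e f + sumCount (-α) e f ≤ 10 ∨ α = 1 / 2 ∧ IsSplit e ∧ IsSplit f := by
  by_cases h0 : α ≤ e 0
  · exact .inl (he.count_le_of_le_zero hα hf h0)
  by_cases h0' : α ≤ f 0
  · rw [restrictedCount_comm, sumCount_comm]
    exact .inl (hf.count_le_of_le_zero hα he h0')
  have hse := he.isSplit_iff
  have hsf := hf.isSplit_iff
  obtain ⟨h1, h2, h3, h4⟩ := he
  obtain ⟨h5, h6, h7, h8⟩ := hf
  rw [restrictedCount_eq, sumCount_eq]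
  have a00 := ind_of_not (p := α ≤ e 0 ∧ α ≤ f 0 ∧ 1 ≤ e 0 + f 0) fun h => h0 h.1
  have a01 := ind_of_not (p := α ≤ e 0 ∧ α ≤ f 1 ∧ 1 ≤ e 0 + f 1) fun h => h0 h.1
  have a02 := ind_of_not (p := α ≤ e 0 ∧ α ≤ f 2 ∧ 1 ≤ e 0 + f 2) fun h => h0 h.1
  have a10 := ind_of_not (p := α ≤ e 1 ∧ α ≤ f 0 ∧ 1 ≤ e 1 + f 0) fun h => h0' h.2.1
  have a20 := ind_of_not (p := α ≤ e 2 ∧ α ≤ f 0 ∧ 1 ≤ e 2 + f 0) fun h => h0' h.2.1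
  have b11 := ind_le_one (α ≤ e 1 ∧ α ≤ f 1 ∧ 1 ≤ e 1 + f 1)
  have b12 := ind_le_one (α ≤ e 1 ∧ α ≤ f 2 ∧ 1 ≤ e 1 + f 2)
  have b21 := ind_le_one (α ≤ e 2 ∧ α ≤ f 1 ∧ 1 ≤ e 2 + f 1)
  have b22 := ind_le_one (α ≤ e 2 ∧ α ≤ f 2 ∧ 1 ≤ e 2 + f 2)
  have c00 := ind_le_one (-α ≤ e 0 + f 0)
  have c01 := ind_le_one (-α ≤ e 0 + f 1)
  have c02 := ind_le_one (-α ≤ e 0 + f 2)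
  have c10 := ind_le_one (-α ≤ e 1 + f 0)
  have c11 := ind_le_one (-α ≤ e 1 + f 1)
  have c12 := ind_le_one (-α ≤ e 1 + f 2)
  have c20 := ind_le_one (-α ≤ e 2 + f 0)
  have c21 := ind_le_one (-α ≤ e 2 + f 1)
  have c22 := ind_le_one (-α ≤ e 2 + f 2)
  push Not at h0 h0'
  -- Since e 1 ≤ 1/2 and f 1 ≤ 1/2, a qualifying entry (1, 1) forces both triples to be (-1, 1/2,
  -- 1/2). For α < 1/2 the first row of the second table is then lost, which gives 4 + 6.
  by_cases hd : α ≤ e 1 ∧ α ≤ f 1 ∧ 1 ≤ e 1 + f 1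
  · obtain ⟨d1, d2, d3⟩ := hd
    have e0 : e 0 = -1 := by linarith
    have e1 : e 1 = 1 / 2 := by linarith
    have e2 : e 2 = 1 / 2 := by linarith
    have f0 : f 0 = -1 := by linarith
    have f1 : f 1 = 1 / 2 := by linarith
    have f2 : f 2 = 1 / 2 := by linarith
    rcases eq_or_lt_of_le (e1 ▸ d1) with h | h
    · exact .inr ⟨h, hse.2 ⟨e0, e1, e2⟩, hsf.2 ⟨f0, f1, f2⟩⟩
    · left
      have := ind_of_not (p := -α ≤ e 0 + f 0) (by rw [e0, f0]; linarith)
      have := ind_of_not (p := -α ≤ e 0 + f 1) (by rw [e0, f1]; linarith)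
      have := ind_of_not (p := -α ≤ e 0 + f 2) (by rw [e0, f2]; linarith)
      omega
  have a11 := ind_of_not hd
  left
  by_cases hd' : (α ≤ e 1 ∧ α ≤ f 2 ∧ 1 ≤ e 1 + f 2) ∧ (α ≤ e 2 ∧ α ≤ f 1 ∧ 1 ≤ e 2 + f 1)
  · obtain ⟨⟨d1, d2, d3⟩, d4, d5, d6⟩ := hd'
    have d7 : e 1 + f 1 < 1 := not_le.1 fun h => hd ⟨d1, d5, h⟩
    have := ind_of_not (p := -α ≤ e 0 + f 0) (by linarith)
    have := ind_of_not (p := -α ≤ e 0 + f 1) (by linarith)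
    have := ind_of_not (p := -α ≤ e 1 + f 0) (by linarith)
    omega
  have k1 := ind_add_le_one fun a b => hd' ⟨a, b⟩
  have k2 : ind (α ≤ e 1 ∧ α ≤ f 2 ∧ 1 ≤ e 1 + f 2) + ind (-α ≤ e 0 + f 0) ≤ 1 :=
    ind_add_le_one fun ⟨_, _, _⟩ _ => by linarith
  have k3 : ind (α ≤ e 2 ∧ α ≤ f 1 ∧ 1 ≤ e 2 + f 1) + ind (-α ≤ e 0 + f 0) ≤ 1 :=
    ind_add_le_one fun ⟨_, _, _⟩ _ => by linarith
  omega

lemma count_split_split {e f : Fin 3 → ℝ} (he : SortedTriple e) (hf : SortedTriple f)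
    (hse : IsSplit e) (hsf : IsSplit f) :
    restrictedCount (1 / 2) e f + sumCount (-(1 / 2)) e f ≤ 12 := by
  obtain ⟨e0, e1, e2⟩ := he.isSplit_iff.1 hse
  obtain ⟨f0, f1, f2⟩ := hf.isSplit_iff.1 hsf
  rw [restrictedCount_eq, sumCount_eq, e0, e1, e2, f0, f1, f2]
  norm_num [ind]

/-- This deficit of 4 below 10 is what compensates for the excess of 2 in the split-split case. -/
lemma count_split_zero {e : Fin 3 → ℝ} (he : SortedTriple e) (hse : IsSplit e) :
    restrictedCount (1 / 2) e 0 + sumCount (-(1 / 2)) e 0 ≤ 6 := by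
  obtain ⟨e0, e1, e2⟩ := he.isSplit_iff.1 hse
  rw [restrictedCount_eq, sumCount_eq, e0, e1, e2]
  norm_num [ind]

lemma sumCount_split_split {β : ℝ} (hβ : 0 ≤ β) {e f : Fin 3 → ℝ} (he : SortedTriple e)
    (hf : SortedTriple f) (hse : IsSplit e) (hsf : IsSplit f) : sumCount β e f ≤ 4 := by
  obtain ⟨e0, e1, e2⟩ := he.isSplit_iff.1 hse
  obtain ⟨f0, f1, f2⟩ := hf.isSplit_iff.1 hsf
  rw [sumCount_eq, e0, e1, e2, f0, f1, f2]
  have := ind_of_not (p := β ≤ (-1 : ℝ) + -1) (by linarith)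
  have := ind_of_not (p := β ≤ (-1 : ℝ) + 1 / 2) (by linarith)
  have := ind_of_not (p := β ≤ (1 / 2 : ℝ) + -1) (by linarith)
  have := ind_le_one (β ≤ (1 / 2 : ℝ) + 1 / 2)
  omega

lemma SortedTriple.eq_zero {e : Fin 3 → ℝ} (he : SortedTriple e) (h : 0 ≤ e 0) : e = 0 := by
  obtain ⟨h1, h2, h3, h4⟩ := he
  ext i
  fin_cases i
  · exact le_antisymm (by simp; linarith) h
  · exact le_antisymm (by simp; linarith) (by simp; linarith)
  · exact le_antisymm (by simp; linarith) (by simp; linarith)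

lemma SortedTriple.sumCount_zero_le_three {e f : Fin 3 → ℝ} (he : SortedTriple e)
    (hf : SortedTriple f) (h : e 2 = -1) : sumCount 0 e f ≤ 3 := by
  obtain ⟨h1, h2, h3, h4⟩ := he
  obtain ⟨h5, h6, h7, h8⟩ := hf
  rw [sumCount_eq]
  have := ind_of_not (p := 0 ≤ e 0 + f 0) (by linarith)
  have := ind_of_not (p := 0 ≤ e 0 + f 1) (by linarith)
  have := ind_of_not (p := 0 ≤ e 1 + f 0) (by linarith)
  have := ind_of_not (p := 0 ≤ e 1 + f 1) (by linarith)
  have := ind_of_not (p := 0 ≤ e 2 + f 0) (by linarith)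
  have := ind_of_not (p := 0 ≤ e 2 + f 1) (by linarith)
  have := ind_le_one (0 ≤ e 0 + f 2)
  have := ind_le_one (0 ≤ e 1 + f 2)
  have := ind_le_one (0 ≤ e 2 + f 2)
  omega

/-- At threshold 0 the antidiagonal argument fails, hence the restriction to triples with at most
one negative entry or constantly -1. Without it, (-1/2, -1/2, 1) against (-1, 1/2, 1/2) has 7
nonnegative entries. -/
lemma SortedTriple.sumCount_zero_le {e f : Fin 3 → ℝ} (he : SortedTriple e)
    (hf : SortedTriple f) (hne : 0 ≤ e 1 ∨ e 2 = -1) (hnf : 0 ≤ f 1 ∨ f 2 = -1)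
    (h : ¬ (e = 0 ∧ f = 0)) : sumCount 0 e f ≤ 6 := by
  rcases hne with hne | hne
  swap
  · exact (he.sumCount_zero_le_three hf hne).trans (by norm_num)
  rcases hnf with hnf | hnf
  swap
  · rw [sumCount_comm]
    exact (hf.sumCount_zero_le_three he hnf).trans (by norm_num)
  have m := he.monotone_table hf 0
  have h' : ¬ (0 ≤ e 0 ∧ 0 ≤ f 0) := fun ⟨a, b⟩ => h ⟨he.eq_zero a, hf.eq_zero b⟩
  obtain ⟨h1, h2, h3, h4⟩ := he
  obtain ⟨h5, h6, h7, h8⟩ := hf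
  rw [sumCount_eq]
  have a := ind_of_not (p := 0 ≤ e 0 + f 0) fun _ => h' ⟨by linarith, by linarith⟩
  have b : ind (0 ≤ e 0 + f 1) + ind (0 ≤ e 2 + f 0) ≤ 1 :=
    ind_add_le_one fun _ _ => h' ⟨by linarith, by linarith⟩
  have c : ind (0 ≤ e 1 + f 0) + ind (0 ≤ e 0 + f 2) ≤ 1 :=
    ind_add_le_one fun _ _ => h' ⟨by linarith, by linarith⟩
  omega

/-- A triple of reals that is bounded below by `-1` and has a sum of at most `0`. -/
structure LowTriple (e : Fin 3 → ℝ) : Prop where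
  low : ∀ i, -1 ≤ e i
  sum : ∑ i, e i ≤ 0

lemma LowTriple.sumCount_one_le {e f : Fin 3 → ℝ} (he : LowTriple e) (hf : LowTriple f) :
    sumCount 1 e f ≤ 5 := by
  obtain ⟨σ, hσ⟩ := exists_perm_sortedTriple he.1 he.2
  obtain ⟨τ, hτ⟩ := exists_perm_sortedTriple hf.1 hf.2
  rw [← sumCount_perm 1 e f σ τ]
  exact hσ.sumCount_one_le hτ

lemma LowTriple.count_le {α : ℝ} (hα : -1 ≤ α) {e f : Fin 3 → ℝ} (he : LowTriple e)
    (hf : LowTriple f) :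
    restrictedCount α e f + sumCount (-α) e f ≤ 10 ∨ α = 1 / 2 ∧ IsSplit e ∧ IsSplit f := by
  obtain ⟨σ, hσ⟩ := exists_perm_sortedTriple he.1 he.2
  obtain ⟨τ, hτ⟩ := exists_perm_sortedTriple hf.1 hf.2
  rw [← sumCount_perm _ e f σ τ, ← restrictedCount_perm _ e f σ τ, ← isSplit_perm (e := e) σ,
    ← isSplit_perm (e := f) τ]
  rcases le_or_gt 0 α with h | h
  · exact hσ.count_le_nonneg h hτ
  · have h1 := restrictedCount_le_sumCount α (e ∘ σ) (f ∘ τ)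
    have h2 := hσ.sumCount_add_neg hτ (s := -α) (by linarith) (by linarith)
    left
    omega

open scoped Classical in
/-- The upper bound for the table count at the critical value `1 / 2`. -/
lemma LowTriple.count_half_le {e f : Fin 3 → ℝ} (he : LowTriple e) (hf : LowTriple f) :
    (restrictedCount (1 / 2) e f + sumCount (-(1 / 2)) e f : ℝ) ≤
      10 + 2 * (ind (IsSplit e) * ind (IsSplit f)) - 4 * (ind (IsSplit e) * ind (f = 0))
        - 4 * (ind (e = 0) * ind (IsSplit f)) := by
  have main := LowTriple.count_le (α := 1 / 2) (by norm_num) he hf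
  obtain ⟨σ, hσ⟩ := exists_perm_sortedTriple he.1 he.2
  obtain ⟨τ, hτ⟩ := exists_perm_sortedTriple hf.1 hf.2
  rw [← sumCount_perm _ e f σ τ, ← restrictedCount_perm _ e f σ τ, ← isSplit_perm (e := e) σ,
    ← isSplit_perm (e := f) τ, ← zero_perm (e := e) σ, ← zero_perm (e := f) τ] at *
  generalize e ∘ σ = e at *
  generalize f ∘ τ = f at *
  have hz : ¬ IsSplit 0 := by
    rintro ⟨i, hi, _⟩
    norm_num at hi
  -- The bounds are 12 for two split triples, 6 for a split and a zero triple, and 10 otherwise.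
  by_cases h1 : IsSplit e <;> by_cases h2 : IsSplit f
  · have := count_split_split hσ hτ h1 h2
    rw [ind_of h1, ind_of h2, ind_of_not (p := e = 0) (by rintro rfl; exact hz h1),
      ind_of_not (p := f = 0) (by rintro rfl; exact hz h2)]
    norm_num
    exact_mod_cast this
  · by_cases h3 : f = 0
    · subst h3
      have := count_split_zero hσ h1
      rw [ind_of h1, ind_of_not h2, ind_of rfl]
      norm_num
      exact_mod_cast this
    · rw [ind_of h1, ind_of_not h2, ind_of_not h3]
      norm_num
      exact_mod_cast main.resolve_right (by tauto)
  · by_cases h3 : e = 0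
    · subst h3
      have := count_split_zero hτ h2
      rw [restrictedCount_comm, sumCount_comm] at this
      rw [ind_of h2, ind_of_not h1, ind_of rfl]
      norm_num
      exact_mod_cast this
    · rw [ind_of h2, ind_of_not h1, ind_of_not h3]
      norm_num
      exact_mod_cast main.resolve_right (by tauto)
  · rw [ind_of_not h1, ind_of_not h2]
    norm_num
    exact_mod_cast main.resolve_right (by tauto)

lemma nonneg_one_or {e : Fin 3 → ℝ} (σ : Equiv.Perm (Fin 3)) (hσ : SortedTriple (e ∘ σ))
    (h : (∀ i j, i ≠ j → e i < 0 → 0 ≤ e j) ∨ ∀ i, e i = -1) :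
    0 ≤ (e ∘ σ) 1 ∨ (e ∘ σ) 2 = -1 := by
  rcases h with h | h
  · left
    by_contra hlt
    push Not at hlt
    have h1 := h (σ 1) (σ 0) (by simp) hlt
    have := hσ.le01
    simp only [Function.comp] at *
    linarith
  · exact .inr (h _)

/-- The upper bound for the number of entries of a sum table that are at least `β ≥ 0`. -/
lemma LowTriple.sumCount_le {β : ℝ} (hβ : 0 ≤ β) {e f : Fin 3 → ℝ} (he : LowTriple e)
    (hf : LowTriple f)
    (hne : β = 0 → (∀ i j, i ≠ j → e i < 0 → 0 ≤ e j) ∨ ∀ i, e i = -1)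
    (hnf : β = 0 → (∀ i j, i ≠ j → f i < 0 → 0 ≤ f j) ∨ ∀ i, f i = -1) :
    (sumCount β e f : ℝ) ≤
      6 - 2 * (ind (IsSplit e) * ind (IsSplit f)) + 3 * (ind (e = 0) * ind (f = 0)) := by
  obtain ⟨σ, hσ⟩ := exists_perm_sortedTriple he.1 he.2
  obtain ⟨τ, hτ⟩ := exists_perm_sortedTriple hf.1 hf.2
  replace hne := fun h => nonneg_one_or σ hσ (hne h)
  replace hnf := fun h => nonneg_one_or τ hτ (hnf h)
  rw [← sumCount_perm _ e f σ τ, ← isSplit_perm (e := e) σ,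
    ← isSplit_perm (e := f) τ, ← zero_perm (e := e) σ, ← zero_perm (e := f) τ]
  clear he hf
  generalize e ∘ σ = e at *
  generalize f ∘ τ = f at *
  have hz : ¬ IsSplit 0 := by
    rintro ⟨i, hi, _⟩
    norm_num at hi
  by_cases h1 : IsSplit e ∧ IsSplit f
  · obtain ⟨h1, h2⟩ := h1
    have := sumCount_split_split hβ hσ hτ h1 h2
    rw [ind_of h1, ind_of h2, ind_of_not (p := e = 0) (by rintro rfl; exact hz h1)]
    norm_num
    exact_mod_cast this
  have h1' : ((ind (IsSplit e) : ℝ) * ind (IsSplit f)) = 0 := by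
    by_cases h : IsSplit e
    · rw [ind_of_not fun h' => h1 ⟨h, h'⟩]; simp
    · rw [ind_of_not h]; simp
  rw [h1']
  by_cases h2 : e = 0 ∧ f = 0
  · rw [ind_of h2.1, ind_of h2.2]
    have : sumCount β e f ≤ ∑ _i : Fin 3, ∑ _j : Fin 3, 1 :=
      Finset.sum_le_sum fun _ _ => Finset.sum_le_sum fun _ _ => ind_le_one _
    norm_num at this ⊢
    exact_mod_cast this
  · have h3 : sumCount β e f ≤ 6 := by
      rcases hβ.eq_or_lt with h | h
      · rw [← h]
        exact hσ.sumCount_zero_le hτ (hne h.symm) (hnf h.symm) h2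
      · exact hσ.sumCount_pos_le hτ h
    have : (sumCount β e f : ℝ) ≤ 6 := by exact_mod_cast h3
    have : (0 : ℝ) ≤ (ind (e = 0) : ℝ) * ind (f = 0) := by positivity
    linarith

/-! ### Duality and complementary slackness -/

section LinearProgram

variable {ι : Type*} [Fintype ι]

/-- The feasible region of the dual program: weights that are at least `-1`, nonnegative on every
triple of `F`, and have a nonpositive sum. -/
def feasible (F : Set (Fin 3 → ι)) : Set (ι → ℝ) :=
  {z | (∀ v, -1 ≤ z v) ∧ (∀ f ∈ F, 0 ≤ ∑ i, z (f i)) ∧ ∑ v, z v ≤ 0}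

/-- The triples that are tight for the weight `z`. -/
def tight (F : Set (Fin 3 → ι)) (z : ι → ℝ) : Set (Fin 3 → ι) :=
  {f | (f ∈ F ∧ ∑ i, z (f i) = 0) ∨ ∃ v, z v = -1 ∧ f = fun _ => v}

lemma isCompact_feasible (F : Set (Fin 3 → ι)) : IsCompact (feasible F) := by
  have hc : IsClosed (feasible F) := by
    have h1 : IsClosed {z : ι → ℝ | ∀ v, -1 ≤ z v} := by
      simp only [Set.ofPred_forall]
      exact isClosed_iInter fun v => isClosed_le continuous_const (continuous_apply v)
    have h2 : IsClosed {z : ι → ℝ | ∀ f ∈ F, 0 ≤ ∑ i, z (f i)} := by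
      simp only [Set.ofPred_forall]
      exact isClosed_iInter fun f => isClosed_iInter fun _ =>
        isClosed_le continuous_const (continuous_finsetSum _ fun i _ => continuous_apply (f i))
    have h3 : IsClosed {z : ι → ℝ | ∑ v, z v ≤ 0} :=
      isClosed_le (continuous_finsetSum _ fun i _ => continuous_apply i) continuous_const
    exact h1.inter (h2.inter h3)
  refine IsCompact.of_isClosed_subset
    (isCompact_univ_pi fun _ : ι => isCompact_Icc (a := (-1 : ℝ)) (b := Fintype.card ι)) hc ?_
  rintro z ⟨h1, -, h3⟩ v -
  refine ⟨h1 v, ?_⟩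
  classical
  have h4 : ∑ w, (z w + 1) ≤ Fintype.card ι := by
    rw [Finset.sum_add_distrib]
    simp
    linarith
  have h5 : z v + 1 ≤ ∑ w, (z w + 1) :=
    Finset.single_le_sum (f := fun w => z w + 1) (fun w _ => by linarith [h1 w])
      (Finset.mem_univ v)
  linarith

lemma zero_mem_feasible (F : Set (Fin 3 → ι)) : (0 : ι → ℝ) ∈ feasible F := by
  simp [feasible]

lemma exists_minimizer (F : Set (Fin 3 → ι)) :
    ∃ z ∈ feasible F, ∀ y ∈ feasible F, ∑ v, z v ≤ ∑ v, y v := by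
  obtain ⟨z, hz, h⟩ := (isCompact_feasible F).exists_isMinOn ⟨0, zero_mem_feasible F⟩
    (f := fun z : ι → ℝ => ∑ v, z v)
    (continuous_finsetSum _ fun i _ => continuous_apply i).continuousOn
  exact ⟨z, hz, fun y hy => h hy⟩

/-- A fractional decomposition of the uniform weight into triples from `F`. -/
structure IsDecomposition (F : Set (Fin 3 → ι)) (x : (Fin 3 → ι) → ℝ) : Prop where
  nonneg : ∀ f, 0 ≤ x f
  mem : ∀ f, x f ≠ 0 → f ∈ F
  sum_eq_one : ∑ f, x f = 1
  marginal : ∀ φ : ι → ℝ, ∑ f, x f * ∑ i, φ (f i) = 3 / Fintype.card ι * ∑ v, φ v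

/-- If no fractional decomposition into triples of `T` exists, then some direction is positive on
every triple of `T` but has a negative sum. -/
lemma exists_direction [Nonempty ι] (T : Set (Fin 3 → ι)) (hT : ¬ ∃ x, IsDecomposition T x) :
    ∃ d : ι → ℝ, (∀ f ∈ T, 0 < ∑ i, d (f i)) ∧ ∑ v, d v < 0 := by
  classical
  have hcard : (0 : ℝ) < Fintype.card ι := by exact_mod_cast Fintype.card_pos
  let L : ((Fin 3 → ι) → ℝ) →ₗ[ℝ] (ι → ℝ) :=
    ∑ f, (LinearMap.proj f : ((Fin 3 → ι) → ℝ) →ₗ[ℝ] ℝ).smulRight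
      (∑ i, Pi.single (f i) (1 : ℝ))
  have hL : ∀ (x : (Fin 3 → ι) → ℝ) (φ : ι → ℝ),
      ∑ v, L x v * φ v = ∑ f, x f * ∑ i, φ (f i) := by
    intro x φ
    simp only [L, LinearMap.sum_apply, LinearMap.smulRight_apply, LinearMap.proj_apply,
      Finset.sum_apply, Pi.smul_apply, smul_eq_mul, Finset.sum_mul, Finset.mul_sum]
    rw [Finset.sum_comm]
    refine Finset.sum_congr rfl fun f _ => ?_
    rw [Finset.sum_comm]
    refine Finset.sum_congr rfl fun i _ => ?_
    simp [Pi.single_apply]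
  set K : Set ((Fin 3 → ι) → ℝ) := stdSimplex ℝ (Fin 3 → ι) ∩ {x | ∀ f, f ∉ T → x f = 0} with hK
  have hKconv : Convex ℝ K := by
    refine (convex_stdSimplex ℝ _).inter ?_
    intro x hx y hy a b _ _ _ f hf
    simp [hx f hf, hy f hf]
  have hKcomp : IsCompact K := by
    refine (isCompact_stdSimplex ℝ _).inter_right ?_
    simp only [Set.ofPred_forall]
    exact isClosed_iInter fun f => isClosed_iInter fun _ =>
      isClosed_eq (continuous_apply f) continuous_const
  have hconv : Convex ℝ (L '' K) := hKconv.linear_image L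
  have hcomp : IsCompact (L '' K) := hKcomp.image (LinearMap.continuous_of_finiteDimensional L)
  -- The target has total 3, the number of entries of a triple.
  let u : ι → ℝ := fun _ => 3 / Fintype.card ι
  have hu : u ∉ L '' K := by
    rintro ⟨x, ⟨⟨hx0, hx1⟩, hxT⟩, hx⟩
    refine hT ⟨x, hx0, fun f hf => by_contra fun h => hf (hxT f h), hx1, fun φ => ?_⟩
    rw [← hL, hx, Finset.mul_sum]
  obtain ⟨g, s, hgu, hgC⟩ := geometric_hahn_banach_point_closed hconv hcomp.isClosed hu
  have hg : ∀ y : ι → ℝ, g y = ∑ v, y v * g (Pi.single v 1) := by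
    intro y
    conv_lhs => rw [pi_eq_sum_univ' y]
    simp only [map_sum, map_smul, smul_eq_mul]
  -- The separating functional exceeds s on triples and is below s on the uniform weight, both of
  -- total mass 3; subtracting s / 3 at each vertex moves the threshold to 0.
  refine ⟨fun v => g (Pi.single v 1) - s / 3, fun f hf => ?_, ?_⟩
  · have h1 := hgC _ ⟨Pi.single f 1, ⟨single_mem_stdSimplex ℝ f, fun f' hf' => ?_⟩, rfl⟩
    · rw [hg, hL] at h1
      simp [Pi.single_apply, Finset.sum_sub_distrib] at h1 ⊢
      linarith
    · rw [Pi.single_apply, if_neg]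
      rintro rfl
      exact hf' hf
  · rw [hg] at hgu
    simp only [u, ← Finset.mul_sum] at hgu
    rw [Finset.sum_sub_distrib]
    simp only [Finset.sum_const, Finset.card_univ, nsmul_eq_mul]
    rw [div_mul_eq_mul_div, div_lt_iff₀ hcard] at hgu
    linarith

/-- The uniform weight is a mixture of the triples that are tight for an optimal dual solution. -/
lemma exists_decomposition_tight [Nonempty ι] (F : Set (Fin 3 → ι)) {z : ι → ℝ}
    (hz : z ∈ feasible F) (hmin : ∀ y ∈ feasible F, ∑ v, z v ≤ ∑ v, y v) :
    ∃ x, IsDecomposition (tight F z) x := by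
  by_contra hcon
  obtain ⟨d, hd, hneg⟩ := exists_direction _ hcon
  obtain ⟨hz1, hz2, hz3⟩ := hz
  have hlim : ∀ a b : ℝ, Filter.Tendsto (fun ε : ℝ => a + ε * b) (nhdsWithin 0 (Set.Ioi 0))
      (nhds a) := by
    intro a b
    have : Filter.Tendsto (fun ε : ℝ => a + ε * b) (nhds 0) (nhds (a + 0 * b)) :=
      (Continuous.tendsto (by fun_prop) 0)
    rw [zero_mul, add_zero] at this
    exact this.mono_left nhdsWithin_le_nhds
  -- Slack bounds survive a small ε. Where z v = -1, the constant triple at v is tight, so d v > 0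
  -- and the bound only improves.
  have e1 : ∀ᶠ ε : ℝ in nhdsWithin 0 (Set.Ioi 0), ∀ v, -1 ≤ z v + ε * d v := by
    rw [Filter.eventually_all]
    intro v
    rcases (hz1 v).eq_or_lt with h | h
    · have h1 := hd _ (.inr ⟨v, h.symm, rfl⟩)
      simp only [Finset.sum_const, Finset.card_univ, Fintype.card_fin, nsmul_eq_mul] at h1
      filter_upwards [self_mem_nhdsWithin] with ε hε
      have : 0 < ε * d v := mul_pos hε (by push_cast at h1; linarith)
      linarith
    · exact ((hlim (z v) (d v)).eventually_const_lt h).mono fun _ h => h.le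
  have e2 : ∀ᶠ ε : ℝ in nhdsWithin 0 (Set.Ioi 0), ∀ f, f ∈ F →
      0 ≤ ∑ i, z (f i) + ε * ∑ i, d (f i) := by
    rw [Filter.eventually_all]
    intro f
    by_cases hf : f ∈ F
    · rcases (hz2 f hf).eq_or_lt with h | h
      · have h1 := hd _ (.inl ⟨hf, h.symm⟩)
        filter_upwards [self_mem_nhdsWithin] with ε hε _
        have : 0 < ε * ∑ i, d (f i) := mul_pos hε h1
        linarith
      · exact ((hlim _ _).eventually_const_lt h).mono fun _ h _ => h.le
    · exact Filter.Eventually.of_forall fun _ h => absurd h hf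
  obtain ⟨ε, ⟨he1, he2⟩, hε⟩ := ((e1.and e2).and self_mem_nhdsWithin).exists
  have hε' : 0 < ε := hε
  have hsum : ∑ v, (z v + ε * d v) = ∑ v, z v + ε * ∑ v, d v := by
    rw [Finset.sum_add_distrib, Finset.mul_sum]
  have hlt : ε * ∑ v, d v < 0 := mul_neg_of_pos_of_neg hε' hneg
  have := hmin (fun v => z v + ε * d v) ⟨he1, fun f hf => ?_, ?_⟩
  · rw [hsum] at this
    linarith
  · rw [Finset.sum_add_distrib, ← Finset.mul_sum]
    exact he2 f hf
  · rw [hsum]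
    linarith

end LinearProgram

/-! ### Perfect fractional matchings from the degree condition -/

section FractionalMatching

variable {ι : Type*} [Fintype ι]

/-- The number of ordered pairs that form a triple of `R` together with `v`. -/
noncomputable def pairDegree (R : ι → ι → ι → Prop) (v : ι) : ℕ := ∑ a, ∑ b, ind (R v a b)

/-- A uniform vertex is a random entry of a random triple; applying the marginal identity in both
coordinates turns sums over pairs of vertices into averages of table sums. -/
lemma IsDecomposition.sum_sum [Nonempty ι] {T : Set (Fin 3 → ι)} {x : (Fin 3 → ι) → ℝ}
    (hx : IsDecomposition T x) (ψ : ι → ι → ℝ) :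
    ∑ a, ∑ b, ψ a b = (Fintype.card ι / 3 : ℝ) ^ 2 *
      ∑ f, ∑ f', x f * x f' * ∑ i, ∑ j, ψ (f i) (f' j) := by
  have hcard : (0 : ℝ) < Fintype.card ι := by exact_mod_cast Fintype.card_pos
  have h1 : ∀ φ : ι → ℝ, ∑ v, φ v = (Fintype.card ι / 3 : ℝ) * ∑ f, x f * ∑ i, φ (f i) := by
    intro φ
    rw [hx.marginal φ]
    field_simp
  rw [h1, pow_two, mul_assoc]
  congr 1
  rw [Finset.mul_sum]
  refine Finset.sum_congr rfl fun f _ => ?_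
  simp only [h1 (fun b => ψ _ b)]
  simp only [Finset.mul_sum]
  rw [Finset.sum_comm]
  refine Finset.sum_congr rfl fun f' _ => ?_
  refine Finset.sum_congr rfl fun i _ => ?_
  refine Finset.sum_congr rfl fun j _ => ?_
  ring

lemma IsDecomposition.sum_sum_le [Nonempty ι] {T : Set (Fin 3 → ι)} {x : (Fin 3 → ι) → ℝ}
    (hx : IsDecomposition T x) (ψ : ι → ι → ℝ) (B : (Fin 3 → ι) → (Fin 3 → ι) → ℝ)
    (hB : ∀ f ∈ T, ∀ f' ∈ T, ∑ i, ∑ j, ψ (f i) (f' j) ≤ B f f') :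
    ∑ a, ∑ b, ψ a b ≤ (Fintype.card ι / 3 : ℝ) ^ 2 * ∑ f, ∑ f', x f * x f' * B f f' := by
  rw [hx.sum_sum]
  refine mul_le_mul_of_nonneg_left ?_ (by positivity)
  refine Finset.sum_le_sum fun f _ => Finset.sum_le_sum fun f' _ => ?_
  by_cases h : x f = 0
  · simp [h]
  by_cases h' : x f' = 0
  · simp [h']
  exact mul_le_mul_of_nonneg_left (hB f (hx.mem f h) f' (hx.mem f' h'))
    (mul_nonneg (hx.nonneg f) (hx.nonneg f'))

/-- Suppose the dual optimum is negative. Then q and o, the proportions of split and of zero triples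
in a mixture of tight triples, satisfy two incompatible inequalities: one comes from a vertex of
weight -1 and its lightest neighbour, the other from the lightest vertex of large degree. -/
lemma exists_decomposition [Nonempty ι] (R : ι → ι → ι → Prop)
    (hswap : ∀ a b c, R a b c → R b a c) (hswap' : ∀ a b c, R a b c → R a c b)
    (hiso : ∀ v, ∃ a b, R v a b)
    (hadj : ∀ u v w, R u v w →
      6 / 5 * (Fintype.card ι : ℝ) ^ 2 ≤ pairDegree R u + pairDegree R v)
    (hW : (3 * ∑ v, ind ((pairDegree R v : ℝ) < 3 / 5 * (Fintype.card ι : ℝ) ^ 2) : ℕ)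
      ≤ Fintype.card ι) :
    ∃ x, IsDecomposition {f | R (f 0) (f 1) (f 2)} x := by
  set F : Set (Fin 3 → ι) := {f | R (f 0) (f 1) (f 2)} with hF
  set m : ℝ := (Fintype.card ι : ℝ) with hm
  have hcard : (0 : ℝ) < m := by rw [hm]; exact_mod_cast Fintype.card_pos
  obtain ⟨z, hz, hmin⟩ := exists_minimizer F
  -- If the optimum is 0, the zero weight is optimal and no bound -1 is tight for it, so its tight
  -- triples are edges.
  rcases hz.2.2.eq_or_lt with h0 | hneg
  · obtain ⟨x, hx⟩ := exists_decomposition_tight F (zero_mem_feasible F)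
      (fun y hy => by simpa [h0] using hmin y hy)
    refine ⟨x, hx.nonneg, fun f hf => ?_, hx.sum_eq_one, hx.marginal⟩
    rcases hx.mem f hf with ⟨h, -⟩ | ⟨v, h, -⟩
    · exact h
    · norm_num at h
  exfalso
  obtain ⟨x, hx⟩ := exists_decomposition_tight F hz hmin
  obtain ⟨hz1, hz2, -⟩ := hz
  have hlow : ∀ f ∈ tight F z, LowTriple (z ∘ f) := by
    rintro f (⟨hf, h⟩ | ⟨v, hv, rfl⟩)
    · exact ⟨fun i => hz1 _, h.le⟩
    · refine ⟨fun i => hz1 _, ?_⟩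
      simp [hv]
  have hedge : ∀ a b c, R a b c → 0 ≤ z a + z b + z c := fun a b c h => by
    have := hz2 ![a, b, c] h
    simpa [Fin.sum_univ_three] using this
  have hsum2 : ∑ f, ∑ f', x f * x f' = 1 := by
    rw [← Finset.sum_mul_sum, hx.sum_eq_one, one_mul]
  have hmul : ∀ (c : ℝ) (p q : (Fin 3 → ι) → ℝ), ∑ f, ∑ f', x f * x f' * (c * (p f * q f')) =
      c * ((∑ f, x f * p f) * ∑ f, x f * q f) := by
    intro c p q
    rw [Finset.sum_mul_sum, Finset.mul_sum]
    refine Finset.sum_congr rfl fun f _ => ?_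
    rw [Finset.mul_sum]
    refine Finset.sum_congr rfl fun f' _ => ?_
    ring
  have hlin : ∀ (c a b d e : ℝ) (p r : (Fin 3 → ι) → ℝ), ∑ f, ∑ f', x f * x f' *
      (c + a * (p f * p f') + b * (p f * r f') + d * (r f * p f') + e * (r f * r f')) =
      c + a * ((∑ f, x f * p f) * ∑ f, x f * p f) + b * ((∑ f, x f * p f) * ∑ f, x f * r f) +
      d * ((∑ f, x f * r f) * ∑ f, x f * p f) + e * ((∑ f, x f * r f) * ∑ f, x f * r f) := by
    intro c a b d e p r
    simp only [mul_add, Finset.sum_add_distrib, hmul]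
    simp only [← Finset.sum_mul, hsum2, one_mul]
  -- vertices of minimum weight have a small degree
  have hsmall : ∀ v, z v = -1 → (pairDegree R v : ℝ) < 3 / 5 * m ^ 2 := by
    intro v hv
    have h1 := hx.sum_sum_le (fun a b => (ind (1 ≤ z a + z b) : ℝ)) (fun _ _ => 5)
      (fun f hf f' hf' => by
        have := (hlow f hf).sumCount_one_le (hlow f' hf')
        unfold sumCount at this
        exact_mod_cast this)
    simp only [← Finset.sum_mul, hsum2] at h1
    have h2 : (pairDegree R v : ℝ) ≤ ∑ a, ∑ b, (ind (1 ≤ z a + z b) : ℝ) := by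
      unfold pairDegree
      push_cast
      refine Finset.sum_le_sum fun a _ => Finset.sum_le_sum fun b _ => ?_
      exact_mod_cast ind_mono fun h => by linarith [hedge _ _ _ h]
    have : 0 < m ^ 2 := by positivity
    rw [← hm] at h1
    linarith [h2.trans h1]
  -- some vertex of weight `-1` is used as a constant triple
  obtain ⟨v0, hv0, hxv0⟩ : ∃ v, z v = -1 ∧ x (fun _ => v) ≠ 0 := by
    by_contra hcon
    push Not at hcon
    have h1 := hx.marginal z
    have h2 : ∑ f, x f * ∑ i, z (f i) = 0 := by
      refine Finset.sum_eq_zero fun f _ => ?_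
      by_cases h : x f = 0
      · rw [h, zero_mul]
      · rcases hx.mem f h with ⟨_, h'⟩ | ⟨v, hv, rfl⟩
        · rw [h', mul_zero]
        · exact absurd (hcon v hv) h
    rw [h2] at h1
    have : 3 / m * ∑ v, z v < 0 := mul_neg_of_pos_of_neg (by positivity) hneg
    linarith
  -- a neighbour of `v0` of minimum weight
  classical
  obtain ⟨a0, ha0, hα⟩ : ∃ a0, (∃ b, R v0 a0 b) ∧ ∀ a, (∃ b, R v0 a b) → z a0 ≤ z a := by
    obtain ⟨a, b, hab⟩ := hiso v0
    obtain ⟨a0, h1, h2⟩ := Finset.exists_min_image (Finset.univ.filter fun a => ∃ b, R v0 a b) z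
      ⟨a, by simpa using ⟨b, hab⟩⟩
    refine ⟨a0, by simpa using h1, fun a ha => h2 a (by simpa using ha)⟩
  obtain ⟨b0, hb0⟩ := ha0
  -- In the link of `v0` all vertices weigh at least z a0 and pairs weigh at least 1; in the link of
  -- `a0` pairs weigh at least -z a0. The value 54/5 is 9 · 6/5.
  have hG : ∀ B : (Fin 3 → ι) → (Fin 3 → ι) → ℝ,
      (∀ f ∈ tight F z, ∀ f' ∈ tight F z, (restrictedCount (z a0) (z ∘ f) (z ∘ f') +
        sumCount (-z a0) (z ∘ f) (z ∘ f') : ℝ) ≤ B f f') →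
      54 / 5 ≤ ∑ f, ∑ f', x f * x f' * B f f' := by
    intro B hB
    have h1 := hx.sum_sum_le (fun a b => (ind (z a0 ≤ z a ∧ z a0 ≤ z b ∧ 1 ≤ z a + z b) +
      ind (-z a0 ≤ z a + z b) : ℝ)) B (fun f hf f' hf' => by
        refine le_trans (le_of_eq ?_) (hB f hf f' hf')
        simp [restrictedCount, sumCount, Finset.sum_add_distrib])
    have h2 : (pairDegree R v0 + pairDegree R a0 : ℝ) ≤ ∑ a, ∑ b,
        (ind (z a0 ≤ z a ∧ z a0 ≤ z b ∧ 1 ≤ z a + z b) + ind (-z a0 ≤ z a + z b) : ℝ) := by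
      unfold pairDegree
      push_cast
      rw [← Finset.sum_add_distrib]
      refine Finset.sum_le_sum fun a _ => ?_
      rw [← Finset.sum_add_distrib]
      refine Finset.sum_le_sum fun b _ => add_le_add ?_ ?_
      · have : ind (R v0 a b) ≤ ind (z a0 ≤ z a ∧ z a0 ≤ z b ∧ 1 ≤ z a + z b) :=
          ind_mono fun h => ⟨hα a ⟨b, h⟩, hα b ⟨a, hswap' _ _ _ h⟩,
            by linarith [hedge _ _ _ h]⟩
        exact_mod_cast this
      · exact_mod_cast ind_mono fun h => by linarith [hedge _ _ _ h]
    have h3 := hadj v0 a0 b0 hb0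
    have h4 : 0 < m ^ 2 := by positivity
    have h5 := (h3.trans h2).trans h1
    rw [← hm] at h5
    by_contra hlt
    push Not at hlt
    have := mul_lt_mul_of_pos_left hlt h4
    linarith
  have hhalf : z a0 = 1 / 2 := by
    by_contra hne
    have := hG (fun _ _ => 10) (fun f hf f' hf' => by
      have := (LowTriple.count_le (hz1 a0) (hlow f hf) (hlow f' hf')).resolve_right
        (fun h => hne h.1)
      exact_mod_cast this)
    simp only [← Finset.sum_mul, hsum2] at this
    norm_num at this
  set q : ℝ := ∑ f, x f * ind (IsSplit (z ∘ f)) with hq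
  set o : ℝ := ∑ f, x f * ind (z ∘ f = 0) with ho
  have hq0 : 0 ≤ q := Finset.sum_nonneg fun f _ => mul_nonneg (hx.nonneg f) (by positivity)
  have ho0 : 0 ≤ o := Finset.sum_nonneg fun f _ => mul_nonneg (hx.nonneg f) (by positivity)
  have ho1 : o ≤ 1 := by
    rw [← hx.sum_eq_one]
    refine Finset.sum_le_sum fun f _ => mul_le_of_le_one_right (hx.nonneg f) ?_
    exact_mod_cast ind_le_one _
  have hGq : 54 / 5 ≤ 10 + 2 * (q * q) - 8 * (q * o) := by
    have := hG (fun f f' => 10 + 2 * (ind (IsSplit (z ∘ f)) * ind (IsSplit (z ∘ f'))) +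
        (-4) * (ind (IsSplit (z ∘ f)) * ind (z ∘ f' = 0)) +
        (-4) * (ind (z ∘ f = 0) * ind (IsSplit (z ∘ f'))) +
        0 * (ind (z ∘ f = 0) * ind (z ∘ f' = 0))) (fun f hf f' hf' => by
      rw [hhalf]
      linarith [(hlow f hf).count_half_le (hlow f' hf')])
    rw [hlin 10 2 (-4) (-4) 0 (fun f => ind (IsSplit (z ∘ f))) (fun f => ind (z ∘ f = 0))] at this
    linarith
  -- a tight edge that consists of vertices of large degree
  set W : ι → Prop := fun v => (pairDegree R v : ℝ) < 3 / 5 * m ^ 2 with hWdef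
  obtain ⟨f0, hf0, hf0W⟩ : ∃ f, x f ≠ 0 ∧ ∀ i, ¬ W (f i) := by
    by_contra hcon
    push Not at hcon
    have h1 := hx.marginal (fun v => (ind (W v) : ℝ))
    have h2 : 3 * ∑ v, (ind (W v) : ℝ) ≤ m := by
      rw [hm]
      exact_mod_cast hW
    have h3 : 3 / m * ∑ v, (ind (W v) : ℝ) ≤ 1 := by
      rw [div_mul_eq_mul_div, div_le_one hcard]
      exact h2
    -- If every triple of the mixture met `W`, the average number of entries in `W` would exceed 1,
    -- because the constant triple at `v0` contributes 3. But |W| ≤ n/3 makes that average at most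
    -- 1.
    have h4 : ∑ f, x f * ∑ i, (ind (W (f i)) : ℝ) > ∑ f, x f := by
      refine Finset.sum_lt_sum (fun f _ => ?_) ⟨fun _ => v0, Finset.mem_univ _, ?_⟩
      · by_cases h : x f = 0
        · simp [h]
        · refine le_mul_of_one_le_right (hx.nonneg f) ?_
          obtain ⟨i, hi⟩ := hcon f h
          have : ind (W (f i)) ≤ ∑ i, ind (W (f i)) :=
            Finset.single_le_sum (f := fun i => ind (W (f i))) (fun _ _ => Nat.zero_le _)
              (Finset.mem_univ i)
          rw [ind_of hi] at this
          exact_mod_cast this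
      · have : W v0 := hsmall v0 hv0
        have h5 : 0 < x fun _ => v0 := lt_of_le_of_ne (hx.nonneg _) (Ne.symm hxv0)
        simp [ind_of this]
        linarith
    rw [hx.sum_eq_one] at h4
    linarith
  have hf0z : ∑ i, z (f0 i) = 0 := by
    rcases hx.mem f0 hf0 with ⟨_, h⟩ | ⟨v, hv, rfl⟩
    · exact h
    · exact absurd (hsmall v hv) (hf0W 0)
  obtain ⟨u0, hu0, hβ⟩ : ∃ u0, ¬ W u0 ∧ ∀ u, ¬ W u → z u0 ≤ z u := by
    obtain ⟨a0, h1, h2⟩ := Finset.exists_min_image (Finset.univ.filter fun a => ¬ W a) z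
      ⟨f0 0, by simpa using hf0W 0⟩
    refine ⟨a0, by simpa using h1, fun a ha => h2 a (by simpa using ha)⟩
  have hu0z : z u0 ≤ 0 := by
    by_contra hlt
    push Not at hlt
    have : 0 < ∑ i, z (f0 i) :=
      Finset.sum_pos (fun i _ => hlt.trans_le (hβ _ (hf0W i))) Finset.univ_nonempty
    linarith
  -- When z u0 = 0, negative vertices lie in `W`, and two adjacent vertices of `W` would violate the
  -- degree sum; so a tight edge has at most one negative entry.
  have hstruct : -z u0 = 0 → ∀ f ∈ tight F z,
      (∀ i j, i ≠ j → (z ∘ f) i < 0 → 0 ≤ (z ∘ f) j) ∨ ∀ i, (z ∘ f) i = -1 := by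
    rintro hz0 f (⟨hf, h⟩ | ⟨v, hv, rfl⟩)
    · left
      intro i j hij hi
      by_contra hj
      push Not at hj
      have hWi : W (f i) := by
        by_contra h
        have := hβ _ h
        simp only [Function.comp] at hi
        linarith
      have hWj : W (f j) := by
        by_contra h
        have := hβ _ h
        simp only [Function.comp] at hj
        linarith
      have hR : ∃ w, R (f i) (f j) w := by
        have h1 : R (f 0) (f 1) (f 2) := hf
        have h2 := hswap _ _ _ h1
        have h3 := hswap' _ _ _ h1
        have h4 := hswap' _ _ _ h2
        have h5 := hswap _ _ _ h3
        have h6 := hswap _ _ _ h4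
        fin_cases i <;> fin_cases j <;> first | exact absurd rfl hij | exact ⟨_, by assumption⟩
      obtain ⟨w, hw⟩ := hR
      have := hadj _ _ _ hw
      simp only [hWdef] at hWi hWj
      linarith
    · exact .inr fun _ => hv
  have hK : 27 / 5 ≤ 6 - 2 * (q * q) + 3 * (o * o) := by
    have h1 := hx.sum_sum_le (fun a b => (ind (-z u0 ≤ z a + z b) : ℝ))
      (fun f f' => 6 + (-2) * (ind (IsSplit (z ∘ f)) * ind (IsSplit (z ∘ f'))) +
        0 * (ind (IsSplit (z ∘ f)) * ind (z ∘ f' = 0)) +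
        0 * (ind (z ∘ f = 0) * ind (IsSplit (z ∘ f'))) +
        3 * (ind (z ∘ f = 0) * ind (z ∘ f' = 0)))
      (fun f hf f' hf' => by
        have := LowTriple.sumCount_le (β := -z u0) (by linarith) (hlow f hf) (hlow f' hf')
          (fun h => hstruct h f hf) (fun h => hstruct h f' hf')
        refine le_trans (le_of_eq ?_) (this.trans (by linarith))
        simp [sumCount])
    have h2 : (pairDegree R u0 : ℝ) ≤ ∑ a, ∑ b, (ind (-z u0 ≤ z a + z b) : ℝ) := by
      unfold pairDegree
      push_cast
      refine Finset.sum_le_sum fun a _ => Finset.sum_le_sum fun b _ => ?_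
      exact_mod_cast ind_mono fun h => by linarith [hedge _ _ _ h]
    have h3 : 3 / 5 * m ^ 2 ≤ pairDegree R u0 := not_lt.1 hu0
    rw [hlin 6 (-2) 0 0 3 (fun f => ind (IsSplit (z ∘ f))) (fun f => ind (z ∘ f = 0)),
      ← hm] at h1
    have h4 : 0 < m ^ 2 := by positivity
    have h5 := (h3.trans h2).trans h1
    by_contra hlt
    push Not at hlt
    have := mul_lt_mul_of_pos_left hlt h4
    linarith
  -- From `hGq`, q² ≥ 2/5 > 9/25.
  have h6 : 3 / 5 ≤ q := by
    by_contra hlt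
    push Not at hlt
    nlinarith [mul_nonneg hq0 ho0]
  -- Adding `hGq` and `hK` gives 1/5 + 8qo ≤ 3o², whereas 8qo ≥ (24/5)o ≥ 3o².
  nlinarith [mul_le_mul_of_nonneg_right h6 ho0, mul_le_mul_of_nonneg_right ho1 ho0]

end FractionalMatching

/-! ### Disjoint unions of edges -/

section Matchable

variable {V : Type*} [DecidableEq V]

/-- A set of vertices is matchable if it is a disjoint union of edges. -/
def Matchable (E : Finset (Finset V)) (S : Finset V) : Prop :=
  ∃ M ⊆ E, (M : Set (Finset V)).PairwiseDisjoint id ∧ M.biUnion id = S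

lemma matchable_empty (E : Finset (Finset V)) : Matchable E ∅ :=
  ⟨∅, Finset.empty_subset _, by simp, rfl⟩

lemma matchable_of_mem {E : Finset (Finset V)} {e : Finset V} (he : e ∈ E) : Matchable E e :=
  ⟨{e}, by simpa using he, by simp, by simp⟩

lemma Matchable.mono {E E' : Finset (Finset V)} {S : Finset V} (h : Matchable E S)
    (hE : E ⊆ E') : Matchable E' S := by
  obtain ⟨M, h1, h2, h3⟩ := h
  exact ⟨M, h1.trans hE, h2, h3⟩

lemma Matchable.union {E : Finset (Finset V)} {S T : Finset V} (hS : Matchable E S)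
    (hT : Matchable E T) (h : Disjoint S T) : Matchable E (S ∪ T) := by
  obtain ⟨M, h1, h2, h3⟩ := hS
  obtain ⟨N, k1, k2, k3⟩ := hT
  refine ⟨M ∪ N, Finset.union_subset h1 k1, ?_, by rw [Finset.union_biUnion, h3, k3]⟩
  rw [Finset.coe_union, Set.pairwiseDisjoint_union]
  refine ⟨h2, k2, fun e he f hf _ => ?_⟩
  refine Finset.disjoint_of_subset_left ?_ (Finset.disjoint_of_subset_right ?_ h)
  · rw [← h3]
    exact Finset.subset_biUnion_of_mem id he
  · rw [← k3]
    exact Finset.subset_biUnion_of_mem id hf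

lemma Matchable.biUnion {E : Finset (Finset V)} {κ : Type*} (s : Finset κ) (t : κ → Finset V)
    (h : ∀ i ∈ s, Matchable E (t i)) (hd : (s : Set κ).PairwiseDisjoint t) :
    Matchable E (s.biUnion t) := by
  classical
  induction s using Finset.induction_on with
  | empty => exact matchable_empty E
  | insert a s ha ih =>
    rw [Finset.biUnion_insert]
    refine (h a (Finset.mem_insert_self _ _)).union
      (ih (fun i hi => h i (Finset.mem_insert_of_mem hi))
        (hd.subset (by simp))) ?_
    rw [Finset.disjoint_biUnion_right]
    intro i hi
    exact hd (by simp) (by simp [hi]) (by rintro rfl; exact ha hi)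

end Matchable

/-! ### Guided edge removal and almost perfect matchings -/

section Guided

variable {V : Type*}

/-- The number of ordered pairs of vertices of `S` that are related by `G`. -/
noncomputable def pairCount (G : V → V → Prop) (S : Finset V) : ℕ :=
  ∑ a ∈ S, ∑ b ∈ S, ind (G a b)

/-- The number of related ordered pairs of vertices of `S` that involve `a`, counted at `a`. -/
noncomputable def incidence (G : V → V → Prop) (S : Finset V) (a : V) : ℕ :=
  ∑ b ∈ S, ind (G a b) + ∑ b ∈ S, ind (G b a)

/-- The proportion of the ordered pairs of vertices of `S` that are related by `G`. -/
noncomputable def density (G : V → V → Prop) (S : Finset V) : ℝ :=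
  pairCount G S / (S.card : ℝ) ^ 2

lemma pairCount_mono (G : V → V → Prop) {S T : Finset V} (h : S ⊆ T) :
    pairCount G S ≤ pairCount G T :=
  (Finset.sum_le_sum fun _ _ => Finset.sum_le_sum_of_subset h).trans
    (Finset.sum_le_sum_of_subset h)

lemma pairCount_le_sq (G : V → V → Prop) (S : Finset V) : pairCount G S ≤ S.card ^ 2 := by
  calc pairCount G S ≤ ∑ a ∈ S, ∑ b ∈ S, 1 :=
        Finset.sum_le_sum fun _ _ => Finset.sum_le_sum fun _ _ => ind_le_one _
    _ = S.card ^ 2 := by simp [pow_two]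

lemma incidence_le (G : V → V → Prop) (S : Finset V) (a : V) : incidence G S a ≤ 2 * S.card := by
  have h1 : ∑ b ∈ S, ind (G a b) ≤ ∑ b ∈ S, 1 := Finset.sum_le_sum fun _ _ => ind_le_one _
  have h2 : ∑ b ∈ S, ind (G b a) ≤ ∑ b ∈ S, 1 := Finset.sum_le_sum fun _ _ => ind_le_one _
  simp only [Finset.sum_const, smul_eq_mul, mul_one] at h1 h2
  unfold incidence
  omega

lemma sum_incidence (G : V → V → Prop) (S : Finset V) :
    ∑ a ∈ S, incidence G S a = 2 * pairCount G S := by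
  unfold incidence pairCount
  rw [Finset.sum_add_distrib, Finset.sum_comm (f := fun a b => ind (G b a)), two_mul]

variable [DecidableEq V]

/-- Every lost pair has an endpoint in e and is charged there; pairs with both endpoints in e may be
charged twice, which is harmless. -/
lemma pairCount_le_sdiff_add (G : V → V → Prop) {S e : Finset V} (he : e ⊆ S) :
    pairCount G S ≤ pairCount G (S \ e) + ∑ a ∈ e, incidence G S a := by
  unfold pairCount incidence
  rw [← Finset.sum_sdiff he, Finset.sum_add_distrib]
  have h1 : ∑ a ∈ S \ e, ∑ b ∈ S, ind (G a b) =
      ∑ a ∈ S \ e, ∑ b ∈ S \ e, ind (G a b) + ∑ a ∈ S \ e, ∑ b ∈ e, ind (G a b) := by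
    rw [← Finset.sum_add_distrib]
    exact Finset.sum_congr rfl fun a _ => (Finset.sum_sdiff he).symm
  have h2 : ∑ a ∈ S \ e, ∑ b ∈ e, ind (G a b) ≤ ∑ b ∈ e, ∑ a ∈ S, ind (G a b) := by
    rw [Finset.sum_comm (s := e)]
    exact Finset.sum_le_sum_of_subset Finset.sdiff_subset
  omega

/-- The analytic estimate behind one step of the guided removal process. -/
lemma removal_estimate {s D : ℝ} (hs : 6 ≤ s) (hD0 : 0 ≤ D) (hD : D ≤ s ^ 2) {lam : ℝ}
    (hlam : 1 ≤ lam) (hlams : 24 * lam ≤ s) {κ : Type*} [Fintype κ] (x D' ρ : κ → ℝ)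
    (hx : ∀ f, 0 ≤ x f) (hx1 : ∑ f, x f = 1) (hρ : ∑ f, x f * ρ f = 6 * D / s)
    (hρ' : ∀ f, x f ≠ 0 → ρ f ≤ 6 * s) (hD1 : ∀ f, x f ≠ 0 → D' f ≤ D)
    (hD2 : ∀ f, x f ≠ 0 → D - ρ f ≤ D' f) :
    ∑ f, x f * Real.exp (lam * (D / s ^ 2 - D' f / (s - 3) ^ 2)) ≤ 1 + 612 * lam ^ 2 / s ^ 2 := by
  have hs0 : 0 < s := by linarith
  have hs3 : 0 < s - 3 := by linarith
  -- Here s ≥ 6 gives s - 3 ≥ s / 2, the source of the factors 4 in 24/s and 36/s².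
  have hsq : s ^ 2 / 4 ≤ (s - 3) ^ 2 := by nlinarith
  have hbig : 6 * s / (s - 3) ^ 2 ≤ 24 / s := by
    rw [div_le_div_iff₀ (by positivity) hs0]
    nlinarith
  have hinv : 9 / (s - 3) ^ 2 ≤ 36 / s ^ 2 := by
    rw [div_le_div_iff₀ (by positivity) (by positivity)]
    nlinarith
  have hle : D / s ^ 2 ≤ D / (s - 3) ^ 2 :=
    div_le_div_of_nonneg_left hD0 (by positivity) (by nlinarith)
  have hdiff : D / (s - 3) ^ 2 - D / s ^ 2 ≤ 6 * s / (s - 3) ^ 2 := by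
    rw [div_sub_div _ _ (by positivity) (by positivity), div_le_div_iff₀ (by positivity)
      (by positivity)]
    have : D * s ^ 2 - (s - 3) ^ 2 * D ≤ 6 * s * s ^ 2 := by nlinarith
    nlinarith [mul_le_mul_of_nonneg_right this (by positivity : 0 ≤ (s - 3) ^ 2)]
  have hpoint : ∀ f, x f * Real.exp (lam * (D / s ^ 2 - D' f / (s - 3) ^ 2)) ≤
      x f * (1 + lam * (D / s ^ 2 - (D - ρ f) / (s - 3) ^ 2) + lam ^ 2 * (24 / s) ^ 2) := by
    intro f
    by_cases h : x f = 0
    · simp [h]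
    refine mul_le_mul_of_nonneg_left ?_ (hx f)
    have h1 : D' f / (s - 3) ^ 2 ≤ D / (s - 3) ^ 2 := by
      gcongr
      exact hD1 f h
    have h2 : (D - ρ f) / (s - 3) ^ 2 ≤ D' f / (s - 3) ^ 2 := by
      gcongr
      exact hD2 f h
    have h3 : ρ f / (s - 3) ^ 2 ≤ 6 * s / (s - 3) ^ 2 := by
      gcongr
      exact hρ' f h
    set t := D / s ^ 2 - D' f / (s - 3) ^ 2 with ht
    have hsub : (D - ρ f) / (s - 3) ^ 2 = D / (s - 3) ^ 2 - ρ f / (s - 3) ^ 2 := sub_div _ _ _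
    have ht1 : |t| ≤ 24 / s := by
      rw [abs_le]
      constructor <;> linarith
    have ht2 : |lam * t| ≤ lam * (24 / s) := by
      rw [abs_mul, abs_of_nonneg (by linarith)]
      exact mul_le_mul_of_nonneg_left ht1 (by linarith)
    have ht3 : lam * (24 / s) ≤ 1 := by
      rw [← mul_div_assoc, div_le_one hs0]
      linarith
    have h4 := (abs_le.1 (Real.abs_exp_sub_one_sub_id_le (ht2.trans ht3))).2
    have h5 : (lam * t) ^ 2 ≤ (lam * (24 / s)) ^ 2 := by
      rw [← sq_abs]
      exact pow_le_pow_left₀ (abs_nonneg _) ht2 2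
    have h6 : lam * t ≤ lam * (D / s ^ 2 - (D - ρ f) / (s - 3) ^ 2) :=
      mul_le_mul_of_nonneg_left (by linarith) (by linarith)
    rw [mul_pow] at h5
    linarith
  refine (Finset.sum_le_sum fun f _ => hpoint f).trans ?_
  have hexp : ∀ f, x f * (1 + lam * (D / s ^ 2 - (D - ρ f) / (s - 3) ^ 2) +
      lam ^ 2 * (24 / s) ^ 2) = (1 + lam * (D / s ^ 2 - D / (s - 3) ^ 2) +
      lam ^ 2 * (24 / s) ^ 2) * x f + lam / (s - 3) ^ 2 * (x f * ρ f) := by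
    intro f
    field_simp
    ring
  simp only [hexp]
  rw [Finset.sum_add_distrib, ← Finset.mul_sum, ← Finset.mul_sum, hx1, hρ]
  -- The first-order terms cancel: removing an average triple loses exactly the share of pairs that
  -- the shrinking denominator (s - 3)² compensates, up to an error of order 1/s².
  have h7 : D / s ^ 2 - D / (s - 3) ^ 2 + 6 * D / s / (s - 3) ^ 2 =
      D / s ^ 2 * (9 / (s - 3) ^ 2) := by
    field_simp
    ring
  have h8 : D / s ^ 2 ≤ 1 := by
    rw [div_le_one (by positivity)]
    exact hD
  have h9 : D / s ^ 2 * (9 / (s - 3) ^ 2) ≤ 1 * (36 / s ^ 2) :=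
    mul_le_mul h8 hinv (by positivity) (by norm_num)
  have h10 : lam * (D / s ^ 2 - D / (s - 3) ^ 2 + 6 * D / s / (s - 3) ^ 2) ≤
      lam ^ 2 * (36 / s ^ 2) := by
    rw [h7]
    have : lam ≤ lam ^ 2 := by nlinarith
    calc lam * (D / s ^ 2 * (9 / (s - 3) ^ 2)) ≤ lam * (1 * (36 / s ^ 2)) :=
          mul_le_mul_of_nonneg_left h9 (by linarith)
      _ ≤ lam ^ 2 * (36 / s ^ 2) := by
          rw [one_mul]
          exact mul_le_mul_of_nonneg_right this (by positivity)
  -- 612 = 24² + 36, from the quadratic error of the exponential and from the linear term.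
  have h11 : 1 + 612 * lam ^ 2 / s ^ 2 = 1 + lam ^ 2 * (24 / s) ^ 2 + lam ^ 2 * (36 / s ^ 2) := by
    field_simp
    ring
  rw [h11]
  have h12 : lam / (s - 3) ^ 2 * (6 * D / s) = lam * (6 * D / s / (s - 3) ^ 2) := by
    field_simp
  rw [h12]
  linarith

/-- The potential that controls the densities of several relations during the removal. -/
noncomputable def potential {J : Type*} [Fintype J] (G : J → V → V → Prop) (V₀ : Finset V)
    (lam : ℝ) (S : Finset V) : ℝ :=
  ∑ j, Real.exp (lam * (density (G j) V₀ - density (G j) S))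

/-- A triple drawn from the fractional matching has uniform marginals, so `removal_estimate` bounds
the expected value of each summand of the potential; some edge does at least as well as the average.
-/
lemma exists_edge_potential_le {E : Finset (Finset V)} (hE : ∀ e ∈ E, e.card = 3)
    {J : Type*} [Fintype J] (G : J → V → V → Prop) (V₀ S : Finset V) {lam : ℝ}
    (hs : (6 : ℝ) ≤ S.card) (hlam : 1 ≤ lam) (hlams : 24 * lam ≤ S.card)
    {x : (Fin 3 → S) → ℝ}
    (hx : IsDecomposition {f : Fin 3 → S | Finset.univ.image (fun i => (f i : V)) ∈ E} x) :
    ∃ e ∈ E, e ⊆ S ∧ potential G V₀ lam (S \ e) ≤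
      potential G V₀ lam S * (1 + 612 * lam ^ 2 / (S.card : ℝ) ^ 2) := by
  set e : (Fin 3 → S) → Finset V := fun f => Finset.univ.image (fun i => (f i : V)) with he
  have hsub : ∀ f, e f ⊆ S := by
    intro f v hv
    simp only [he, Finset.mem_image, Finset.mem_univ, true_and] at hv
    obtain ⟨i, rfl⟩ := hv
    exact (f i).2
  have hcardE : ∀ f, x f ≠ 0 → (e f).card = 3 := fun f hf => hE _ (hx.mem f hf)
  have hsd : ∀ f, x f ≠ 0 → ((S \ e f).card : ℝ) = S.card - 3 := by
    intro f hf
    rw [Finset.card_sdiff_of_subset (hsub f), Nat.cast_sub (Finset.card_le_card (hsub f)),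
      hcardE f hf]
    norm_num
  have hrho : ∀ (G : V → V → Prop) f, ∑ a ∈ e f, incidence G S a ≤ ∑ i, incidence G S (f i) := by
    intro G f
    exact Finset.sum_image_le_of_nonneg (fun _ _ => Nat.zero_le _)
  have key : ∀ j, ∑ f, x f * Real.exp (lam * (density (G j) V₀ - density (G j) (S \ e f))) ≤
      Real.exp (lam * (density (G j) V₀ - density (G j) S)) *
        (1 + 612 * lam ^ 2 / (S.card : ℝ) ^ 2) := by
    intro j
    have h1 := removal_estimate (D := pairCount (G j) S) hs (by positivity)
      (by exact_mod_cast pairCount_le_sq (G j) S) hlam hlams x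
      (fun f => pairCount (G j) (S \ e f)) (fun f => ∑ i, (incidence (G j) S (f i) : ℝ))
      hx.nonneg hx.sum_eq_one ?_ ?_ ?_ ?_
    · refine le_trans (le_of_eq ?_) (mul_le_mul_of_nonneg_left h1 (Real.exp_nonneg _))
      rw [Finset.mul_sum]
      refine Finset.sum_congr rfl fun f _ => ?_
      by_cases h : x f = 0
      · simp [h]
      rw [mul_left_comm, ← Real.exp_add]
      congr 2
      rw [density, density, density, hsd f h]
      ring
    · rw [hx.marginal fun a : S => (incidence (G j) S a : ℝ), Fintype.card_coe,
        Finset.sum_coe_sort S fun a => (incidence (G j) S a : ℝ)]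
      have := sum_incidence (G j) S
      have h2 : ∑ a ∈ S, (incidence (G j) S a : ℝ) = 2 * pairCount (G j) S := by
        exact_mod_cast this
      rw [h2]
      ring
    · intro f _
      have : ∑ i, (incidence (G j) S (f i) : ℝ) ≤ ∑ i : Fin 3, (2 * S.card : ℝ) :=
        Finset.sum_le_sum fun i _ => by exact_mod_cast incidence_le _ _ _
      simp only [Finset.sum_const, Finset.card_univ, Fintype.card_fin, nsmul_eq_mul] at this
      push_cast at this
      linarith
    · intro f _
      exact_mod_cast pairCount_mono (G j) Finset.sdiff_subset
    · intro f _
      have h2 := pairCount_le_sdiff_add (G j) (hsub f)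
      have h3 := hrho (G j) f
      have h4 : pairCount (G j) S ≤ pairCount (G j) (S \ e f) + ∑ i, incidence (G j) S (f i) := by
        omega
      have h5 : (pairCount (G j) S : ℝ) ≤
          pairCount (G j) (S \ e f) + ∑ i, (incidence (G j) S (f i) : ℝ) := by exact_mod_cast h4
      linarith
  have havg : ∑ f, x f * potential G V₀ lam (S \ e f) ≤
      potential G V₀ lam S * (1 + 612 * lam ^ 2 / (S.card : ℝ) ^ 2) := by
    unfold potential
    rw [Finset.sum_mul]
    simp only [Finset.mul_sum]
    rw [Finset.sum_comm]
    exact Finset.sum_le_sum fun j _ => key j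
  by_contra hcon
  push Not at hcon
  have hlt : ∑ f, x f * (potential G V₀ lam S * (1 + 612 * lam ^ 2 / (S.card : ℝ) ^ 2)) <
      ∑ f, x f * potential G V₀ lam (S \ e f) := by
    refine Finset.sum_lt_sum (fun f _ => ?_) ?_
    · by_cases h : x f = 0
      · simp [h]
      · exact mul_le_mul_of_nonneg_left (hcon _ (hx.mem f h) (hsub f)).le (hx.nonneg f)
    · obtain ⟨f, hf⟩ : ∃ f, x f ≠ 0 := by
        by_contra h
        push Not at h
        have := hx.sum_eq_one
        simp [h] at this
      exact ⟨f, Finset.mem_univ _, mul_lt_mul_of_pos_left (hcon _ (hx.mem f hf) (hsub f))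
        (lt_of_le_of_ne (hx.nonneg f) (Ne.symm hf))⟩
  rw [← Finset.sum_mul, hx.sum_eq_one, one_mul] at hlt
  linarith

/-- If every remainder that inherits the densities of the relations `G j` has a fractional perfect
matching, then some matching covers all but fewer than `L` vertices. -/
lemma exists_almost_matching {E : Finset (Finset V)} (hE : ∀ e ∈ E, e.card = 3)
    {J : Type*} [Fintype J] (G : J → V → V → Prop) (V₀ : Finset V) {L lam ξ : ℝ}
    (hL : 6 ≤ L) (hlam : 1 ≤ lam) (hlamL : 24 * lam ≤ L)
    (hδ : V₀.card * (612 * lam ^ 2 / L ^ 2) ≤ 1)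
    (hJ : 3 * (Fintype.card J : ℝ) ≤ Real.exp (lam * ξ))
    (hfrac : ∀ S ⊆ V₀, Matchable E (V₀ \ S) → L ≤ S.card →
      (∀ j, density (G j) V₀ - ξ ≤ density (G j) S) →
      ∃ x : (Fin 3 → S) → ℝ,
        IsDecomposition {f : Fin 3 → S | Finset.univ.image (fun i => (f i : V)) ∈ E} x) :
    ∃ S ⊆ V₀, Matchable E (V₀ \ S) ∧ (S.card : ℝ) < L := by
  set δ := 612 * lam ^ 2 / L ^ 2 with hδdef
  have hδ0 : 0 ≤ δ := by positivity
  have main : ∀ k : ℕ, ∃ S ⊆ V₀, Matchable E (V₀ \ S) ∧ ((S.card : ℝ) < L ∨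
      (S.card + 3 * k ≤ V₀.card ∧ potential G V₀ lam S ≤ Fintype.card J * (1 + δ) ^ k)) := by
    intro k
    induction k with
    | zero =>
      refine ⟨V₀, subset_rfl, by simpa using matchable_empty E, .inr ⟨by omega, ?_⟩⟩
      simp [potential]
    | succ k ih =>
      obtain ⟨S, hS, hM, h | ⟨hk, hpot⟩⟩ := ih
      · exact ⟨S, hS, hM, .inl h⟩
      by_cases hSL : (S.card : ℝ) < L
      · exact ⟨S, hS, hM, .inl hSL⟩
      push Not at hSL
      have hk' : (k : ℝ) ≤ V₀.card := by exact_mod_cast (by omega : k ≤ V₀.card)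
      -- At most |V₀| steps are made and |V₀|δ ≤ 1, so the potential grows by a factor of at most e
      -- < 3 in total. Each single exponential is then at most 3|J| ≤ exp(lam ξ), so no density
      -- falls by more than ξ.
      have hpow : (1 + δ) ^ k ≤ 3 := by
        calc (1 + δ) ^ k ≤ Real.exp δ ^ k := by
              refine pow_le_pow_left₀ (by linarith) ?_ k
              rw [add_comm]
              exact Real.add_one_le_exp δ
          _ = Real.exp (k * δ) := by rw [← Real.exp_nat_mul]
          _ ≤ Real.exp 1 := Real.exp_le_exp.2
              ((mul_le_mul_of_nonneg_right hk' hδ0).trans hδ)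
          _ ≤ 3 := by linarith [Real.exp_one_lt_d9]
      have hpot3 : potential G V₀ lam S ≤ 3 * (Fintype.card J : ℝ) :=
        hpot.trans (by nlinarith [Nat.cast_nonneg (α := ℝ) (Fintype.card J)])
      obtain ⟨x, hx⟩ := hfrac S hS hM hSL fun j => by
        have h1 : Real.exp (lam * (density (G j) V₀ - density (G j) S)) ≤
            potential G V₀ lam S :=
          Finset.single_le_sum
            (f := fun j => Real.exp (lam * (density (G j) V₀ - density (G j) S)))
            (fun _ _ => Real.exp_nonneg _) (Finset.mem_univ j)
        have h2 := Real.exp_le_exp.1 ((h1.trans hpot3).trans hJ)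
        have h3 := le_of_mul_le_mul_left h2 (by linarith)
        linarith
      obtain ⟨e, he, heS, hle⟩ := exists_edge_potential_le hE G V₀ S (hL.trans hSL) hlam
        (hlamL.trans hSL) hx
      have hcard : (S \ e).card = S.card - 3 := by
        rw [Finset.card_sdiff_of_subset heS, hE e he]
      have h3 : 3 ≤ S.card := by
        rw [← hE e he]
        exact Finset.card_le_card heS
      refine ⟨S \ e, Finset.sdiff_subset.trans hS, ?_, .inr ⟨by omega, ?_⟩⟩
      · have : V₀ \ (S \ e) = (V₀ \ S) ∪ e := by
          ext v
          simp only [Finset.mem_sdiff, Finset.mem_union]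
          have := @heS v
          have := @hS v
          tauto
        rw [this]
        refine hM.union (matchable_of_mem he) ?_
        rw [Finset.disjoint_left]
        intro v hv hve
        exact (Finset.mem_sdiff.1 hv).2 (heS hve)
      · have h4 : 612 * lam ^ 2 / (S.card : ℝ) ^ 2 ≤ δ := by
          rw [hδdef]
          gcongr
        have h5 : 0 ≤ potential G V₀ lam S :=
          Finset.sum_nonneg fun _ _ => Real.exp_nonneg _
        calc potential G V₀ lam (S \ e) ≤
            potential G V₀ lam S * (1 + 612 * lam ^ 2 / (S.card : ℝ) ^ 2) := hle
          _ ≤ potential G V₀ lam S * (1 + δ) := by gcongr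
          _ ≤ Fintype.card J * (1 + δ) ^ k * (1 + δ) := by gcongr
          _ = _ := by rw [pow_succ, mul_assoc]
  -- More steps than vertices are impossible, so the process must have stopped below L.
  obtain ⟨S, hS, hM, h | ⟨hk, -⟩⟩ := main (V₀.card + 1)
  · exact ⟨S, hS, hM, h⟩
  · omega

end Guided

/-! ### Greedy selection of disjoint gadgets -/

section Selection

variable {V α I : Type*} [DecidableEq V] [DecidableEq α] [Fintype I]

/-- The potential that measures how often a selection `T` hits the families `F x`. -/
noncomputable def hitPotential (F : I → Finset α) (T : Finset α) : ℝ :=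
  ∑ x, Real.exp (-((T ∩ F x).card : ℝ))

/-- Choosing a member of F x multiplies the term of x by 1/e ≤ 1/2, and at least τ choices in G do
so. -/
lemma sum_hitPotential_le (F : I → Finset α) (T G : Finset α) (hTG : Disjoint T G) {τ : ℝ}
    (hF : ∀ x, τ ≤ (F x ∩ G).card) :
    ∑ a ∈ G, hitPotential F (insert a T) ≤ hitPotential F T * (G.card - τ / 2) := by
  unfold hitPotential
  rw [Finset.sum_comm, Finset.sum_mul]
  refine Finset.sum_le_sum fun x _ => ?_
  have hterm : ∀ a ∈ G, Real.exp (-((insert a T ∩ F x).card : ℝ)) ≤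
      Real.exp (-((T ∩ F x).card : ℝ)) * (1 - 1 / 2 * (if a ∈ F x then 1 else 0)) := by
    intro a ha
    split_ifs with h
    · have haT : a ∉ T ∩ F x := fun h' =>
        (Finset.disjoint_left.1 hTG (Finset.mem_inter.1 h').1) ha
      rw [Finset.insert_inter_of_mem h, Finset.card_insert_of_notMem haT]
      push_cast
      rw [neg_add, Real.exp_add]
      refine mul_le_mul_of_nonneg_left ?_ (Real.exp_nonneg _)
      rw [Real.exp_neg, inv_le_comm₀ (Real.exp_pos _) (by norm_num)]
      linarith [Real.exp_one_gt_d9]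
    · rw [Finset.insert_inter_of_notMem h]
      simp
  refine (Finset.sum_le_sum hterm).trans ?_
  rw [← Finset.mul_sum]
  refine mul_le_mul_of_nonneg_left ?_ (Real.exp_nonneg _)
  rw [Finset.sum_sub_distrib, ← Finset.mul_sum, Finset.sum_boole]
  have h1 : G.filter (· ∈ F x) = F x ∩ G := by
    ext a
    simp [and_comm]
  rw [h1]
  have := hF x
  simp
  linarith

/-- A deterministic selection of pairwise disjoint gadgets that hits every large family of gadgets
proportionally often. -/
lemma exists_disjoint_selection [Nonempty I] (A : Finset α) (supp : α → Finset V) (k : ℕ)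
    (hk : ∀ a ∈ A, (supp a).card ≤ k) (hne : ∀ a ∈ A, (supp a).Nonempty) (Z : Finset V)
    {N B τ : ℝ} (hN : A.card ≤ N) (hτ : 0 < τ)
    (hB : ∀ v, ((A.filter (v ∈ supp ·)).card : ℝ) ≤ B) (m : ℕ)
    (hm : (Z.card + k * m) * B ≤ τ) (F : I → Finset α) (hFA : ∀ x, F x ⊆ A)
    (hF : ∀ x, 2 * τ ≤ (F x).card) :
    ∃ T ⊆ A, T.card = m ∧ (T : Set α).PairwiseDisjoint supp ∧ (∀ a ∈ T, Disjoint (supp a) Z) ∧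
      ∀ x, τ / N * m / 2 - Real.log (Fintype.card I) ≤ ((T ∩ F x).card : ℝ) := by
  obtain ⟨x₀⟩ := ‹Nonempty I›
  have hApos : 0 < N := by
    have h1 := hF x₀
    have h2 : ((F x₀).card : ℝ) ≤ A.card := by exact_mod_cast Finset.card_le_card (hFA x₀)
    linarith
  have hp : τ / N ≤ 1 := by
    rw [div_le_one hApos]
    have h1 := hF x₀
    have h2 : ((F x₀).card : ℝ) ≤ A.card := by exact_mod_cast Finset.card_le_card (hFA x₀)
    linarith
  have hp0 : 0 < τ / N := div_pos hτ hApos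
  have main : ∀ t ≤ m, ∃ T ⊆ A, T.card = t ∧ (T : Set α).PairwiseDisjoint supp ∧
      (∀ a ∈ T, Disjoint (supp a) Z) ∧
      hitPotential F T ≤ Fintype.card I * (1 - τ / N / 2) ^ t := by
    intro t ht
    induction t with
    | zero => exact ⟨∅, by simp, by simp, by simp, by simp, by simp [hitPotential]⟩
    | succ t ih =>
      obtain ⟨T, hTA, hTc, hTd, hTZ, hT⟩ := ih (by omega)
      set U := Z ∪ T.biUnion supp with hU
      have hUc : (U.card : ℝ) ≤ Z.card + k * m := by
        have h1 : (T.biUnion supp).card ≤ T.card * k :=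
          Finset.card_biUnion_le_card_mul _ _ _ fun a ha => hk a (hTA ha)
        have h2 : U.card ≤ Z.card + (T.biUnion supp).card := Finset.card_union_le _ _
        have h3 : T.card * k ≤ k * m := by
          rw [hTc, mul_comm]
          exact Nat.mul_le_mul_left _ (by omega)
        exact_mod_cast h2.trans (by omega)
      set G := A.filter fun a => Disjoint (supp a) U with hG
      -- At most |Z| + km vertices are occupied and each blocks at most B gadgets, so every family
      -- keeps at least τ of its 2τ members.
      have hblocked : ((A \ G).card : ℝ) ≤ τ := by
        have h1 : A \ G ⊆ U.biUnion fun v => A.filter (v ∈ supp ·) := by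
          intro a ha
          simp only [hG, Finset.mem_sdiff, Finset.mem_filter, not_and] at ha
          obtain ⟨v, hv1, hv2⟩ := Finset.not_disjoint_iff.1 (ha.2 ha.1)
          simp only [Finset.mem_biUnion, Finset.mem_filter]
          exact ⟨v, hv2, ha.1, hv1⟩
        have hB0 : 0 ≤ B ∨ U = ∅ := by
          rcases U.eq_empty_or_nonempty with h | ⟨v, _⟩
          · exact .inr h
          · exact .inl ((Nat.cast_nonneg _).trans (hB v))
        have h2 : ((A \ G).card : ℝ) ≤ ∑ v ∈ U, ((A.filter (v ∈ supp ·)).card : ℝ) := by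
          exact_mod_cast (Finset.card_le_card h1).trans Finset.card_biUnion_le
        have h3 : ∑ v ∈ U, ((A.filter (v ∈ supp ·)).card : ℝ) ≤ U.card * B := by
          rw [← nsmul_eq_mul]
          exact Finset.sum_le_card_nsmul _ _ _ fun v _ => hB v
        rcases hB0 with h | h
        · exact h2.trans (h3.trans ((mul_le_mul_of_nonneg_right hUc h).trans hm))
        · rw [h] at h2
          simp only [Finset.sum_empty] at h2
          linarith
      have hFG : ∀ x, τ ≤ (F x ∩ G).card := by
        intro x
        have h1 : F x ⊆ (F x ∩ G) ∪ (A \ G) := by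
          intro a ha
          by_cases h : a ∈ G
          · simp [ha, h]
          · simp [hFA x ha, h]
        have h2 : ((F x).card : ℝ) ≤ (F x ∩ G).card + (A \ G).card := by
          exact_mod_cast (Finset.card_le_card h1).trans (Finset.card_union_le _ _)
        linarith [hF x]
      have hTG : Disjoint T G := by
        rw [Finset.disjoint_left]
        intro a ha haG
        obtain ⟨v, hv⟩ := hne a (hTA ha)
        refine Finset.disjoint_left.1 (Finset.mem_filter.1 haG).2 hv ?_
        rw [hU]
        exact Finset.mem_union_right _ (Finset.mem_biUnion.2 ⟨a, ha, hv⟩)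
      have hGpos : 0 < (G.card : ℝ) := by
        have h1 : ((F x₀ ∩ G).card : ℝ) ≤ G.card := by
          exact_mod_cast Finset.card_le_card Finset.inter_subset_right
        linarith [hFG x₀]
      have hGN : (G.card : ℝ) ≤ N := by
        refine le_trans ?_ hN
        exact_mod_cast Finset.card_le_card (Finset.filter_subset _ _)
      have hΦ0 : 0 ≤ hitPotential F T := Finset.sum_nonneg fun _ _ => Real.exp_nonneg _
      -- On average over the available gadgets the potential shrinks by the factor 1 - τ/(2N).
      have havg : ∑ a ∈ G, hitPotential F (insert a T) ≤
          ∑ _a ∈ G, hitPotential F T * (1 - τ / N / 2) := by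
        refine (sum_hitPotential_le F T G hTG hFG).trans ?_
        rw [Finset.sum_const, nsmul_eq_mul, mul_left_comm]
        refine mul_le_mul_of_nonneg_left ?_ hΦ0
        have : G.card * (τ / N) ≤ τ := by
          rw [mul_div_assoc', div_le_iff₀ hApos, mul_comm]
          exact mul_le_mul_of_nonneg_left hGN hτ.le
        linarith
      obtain ⟨a, haG, ha⟩ := Finset.exists_le_of_sum_le
        (Finset.card_pos.1 (by exact_mod_cast hGpos)) havg
      have haU := (Finset.mem_filter.1 haG).2
      refine ⟨insert a T, Finset.insert_subset (Finset.mem_filter.1 haG).1 hTA, ?_, ?_, ?_, ?_⟩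
      · rw [Finset.card_insert_of_notMem (fun h => Finset.disjoint_left.1 hTG h haG), hTc]
      · rw [Finset.coe_insert]
        refine hTd.insert fun b hb _ => ?_
        refine Finset.disjoint_of_subset_right ?_ haU
        exact (Finset.subset_biUnion_of_mem supp hb).trans Finset.subset_union_right
      · intro b hb
        rcases Finset.mem_insert.1 hb with rfl | hb
        · exact Finset.disjoint_of_subset_right Finset.subset_union_left haU
        · exact hTZ b hb
      · refine ha.trans ?_
        rw [pow_succ, ← mul_assoc]
        exact mul_le_mul_of_nonneg_right hT (by linarith)
  obtain ⟨T, hTA, hTc, hTd, hTZ, hT⟩ := main m le_rfl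
  refine ⟨T, hTA, hTc, hTd, hTZ, fun x => ?_⟩
  have hI : (0 : ℝ) < Fintype.card I := by
    have : Nonempty I := ⟨x₀⟩
    exact_mod_cast Fintype.card_pos
  have h1 : Real.exp (-((T ∩ F x).card : ℝ)) ≤ hitPotential F T :=
    Finset.single_le_sum (f := fun x => Real.exp (-((T ∩ F x).card : ℝ)))
      (fun _ _ => Real.exp_nonneg _) (Finset.mem_univ x)
  have h2 : (1 - τ / N / 2) ^ m ≤ Real.exp (-(τ / N * m / 2)) := by
    calc (1 - τ / N / 2) ^ m ≤ Real.exp (-(τ / N / 2)) ^ m := by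
          refine pow_le_pow_left₀ (by linarith) ?_ m
          linarith [Real.add_one_le_exp (-(τ / N / 2))]
      _ = Real.exp (-(τ / N * m / 2)) := by
          rw [← Real.exp_nat_mul]
          congr 1
          ring
  have h3 : Real.exp (-((T ∩ F x).card : ℝ)) ≤
      Real.exp (Real.log (Fintype.card I) + -(τ / N * m / 2)) := by
    rw [Real.exp_add, Real.exp_log hI]
    exact h1.trans (hT.trans (mul_le_mul_of_nonneg_left h2 hI.le))
  have := Real.exp_le_exp.1 h3
  linarith

end Selection

/-! ### Absorbing sets made of 3 × 3 gadgets -/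

section Absorption

/-- The coordinates other than q determine the function, which costs one factor |V|. This bounds
every degenerate family of gadgets. -/
lemma card_filter_le_pow {V ι : Type*} [Fintype V] [Fintype ι] [DecidableEq ι] (q : ι) (p : (ι → V) → Prop)
    [DecidablePred p]
    (hp : ∀ g g' : ι → V, p g → p g' → (∀ j, j ≠ q → g j = g' j) → g q = g' q) :
    (Finset.univ.filter p).card ≤ Fintype.card V ^ (Fintype.card ι - 1) := by
  have h : Fintype.card ({j // j ≠ q} → V) = Fintype.card V ^ (Fintype.card ι - 1) := by
    rw [Fintype.card_fun]
    congr 1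
    rw [Fintype.card_subtype_compl]
    simp
  rw [← h, ← Finset.card_univ]
  refine Finset.card_le_card_of_injOn (fun g j => g j.1) (fun _ _ => Finset.mem_univ _) ?_
  intro g hg g' hg' heq
  have hj : ∀ j, j ≠ q → g j = g' j := fun j hj => congrFun heq ⟨j, hj⟩
  ext j
  by_cases h : j = q
  · rw [h]
    exact hp g g' (by simpa using hg) (by simpa using hg') hj
  · exact hj j h

variable {V : Type*} [Fintype V] [DecidableEq V]

lemma card_filter_mem_range_le {ι : Type*} [Fintype ι] [DecidableEq ι] (v : V) :
    (Finset.univ.filter fun g : ι → V => ∃ j, g j = v).card ≤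
      Fintype.card ι * Fintype.card V ^ (Fintype.card ι - 1) := by
  have h1 : (Finset.univ.filter fun g : ι → V => ∃ j, g j = v) ⊆
      Finset.univ.biUnion fun j => Finset.univ.filter fun g : ι → V => g j = v := by
    intro g hg
    simpa using hg
  refine (Finset.card_le_card h1).trans ((Finset.card_biUnion_le_card_mul _ _
    (Fintype.card V ^ (Fintype.card ι - 1)) fun j _ => ?_).trans (by simp))
  exact card_filter_le_pow j _ fun g g' h h' _ => h.trans h'.symm

lemma card_filter_not_injective_le {ι : Type*} [Fintype ι] [DecidableEq ι] :
    (Finset.univ.filter fun g : ι → V => ¬ Function.Injective g).card ≤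
      Fintype.card ι ^ 2 * Fintype.card V ^ (Fintype.card ι - 1) := by
  have h1 : (Finset.univ.filter fun g : ι → V => ¬ Function.Injective g) ⊆
      (Finset.univ.filter fun p : ι × ι => p.1 ≠ p.2).biUnion
        fun p => Finset.univ.filter fun g : ι → V => g p.1 = g p.2 := by
    intro g hg
    replace hg := (Finset.mem_filter.1 hg).2
    rw [Function.Injective] at hg
    push Not at hg
    obtain ⟨a, b, hab, hne⟩ := hg
    simp only [Finset.mem_biUnion, Finset.mem_filter, Finset.mem_univ, true_and]
    exact ⟨(a, b), hne, hab⟩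
  refine (Finset.card_le_card h1).trans ((Finset.card_biUnion_le_card_mul _ _
    (Fintype.card V ^ (Fintype.card ι - 1)) fun p hp => ?_).trans ?_)
  · refine card_filter_le_pow p.2 _ fun g g' h h' hj => ?_
    rw [← h, ← h']
    exact hj _ (by simpa using hp)
  · refine Nat.mul_le_mul_right _ ((Finset.card_le_univ _).trans ?_)
    simp [pow_two]

/-- The pairs that form an edge both with `x` and with `y`. -/
def commonLink (E : Finset (Finset V)) (x y : V) : Finset (V × V) :=
  Finset.univ.filter fun p => {x, p.1, p.2} ∈ E ∧ {y, p.1, p.2} ∈ E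

/-- The row of a gadget. -/
def gadgetRow (g : Fin 3 × Fin 3 → V) (i : Fin 3) : Finset V := {g (i, 0), g (i, 1), g (i, 2)}

/-- The row of a gadget with the first entry replaced by `v`. -/
def exchangedRow (g : Fin 3 × Fin 3 → V) (v : V) (i : Fin 3) : Finset V :=
  {v, g (i, 1), g (i, 2)}

/-- The first column of a gadget. -/
def gadgetColumn (g : Fin 3 × Fin 3 → V) : Finset V := Finset.univ.image fun i => g (i, 0)

/-- A gadget: a `3 × 3` array of distinct vertices whose rows and whose first column are edges. -/
def gadgets (E : Finset (Finset V)) : Finset (Fin 3 × Fin 3 → V) :=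
  Finset.univ.filter fun g => Function.Injective g ∧ gadgetColumn g ∈ E ∧ ∀ i, gadgetRow g i ∈ E

/-- The gadgets that can absorb the triple `u`. -/
def absorbers (E : Finset (Finset V)) (u : Fin 3 → V) : Finset (Fin 3 × Fin 3 → V) :=
  (gadgets E).filter fun g => ∀ i, exchangedRow g (u i) i ∈ E

/-- Choose the first column among η n³ edges of the right type, then complete each row by a pair
from the common link of u i and the column entry, in η n² ways each. Of these η⁴n⁹ arrays at most 81
n⁸ repeat a vertex. -/
lemma card_absorbers_ge {E : Finset (Finset V)} {P : Fin 3 → Finset V} {η : ℝ} (hη : 0 < η)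
    (h1 : η * (Fintype.card V : ℝ) ^ 3 ≤ (Finset.univ.filter fun a : Fin 3 → V =>
      (∀ i, a i ∈ P i) ∧ Finset.univ.image a ∈ E).card)
    (h2 : ∀ i, ∀ x ∈ P i, ∀ y ∈ P i,
      η * (Fintype.card V : ℝ) ^ 2 ≤ (commonLink E x y).card)
    (hn : 162 ≤ η ^ 4 * Fintype.card V) {u : Fin 3 → V} (hu : ∀ i, u i ∈ P i) :
    η ^ 4 * (Fintype.card V : ℝ) ^ 9 / 2 ≤ (absorbers E u).card := by
  set n : ℝ := (Fintype.card V : ℝ) with hndef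
  set C := Finset.univ.filter fun a : Fin 3 → V =>
      (∀ i, a i ∈ P i) ∧ Finset.univ.image a ∈ E with hC
  set X : Finset (Σ _ : Fin 3 → V, Fin 3 → V × V) :=
    C.sigma fun a => Fintype.piFinset fun i => commonLink E (u i) (a i) with hX
  set bad := Finset.univ.filter fun g : Fin 3 × Fin 3 → V => ¬ Function.Injective g with hbad
  let mk : (Σ _ : Fin 3 → V, Fin 3 → V × V) → (Fin 3 × Fin 3 → V) := fun s q =>
    ![s.1 q.1, (s.2 q.1).1, (s.2 q.1).2] q.2
  have hXcard : η ^ 4 * n ^ 9 ≤ X.card := by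
    rw [hX, Finset.card_sigma]
    push_cast
    have hterm : ∀ a ∈ C, (η * n ^ 2) ^ 3 ≤
        ((Fintype.piFinset fun i => commonLink E (u i) (a i)).card : ℝ) := by
      intro a ha
      rw [Fintype.card_piFinset]
      push_cast
      have : (η * n ^ 2) ^ 3 = ∏ _i : Fin 3, η * n ^ 2 := by simp
      rw [this]
      refine Finset.prod_le_prod (fun _ _ => by positivity) fun i _ => ?_
      exact h2 i _ (hu i) _ ((Finset.mem_filter.1 ha).2.1 i)
    calc η ^ 4 * n ^ 9 = η * n ^ 3 * (η * n ^ 2) ^ 3 := by ring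
      _ ≤ C.card * (η * n ^ 2) ^ 3 := mul_le_mul_of_nonneg_right h1 (by positivity)
      _ ≤ _ := by
          rw [← nsmul_eq_mul]
          exact Finset.card_nsmul_le_sum _ _ _ hterm
  have hXle : X.card ≤ (absorbers E u ∪ bad).card := by
    refine Finset.card_le_card_of_injOn mk ?_ ?_
    · rintro ⟨a, p⟩ hap
      rw [hX] at hap
      simp only [Finset.coe_sigma, Set.mem_sigma_iff, Finset.mem_coe, Fintype.mem_piFinset,
        commonLink, hC, Finset.mem_filter, Finset.mem_univ, true_and] at hap
      obtain ⟨⟨ha1, ha2⟩, hp⟩ := hap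
      by_cases hinj : Function.Injective (mk ⟨a, p⟩)
      · refine Finset.mem_coe.2 (Finset.mem_union_left _ ?_)
        simp only [absorbers, gadgets, Finset.mem_filter, Finset.mem_univ, true_and]
        exact ⟨⟨hinj, ha2, fun i => (hp i).2⟩, fun i => (hp i).1⟩
      · refine Finset.mem_coe.2 (Finset.mem_union_right _ ?_)
        simpa [hbad] using hinj
    · rintro ⟨a, p⟩ - ⟨a', p'⟩ - heq
      have e0 : a = a' := funext fun i => congrFun heq (i, 0)
      have e1 : p = p' := funext fun i =>
        Prod.ext (congrFun heq (i, 1)) (congrFun heq (i, 2))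
      rw [e0, e1]
  have hbadcard : (bad.card : ℝ) ≤ 81 * n ^ 8 := by
    have := card_filter_not_injective_le (V := V) (ι := Fin 3 × Fin 3)
    simp only [Fintype.card_prod, Fintype.card_fin] at this
    rw [hndef]
    exact_mod_cast this
  have hle : (X.card : ℝ) ≤ (absorbers E u).card + bad.card := by
    exact_mod_cast hXle.trans (Finset.card_union_le _ _)
  have hn8 : 81 * n ^ 8 ≤ η ^ 4 * n ^ 9 / 2 := by
    have : 162 * n ^ 8 ≤ η ^ 4 * n * n ^ 8 := mul_le_mul_of_nonneg_right hn (by positivity)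
    linarith
  linarith

lemma gadget_matchable {E : Finset (Finset V)} {g : Fin 3 × Fin 3 → V} (hg : g ∈ gadgets E) :
    Matchable E (Finset.univ.image g) := by
  simp only [gadgets, Finset.mem_filter, Finset.mem_univ, true_and] at hg
  obtain ⟨hinj, -, hrow⟩ := hg
  have h : Finset.univ.image g = Finset.univ.biUnion (gadgetRow g) := by
    ext v
    simp only [Finset.mem_image, Finset.mem_univ, true_and, Finset.mem_biUnion, gadgetRow,
      Finset.mem_insert, Finset.mem_singleton, Prod.exists]
    constructor
    · rintro ⟨i, j, rfl⟩
      refine ⟨i, ?_⟩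
      fin_cases j <;> simp
    · rintro ⟨i, h | h | h⟩
      exacts [⟨i, 0, h.symm⟩, ⟨i, 1, h.symm⟩, ⟨i, 2, h.symm⟩]
  rw [h]
  refine Matchable.biUnion _ _ (fun i _ => matchable_of_mem (hrow i)) ?_
  intro i _ j _ hij
  simp only [Function.onFun, gadgetRow, Finset.disjoint_left, Finset.mem_insert,
    Finset.mem_singleton]
  rintro v (h | h | h) (h' | h' | h') <;>
  · rw [h] at h'
    exact hij (congrArg Prod.fst (hinj h'))

/-- The first column is itself an edge; once it is split off, u i takes its place in row i. -/
lemma absorber_matchable {E : Finset (Finset V)} {g : Fin 3 × Fin 3 → V} {u : Fin 3 → V}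
    (hg : g ∈ absorbers E u) (hu : Function.Injective u) (hug : ∀ i q, u i ≠ g q) :
    Matchable E (Finset.univ.image g ∪ Finset.univ.image u) := by
  simp only [absorbers, gadgets, Finset.mem_filter, Finset.mem_univ, true_and] at hg
  obtain ⟨⟨hinj, hcol, -⟩, hrow⟩ := hg
  have h : Finset.univ.image g ∪ Finset.univ.image u =
      gadgetColumn g ∪ Finset.univ.biUnion fun i => exchangedRow g (u i) i := by
    ext v
    simp only [Finset.mem_image, Finset.mem_univ, true_and, Finset.mem_biUnion, gadgetColumn,
      exchangedRow, Finset.mem_insert, Finset.mem_singleton, Prod.exists, Finset.mem_union]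
    constructor
    · rintro (⟨i, j, rfl⟩ | ⟨i, rfl⟩)
      · fin_cases j
        · exact .inl ⟨i, rfl⟩
        · exact .inr ⟨i, .inr (.inl rfl)⟩
        · exact .inr ⟨i, .inr (.inr rfl)⟩
      · exact .inr ⟨i, .inl rfl⟩
    · rintro (⟨i, rfl⟩ | ⟨i, h | h | h⟩)
      exacts [.inl ⟨i, 0, rfl⟩, .inr ⟨i, h.symm⟩, .inl ⟨i, 1, h.symm⟩, .inl ⟨i, 2, h.symm⟩]
  rw [h]
  refine (matchable_of_mem hcol).union
    (Matchable.biUnion _ _ (fun i _ => matchable_of_mem (hrow i)) ?_) ?_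
  · intro i _ j _ hij
    simp only [Function.onFun, exchangedRow, Finset.disjoint_left, Finset.mem_insert,
      Finset.mem_singleton]
    rintro v (h | h | h) (h' | h' | h') <;> rw [h] at h' <;>
    first
    | exact hij (hu h')
    | exact hug _ _ h'
    | exact hug _ _ h'.symm
    | exact hij (congrArg Prod.fst (hinj h'))
  · rw [Finset.disjoint_biUnion_right]
    intro i _
    simp only [exchangedRow, gadgetColumn, Finset.disjoint_left,
      Finset.mem_insert, Finset.mem_singleton, Finset.mem_image, Finset.mem_univ, true_and]
    rintro v ⟨j, rfl⟩ (h' | h' | h')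
    · exact hug _ _ h'.symm
    · exact absurd (congrArg Prod.snd (hinj h')) (by simp)
    · exact absurd (congrArg Prod.snd (hinj h')) (by simp)

/-- Existence of a small matchable set that stays matchable after adding any few disjoint triples
of the type `P 0 × P 1 × P 2`. -/
lemma exists_absorber {E : Finset (Finset V)} {P : Fin 3 → Finset V} {η : ℝ} (hη : 0 < η)
    (h1 : η * (Fintype.card V : ℝ) ^ 3 ≤ (Finset.univ.filter fun a : Fin 3 → V =>
      (∀ i, a i ∈ P i) ∧ Finset.univ.image a ∈ E).card)
    (h2 : ∀ i, ∀ x ∈ P i, ∀ y ∈ P i,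
      η * (Fintype.card V : ℝ) ^ 2 ≤ (commonLink E x y).card)
    (hn : 162 ≤ η ^ 4 * Fintype.card V) (m : ℕ) (hm : 324 * m ≤ η ^ 4 * Fintype.card V) :
    ∃ A : Finset V, Matchable E A ∧ A.card ≤ 9 * m ∧ ∀ 𝒰 : Finset (Fin 3 → V),
      (𝒰.card : ℝ) ≤ η ^ 4 * m / 8 - 3 * Real.log (Fintype.card V) →
      (∀ u ∈ 𝒰, Function.Injective u ∧ ∀ i, u i ∈ P i ∧ u i ∉ A) →
      (𝒰 : Set (Fin 3 → V)).PairwiseDisjoint (fun u => Finset.univ.image u) →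
      Matchable E (A ∪ 𝒰.biUnion fun u => Finset.univ.image u) := by
  set n : ℝ := (Fintype.card V : ℝ) with hndef
  have hn0 : 0 < n := by
    by_contra h
    push Not at h
    have : η ^ 4 * n ≤ 0 := mul_nonpos_of_nonneg_of_nonpos (by positivity) h
    linarith
  let I := {u : Fin 3 → V // ∀ i, u i ∈ P i}
  have hI : Nonempty I := by
    have : 0 < (Finset.univ.filter fun a : Fin 3 → V =>
      (∀ i, a i ∈ P i) ∧ Finset.univ.image a ∈ E).card := by
      have : 0 < η * n ^ 3 := by positivity
      exact_mod_cast this.trans_le h1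
    obtain ⟨a, ha⟩ := Finset.card_pos.1 this
    exact ⟨⟨a, (Finset.mem_filter.1 ha).2.1⟩⟩
  -- A vertex lies in at most 9n⁸ arrays, so 9m occupied vertices block at most 81mn⁸ ≤ η⁴n⁹/4; this
  -- is the bound on 324m.
  obtain ⟨T, hTA, hTc, hTd, -, hT⟩ := exists_disjoint_selection (I := I) (gadgets E)
    (fun g => Finset.univ.image g) 9
    (fun g _ => by simpa using Finset.card_image_le (s := Finset.univ) (f := g))
    (fun g _ => by simp) ∅ (N := n ^ 9) (B := 9 * n ^ 8)
    (τ := η ^ 4 * n ^ 9 / 4)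
    (by
      have : (gadgets E).card ≤ Fintype.card (Fin 3 × Fin 3 → V) := Finset.card_le_univ _
      simp only [Fintype.card_fun, Fintype.card_prod, Fintype.card_fin] at this
      rw [hndef]
      exact_mod_cast this)
    (by positivity)
    (fun v => by
      have h3 := card_filter_mem_range_le (ι := Fin 3 × Fin 3) v
      simp only [Fintype.card_prod, Fintype.card_fin] at h3
      have h4 : ((gadgets E).filter fun g => v ∈ Finset.univ.image g) ⊆
          Finset.univ.filter fun g : Fin 3 × Fin 3 → V => ∃ j, g j = v := by
        intro g hg
        simpa using (Finset.mem_filter.1 hg).2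
      rw [hndef]
      exact_mod_cast (Finset.card_le_card h4).trans h3)
    m
    (by
      simp only [Finset.card_empty]
      have : 324 * m * n ^ 8 ≤ η ^ 4 * n * n ^ 8 := mul_le_mul_of_nonneg_right hm (by positivity)
      push_cast
      linarith)
    (fun u => absorbers E u.1) (fun u => Finset.filter_subset _ _)
    (fun u => by
      have := card_absorbers_ge hη h1 h2 hn u.2
      linarith)
  refine ⟨T.biUnion fun g => Finset.univ.image g,
    Matchable.biUnion _ _ (fun g hg => gadget_matchable (hTA hg)) hTd, ?_, ?_⟩
  · refine (Finset.card_biUnion_le_card_mul _ _ 9 fun g _ => ?_).trans (by rw [hTc, mul_comm])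
    simpa using Finset.card_image_le (s := Finset.univ) (f := g)
  intro 𝒰 hcard hU hUd
  have hTd' : ∀ t ∈ T, ∀ t' ∈ T, t ≠ t' → Disjoint (Finset.univ.image t) (Finset.univ.image t') :=
    fun t ht t' ht' hne => hTd ht ht' hne
  have hUd' : ∀ u ∈ 𝒰, ∀ u' ∈ 𝒰, u ≠ u' →
      Disjoint (Finset.univ.image u) (Finset.univ.image u') :=
    fun t ht t' ht' hne => hUd ht ht' hne
  have hlog : Real.log (Fintype.card I) ≤ 3 * Real.log n := by
    have h3 : Fintype.card I ≤ Fintype.card V ^ 3 := by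
      have := Fintype.card_subtype_le fun u : Fin 3 → V => ∀ i, u i ∈ P i
      simpa using this
    rw [← Real.log_rpow hn0]
    refine Real.log_le_log (by exact_mod_cast Fintype.card_pos) ?_
    rw [hndef]
    exact_mod_cast h3
  -- Hall's condition holds because each triple alone already has |𝒰| absorbers in `T`.
  obtain ⟨g, hginj, hg⟩ := (Finset.all_card_le_biUnion_card_iff_exists_injective
    (fun u : 𝒰 => T ∩ absorbers E u.1)).1 fun s => by
      rcases s.eq_empty_or_nonempty with rfl | ⟨u, hu⟩
      · simp
      have h3 : s.card ≤ 𝒰.card := by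
        simpa using Finset.card_le_univ s
      have h4 := hT ⟨u.1, fun i => ((hU u.1 u.2).2 i).1⟩
      have h5 : η ^ 4 * n ^ 9 / 4 / n ^ 9 * m / 2 = η ^ 4 * m / 8 := by
        field_simp
        ring
      rw [h5] at h4
      have h6 : (𝒰.card : ℝ) ≤ (T ∩ absorbers E u.1).card := by linarith
      have h7 : (T ∩ absorbers E u.1).card ≤ (s.biUnion fun u => T ∩ absorbers E u.1).card :=
        Finset.card_le_card (Finset.subset_biUnion_of_mem
          (fun u : 𝒰 => T ∩ absorbers E u.1) hu)
      have h8 : 𝒰.card ≤ (T ∩ absorbers E u.1).card := by exact_mod_cast h6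
      omega
  have hgT : ∀ u, g u ∈ T := fun u => (Finset.mem_inter.1 (hg u)).1
  have hnot : ∀ u ∈ 𝒰, ∀ i, ∀ t ∈ T, ∀ q, u i ≠ t q := by
    intro u hu i t ht q heq
    refine ((hU u hu).2 i).2 (Finset.mem_biUnion.2 ⟨t, ht, ?_⟩)
    rw [heq]
    exact Finset.mem_image_of_mem _ (Finset.mem_univ _)
  -- Unassigned gadgets are covered by their rows, assigned ones together with their triple.
  have hsplit : (T.biUnion fun g => Finset.univ.image g) ∪
      (𝒰.biUnion fun u => Finset.univ.image u) =
      ((T \ 𝒰.attach.image g).biUnion fun g => Finset.univ.image g) ∪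
      𝒰.attach.biUnion fun u => Finset.univ.image (g u) ∪ Finset.univ.image u.1 := by
    ext v
    simp only [Finset.mem_union, Finset.mem_biUnion, Finset.mem_sdiff]
    constructor
    · rintro (⟨t, ht, hv⟩ | ⟨u, hu, hv⟩)
      · by_cases h : t ∈ 𝒰.attach.image g
        · obtain ⟨u, hu, rfl⟩ := Finset.mem_image.1 h
          exact .inr ⟨u, hu, .inl hv⟩
        · exact .inl ⟨t, ⟨ht, h⟩, hv⟩
      · exact .inr ⟨⟨u, hu⟩, Finset.mem_attach _ _, .inr hv⟩
    · rintro (⟨t, ⟨ht, -⟩, hv⟩ | ⟨u, hu, hv | hv⟩)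
      · exact .inl ⟨t, ht, hv⟩
      · exact .inl ⟨g u, hgT u, hv⟩
      · exact .inr ⟨u.1, u.2, hv⟩
  have hdisj1 : ∀ u ∈ 𝒰, ∀ t ∈ T, Disjoint (Finset.univ.image t) (Finset.univ.image u) := by
    intro u hu t ht
    rw [Finset.disjoint_left]
    intro v hv hv'
    obtain ⟨q, -, rfl⟩ := Finset.mem_image.1 hv
    obtain ⟨i, -, hi⟩ := Finset.mem_image.1 hv'
    exact hnot u hu i t ht q hi
  rw [hsplit]
  refine (Matchable.biUnion _ _ (fun t ht => gadget_matchable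
    (hTA (Finset.mem_sdiff.1 ht).1)) (hTd.subset ?_)).union
    (Matchable.biUnion _ _ (fun u _ => absorber_matchable (Finset.mem_inter.1 (hg u)).2
      (hU u.1 u.2).1 fun i q => hnot u.1 u.2 i (g u) (hgT u) q) ?_) ?_
  · exact_mod_cast Finset.sdiff_subset
  · intro u _ u' _ hne
    rw [Function.onFun, Finset.disjoint_union_left, Finset.disjoint_union_right,
      Finset.disjoint_union_right]
    refine ⟨⟨hTd' _ (hgT u) _ (hgT u') fun h => hne (hginj h), ?_⟩, ?_, ?_⟩
    · exact hdisj1 _ u'.2 _ (hgT u)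
    · exact (hdisj1 _ u.2 _ (hgT u')).symm
    · exact hUd' _ u.2 _ u'.2 fun h => hne (Subtype.ext h)
  · rw [Finset.disjoint_biUnion_left]
    intro t ht
    obtain ⟨ht, htg⟩ := Finset.mem_sdiff.1 ht
    rw [Finset.disjoint_biUnion_right]
    intro u hu
    rw [Finset.disjoint_union_right]
    refine ⟨hTd' _ ht _ (hgT u) ?_, hdisj1 _ u.2 _ ht⟩
    rintro rfl
    exact htg (Finset.mem_image_of_mem _ hu)

end Absorption

/-! ### Links and fractional matchings on vertex subsets -/

section Link

variable {V : Type*} [DecidableEq V]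

/-- Two vertices are related by the link of `v` if they form an edge together with `v`. -/
def linkRel (E : Finset (Finset V)) (v a b : V) : Prop := {v, a, b} ∈ E

lemma linkRel_swap {E : Finset (Finset V)} {a b c : V} (h : linkRel E a b c) : linkRel E b a c := by
  unfold linkRel at *
  rwa [Finset.insert_comm]

lemma linkRel_swap' {E : Finset (Finset V)} {a b c : V} (h : linkRel E a b c) :
    linkRel E a c b := by
  unfold linkRel at *
  rwa [Finset.pair_comm]

lemma image_fin_three {β : Type*} (f : Fin 3 → β) (g : β → V) :
    Finset.univ.image (fun i => g (f i)) = {g (f 0), g (f 1), g (f 2)} := by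
  ext v
  simp only [Finset.mem_image, Finset.mem_univ, true_and, Finset.mem_insert, Finset.mem_singleton]
  constructor
  · rintro ⟨i, rfl⟩
    fin_cases i <;> simp
  · rintro (h | h | h)
    exacts [⟨0, h.symm⟩, ⟨1, h.symm⟩, ⟨2, h.symm⟩]

/-- `exists_decomposition` for the 3-graph induced on S. The set W need only contain all vertices
whose degree inside S is small, so a fixed W serves every remainder. -/
lemma exists_decomposition_on (E : Finset (Finset V)) {S : Finset V} (hS : S.Nonempty)
    (hpos : ∀ v ∈ S, 0 < pairCount (linkRel E v) S)
    (hadj : ∀ u ∈ S, ∀ v ∈ S, ∀ w ∈ S, linkRel E u v w → 6 / 5 * (S.card : ℝ) ^ 2 ≤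
      pairCount (linkRel E u) S + pairCount (linkRel E v) S)
    (W : Finset V) (hW : 3 * (W ∩ S).card ≤ S.card)
    (hWc : ∀ v ∈ S, v ∉ W → 3 / 5 * (S.card : ℝ) ^ 2 ≤ pairCount (linkRel E v) S) :
    ∃ x : (Fin 3 → S) → ℝ,
      IsDecomposition {f : Fin 3 → S | Finset.univ.image (fun i => (f i : V)) ∈ E} x := by
  have : Nonempty S := hS.to_subtype
  have hdeg : ∀ v : S, pairDegree (fun a b c : S => linkRel E (a : V) b c) v =
      pairCount (linkRel E (v : V)) S := by
    intro v
    unfold pairDegree pairCount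
    rw [← Finset.sum_coe_sort S]
    refine Finset.sum_congr rfl fun a _ => ?_
    rw [← Finset.sum_coe_sort S]
  obtain ⟨x, hx⟩ := exists_decomposition (fun a b c : S => linkRel E (a : V) b c)
    (fun a b c h => linkRel_swap h) (fun a b c h => linkRel_swap' h)
    (fun v => by
      by_contra hcon
      push Not at hcon
      have := hpos v v.2
      rw [← hdeg, pairDegree] at this
      simp [ind_of_not (hcon _ _)] at this)
    (fun u v w h => by
      rw [hdeg, hdeg, Fintype.card_coe]
      exact hadj _ u.2 _ v.2 _ w.2 h)
    (by
      simp only [hdeg, Fintype.card_coe]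
      refine le_trans (Nat.mul_le_mul_left 3 ?_) hW
      rw [Finset.sum_coe_sort S fun v =>
        ind ((pairCount (linkRel E v) S : ℝ) < 3 / 5 * (S.card : ℝ) ^ 2)]
      have h1 : ∀ v ∈ S, ind ((pairCount (linkRel E v) S : ℝ) < 3 / 5 * (S.card : ℝ) ^ 2) ≤
          if v ∈ W then 1 else 0 := by
        intro v hv
        split_ifs with h
        · exact ind_le_one _
        · exact (ind_of_not (not_lt.2 (hWc v hv h))).le
      refine (Finset.sum_le_sum h1).trans ?_
      rw [Finset.sum_boole, Nat.cast_id, Finset.filter_mem_eq_inter, Finset.inter_comm])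
  refine ⟨x, hx.nonneg, fun f hf => ?_, hx.sum_eq_one, hx.marginal⟩
  have h := hx.mem f hf
  simp only [Set.mem_ofPred_eq] at h ⊢
  rw [image_fin_three f (fun v => (v : V))]
  exact h

end Link

/-! ### Almost perfect matchings from robust degree conditions -/

section AlmostMatching

variable {V : Type*} [DecidableEq V]

/-- A threshold above which the guided removal process works. -/
noncomputable def guidedThreshold (γ ε : ℝ) : ℝ :=
  1 + 6 / ε + 625 / ε ^ 2 + 144 / (ε * γ / 50) ^ 4

/-- A robust form of the degree conditions yields a matching in a subfamily `E'` that covers all but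
an `ε`-proportion of the vertices, as long as the fractional matchings live in `E'`. -/
lemma exists_matching_missing_few {γ ε : ℝ} (hγ : 0 < γ) (hε : 0 < ε)
    {E E' : Finset (Finset V)} (hE' : ∀ e ∈ E', e.card = 3) {W V₀ : Finset V}
    (hn : guidedThreshold γ ε ≤ V₀.card)
    (hadj : ∀ u ∈ V₀, ∀ v ∈ V₀, ∀ w ∈ V₀, linkRel E u v w → (6 / 5 + γ) * (V₀.card : ℝ) ^ 2 ≤
      pairCount (linkRel E u) V₀ + pairCount (linkRel E v) V₀)
    (hpos : ∀ v ∈ V₀, γ * (V₀.card : ℝ) ^ 2 ≤ pairCount (linkRel E v) V₀)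
    (hWc : ∀ v ∈ V₀, v ∉ W → (3 / 5 + γ) * (V₀.card : ℝ) ^ 2 ≤ pairCount (linkRel E v) V₀)
    (hW : ∀ S ⊆ V₀, Matchable E' (V₀ \ S) →
      density (fun a b => a ∉ W ∧ b ∉ W) V₀ - γ / 2 ≤ density (fun a b => a ∉ W ∧ b ∉ W) S →
      S.Nonempty → 3 * (W ∩ S).card ≤ S.card ∧ ∀ x : (Fin 3 → S) → ℝ,
        IsDecomposition {f : Fin 3 → S | Finset.univ.image (fun i => (f i : V)) ∈ E} x →
        IsDecomposition {f : Fin 3 → S | Finset.univ.image (fun i => (f i : V)) ∈ E'} x) :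
    ∃ S ⊆ V₀, Matchable E' (V₀ \ S) ∧ (S.card : ℝ) < ε * V₀.card := by
  set n : ℝ := (V₀.card : ℝ) with hndef
  have p1 : 0 ≤ 6 / ε := by positivity
  have p2 : 0 ≤ 625 / ε ^ 2 := by positivity
  have p3 : 0 ≤ 144 / (ε * γ / 50) ^ 4 := by positivity
  rw [guidedThreshold] at hn
  have hn1 : 1 ≤ n := by linarith
  have hn6 : 6 ≤ ε * n := by
    have : 6 / ε ≤ n := by linarith
    rwa [div_le_iff₀ hε, mul_comm] at this
  have hn625 : 625 ≤ ε ^ 2 * n := by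
    have : 625 / ε ^ 2 ≤ n := by linarith
    rwa [div_le_iff₀ (by positivity), mul_comm] at this
  have hn144 : 144 ≤ (ε * γ / 50) ^ 4 * n := by
    have : 144 / (ε * γ / 50) ^ 4 ≤ n := by linarith
    rwa [div_le_iff₀ (by positivity), mul_comm] at this
  have hsq : √n ^ 2 = n := Real.sq_sqrt (by linarith)
  have hsq1 : 1 ≤ √n := Real.one_le_sqrt.2 hn1
  have hlam1 : 1 ≤ ε * √n / 25 := by
    rw [le_div_iff₀ (by norm_num), one_mul]
    refine le_of_sq_le_sq ?_ (by positivity)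
    rw [mul_pow, hsq]
    linarith
  -- The tracked relations are all links, plus (at `none`) the pairs avoiding `W`, which control |W
  -- ∩ S|. A density loss of γ/2 per link uses up exactly the slack γ in a degree sum.
  refine exists_almost_matching (J := Option V₀) hE'
    (fun j => j.elim (fun a b => a ∉ W ∧ b ∉ W) fun v => linkRel E (v : V)) V₀
    (lam := ε * √n / 25) (ξ := γ / 2) hn6 hlam1 ?_ ?_ ?_ ?_
  · nlinarith [mul_pos hε (by linarith : 0 < √n)]
  -- With lam = ε√n/25 and L = εn the quantity is 612/625, whence the 25.
  · rw [← hndef, mul_div_assoc', div_le_one (by positivity), div_pow, mul_pow, hsq]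
    have : 0 ≤ ε ^ 2 * n ^ 2 := by positivity
    nlinarith
  · rw [Fintype.card_option, Fintype.card_coe]
    have h1 : ε * √n / 25 * (γ / 2) = ε * γ / 50 * √n := by ring
    rw [h1]
    -- The bound x⁴/24 ≤ exp x is quadratic in n; the constant 144 = 24 · 6 yields 6n ≥ 3(n + 1).
    have h2 := Real.pow_div_factorial_le_exp (ε * γ / 50 * √n) (by positivity) 4
    refine le_trans ?_ h2
    have h3 : (ε * γ / 50 * √n) ^ 4 = (ε * γ / 50) ^ 4 * n * n := by
      rw [mul_pow, show √n ^ 4 = (√n ^ 2) ^ 2 by ring, hsq]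
      ring
    rw [h3, le_div_iff₀ (by positivity)]
    have h4 : ((4).factorial : ℝ) = 24 := by norm_num [Nat.factorial]
    rw [h4]
    push_cast
    rw [← hndef]
    have h5 := mul_le_mul_of_nonneg_right hn144 (by linarith : 0 ≤ n)
    linarith
  · intro S hS hM hL hdens
    have hs : 0 < (S.card : ℝ) := lt_of_lt_of_le (by linarith) hL
    have hSne : S.Nonempty := Finset.card_pos.1 (by exact_mod_cast hs)
    obtain ⟨hW1, hW2⟩ := hW S hS hM (hdens none) hSne
    have hlow : ∀ v ∈ S, ∀ c : ℝ, c * n ^ 2 ≤ pairCount (linkRel E v) V₀ →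
        (c - γ / 2) * (S.card : ℝ) ^ 2 ≤ pairCount (linkRel E v) S := by
      intro v hv c hc
      have h1 := hdens (some ⟨v, hS hv⟩)
      simp only [Option.elim_some, density] at h1
      rw [← le_div_iff₀ (by positivity)] at hc ⊢
      linarith
    have hsq : 0 < (S.card : ℝ) ^ 2 := by positivity
    obtain ⟨x, hx⟩ := exists_decomposition_on E hSne (fun v hv => by
        have h1 := hlow v hv γ (hpos v (hS hv))
        have h2 : (0 : ℝ) < pairCount (linkRel E v) S :=
          lt_of_lt_of_le (mul_pos (by linarith) hsq) h1
        exact_mod_cast h2)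
      (fun u hu v hv w hw h => by
        have h1 := hadj u (hS hu) v (hS hv) w (hS hw) h
        have h2 := hlow u hu (pairCount (linkRel E u) V₀ / n ^ 2)
          (by rw [div_mul_cancel₀]; positivity)
        have h3 := hlow v hv (pairCount (linkRel E v) V₀ / n ^ 2)
          (by rw [div_mul_cancel₀]; positivity)
        rw [← le_div_iff₀ (by positivity), add_div] at h1
        have h4 := mul_le_mul_of_nonneg_right h1 hsq.le
        linarith)
      W hW1
      (fun v hv hvW => by
        have h1 := hlow v hv _ (hWc v (hS hv) hvW)
        have h2 : 0 ≤ γ / 2 * (S.card : ℝ) ^ 2 := by positivity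
        linarith)
    exact ⟨x, hW2 x hx⟩

end AlmostMatching

/-! ### Counting tools, the degree conditions and the reserve -/

section Utilities

variable {V : Type*} [DecidableEq V]

lemma pairCount_link (E : Finset (Finset V)) (v : V) (S : Finset V) :
    pairCount (linkRel E v) S = ((S ×ˢ S).filter fun p => {v, p.1, p.2} ∈ E).card := by
  rw [Finset.card_filter, Finset.sum_product]
  refine Finset.sum_congr rfl fun a _ => Finset.sum_congr rfl fun b _ => ?_
  unfold ind linkRel
  congr

lemma Matchable.three_dvd_card {E : Finset (Finset V)} (hE : ∀ e ∈ E, e.card = 3) {S : Finset V}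
    (h : Matchable E S) : 3 ∣ S.card := by
  obtain ⟨M, h1, h2, rfl⟩ := h
  rw [Finset.card_biUnion fun e he f hf hne => h2 he hf hne]
  exact Finset.dvd_sum fun e he => by rw [id, hE e (h1 he)]

/-- A matching by edges with exactly one vertex in W keeps W balanced at one third. -/
lemma Matchable.card_inter {E : Finset (Finset V)} {W : Finset V}
    (hE : ∀ e ∈ E, e.card = 3 ∧ (W ∩ e).card = 1) {S : Finset V} (h : Matchable E S) :
    3 * (W ∩ S).card = S.card := by
  obtain ⟨M, h1, h2, rfl⟩ := h
  rw [Finset.inter_biUnion, Finset.card_biUnion fun e he f hf hne => h2 he hf hne,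
    Finset.card_biUnion fun e he f hf hne => ?_]
  · have e1 : ∑ e ∈ M, (W ∩ id e).card = ∑ _e ∈ M, 1 :=
      Finset.sum_congr rfl fun e he => (hE e (h1 he)).2
    have e2 : ∑ e ∈ M, (id e).card = ∑ _e ∈ M, 3 :=
      Finset.sum_congr rfl fun e he => (hE e (h1 he)).1
    rw [e1, e2]
    simp [mul_comm]
  · exact Finset.disjoint_of_subset_left Finset.inter_subset_right
      (Finset.disjoint_of_subset_right Finset.inter_subset_right (h2 he hf hne))

lemma Matchable.subset {E : Finset (Finset V)} {T : Finset V} (hE : ∀ e ∈ E, e ⊆ T)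
    {S : Finset V} (h : Matchable E S) : S ⊆ T := by
  obtain ⟨M, h1, h2, rfl⟩ := h
  exact Finset.biUnion_subset.2 fun e he => hE e (h1 he)

lemma exists_triples (R : Fin 3 → Finset V) (k : ℕ) (hk : ∀ i, (R i).card = k)
    (hd : ∀ i j, i ≠ j → Disjoint (R i) (R j)) :
    ∃ 𝒰 : Finset (Fin 3 → V), 𝒰.card ≤ k ∧ (∀ u ∈ 𝒰, Function.Injective u ∧ ∀ i, u i ∈ R i) ∧
      (𝒰 : Set (Fin 3 → V)).PairwiseDisjoint (fun u => Finset.univ.image u) ∧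
      𝒰.biUnion (fun u => Finset.univ.image u) = Finset.univ.biUnion R := by
  let e : ∀ i, R i ≃ Fin k := fun i => (R i).equivFinOfCardEq (hk i)
  let u : Fin k → Fin 3 → V := fun c i => ((e i).symm c : V)
  have hu : ∀ c i, u c i ∈ R i := fun c i => ((e i).symm c).2
  have hsep : ∀ c c' i j, u c i = u c' j → i = j ∧ c = c' := by
    intro c c' i j h
    have hij : i = j := by
      by_contra hne
      exact Finset.disjoint_left.1 (hd i j hne) (hu c i) (h ▸ hu c' j)
    subst hij
    exact ⟨rfl, (e i).symm.injective (Subtype.ext h)⟩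
  refine ⟨Finset.univ.image u, ?_, ?_, ?_, ?_⟩
  · exact Finset.card_image_le.trans (by simp)
  · intro v hv
    obtain ⟨c, -, rfl⟩ := Finset.mem_image.1 hv
    exact ⟨fun i j h => (hsep _ _ _ _ h).1, hu c⟩
  · intro v hv v' hv' hne
    obtain ⟨c, -, rfl⟩ := Finset.mem_image.1 (Finset.mem_coe.1 hv)
    obtain ⟨c', -, rfl⟩ := Finset.mem_image.1 (Finset.mem_coe.1 hv')
    rw [Function.onFun, Finset.disjoint_left]
    intro a ha ha'
    obtain ⟨i, -, rfl⟩ := Finset.mem_image.1 ha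
    obtain ⟨j, -, hj⟩ := Finset.mem_image.1 ha'
    exact hne (by rw [(hsep _ _ _ _ hj).2])
  · ext v
    simp only [Finset.mem_biUnion, Finset.mem_image, Finset.mem_univ, true_and]
    constructor
    · rintro ⟨_, ⟨c, rfl⟩, i, rfl⟩
      exact ⟨i, hu c i⟩
    · rintro ⟨i, hi⟩
      refine ⟨u (e i ⟨v, hi⟩), ⟨_, rfl⟩, i, ?_⟩
      simp [u]

/-- Inclusion–exclusion: two links that together outweigh a common container Ω overlap. -/
lemma card_add_card_le_commonLink (E : Finset (Finset V)) (x y : V) (S : Finset V)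
    (Ω : Finset (V × V))
    (hx : ((S ×ˢ S).filter fun p => {x, p.1, p.2} ∈ E) ⊆ Ω)
    (hy : ((S ×ˢ S).filter fun p => {y, p.1, p.2} ∈ E) ⊆ Ω) :
    pairCount (linkRel E x) S + pairCount (linkRel E y) S ≤
      Ω.card + ((S ×ˢ S).filter fun p => {x, p.1, p.2} ∈ E ∧ {y, p.1, p.2} ∈ E).card := by
  rw [pairCount_link, pairCount_link, ← Finset.card_union_add_card_inter, ← Finset.filter_and]
  exact Nat.add_le_add_right (Finset.card_le_card (Finset.union_subset hx hy)) _

lemma exists_triples_of_dvd {R : Finset V} (h : 3 ∣ R.card) :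
    ∃ 𝒰 : Finset (Fin 3 → V), 3 * 𝒰.card ≤ R.card ∧
      (∀ u ∈ 𝒰, Function.Injective u ∧ ∀ i, u i ∈ R) ∧
      (𝒰 : Set (Fin 3 → V)).PairwiseDisjoint (fun u => Finset.univ.image u) ∧
      𝒰.biUnion (fun u => Finset.univ.image u) = R := by
  obtain ⟨k, hk⟩ := h
  obtain ⟨R₀, h0, c0⟩ := Finset.exists_subset_card_eq (s := R) (n := k) (by omega)
  have c01 : (R \ R₀).card = 2 * k := by
    rw [Finset.card_sdiff_of_subset h0]
    omega
  obtain ⟨R₁, h1, c1⟩ := Finset.exists_subset_card_eq (s := R \ R₀) (n := k) (by omega)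
  have c2 : ((R \ R₀) \ R₁).card = k := by
    rw [Finset.card_sdiff_of_subset h1]
    omega
  have d01 : Disjoint R₀ R₁ := Finset.disjoint_of_subset_right h1 Finset.disjoint_sdiff
  have d02 : Disjoint R₀ ((R \ R₀) \ R₁) :=
    Finset.disjoint_of_subset_right Finset.sdiff_subset Finset.disjoint_sdiff
  have d12 : Disjoint R₁ ((R \ R₀) \ R₁) := Finset.disjoint_sdiff
  obtain ⟨𝒰, hc, hu, hd, hun⟩ := exists_triples ![R₀, R₁, (R \ R₀) \ R₁] k
    (fun i => by fin_cases i; exacts [c0, c1, c2])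
    (fun i j hij => by
      fin_cases i <;> fin_cases j <;>
        first
        | exact absurd rfl hij
        | exact d01
        | exact d02
        | exact d12
        | exact d01.symm
        | exact d02.symm
        | exact d12.symm)
  have hR : (Finset.univ : Finset (Fin 3)).biUnion ![R₀, R₁, (R \ R₀) \ R₁] = R := by
    ext v
    simp only [Finset.mem_biUnion, Finset.mem_univ, true_and, Fin.exists_fin_succ,
      Matrix.cons_val_zero, Matrix.cons_val_succ, IsEmpty.exists_iff, or_false,
      Finset.mem_sdiff]
    have := @h0 v
    have := @h1 v
    simp only [Finset.mem_sdiff] at this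
    tauto
  rw [hR] at hun
  refine ⟨𝒰, by omega, fun u hu' => ⟨(hu u hu').1, fun i => ?_⟩, hd, hun⟩
  rw [← hR]
  exact Finset.mem_biUnion.2 ⟨i, Finset.mem_univ _, (hu u hu').2 i⟩

lemma pairCount_notMem (W S : Finset V) :
    pairCount (fun a b => a ∉ W ∧ b ∉ W) S = (S \ W).card ^ 2 := by
  have h : ∀ a b : V, ind (a ∉ W ∧ b ∉ W) = (if a ∉ W then 1 else 0) * if b ∉ W then 1 else 0 := by
    intro a b
    unfold ind
    by_cases ha : a ∈ W <;> by_cases hb : b ∈ W <;> simp [ha, hb]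
  unfold pairCount
  simp only [h]
  rw [← Finset.sum_mul_sum, Finset.sum_boole, Finset.filter_notMem_eq_sdiff, Nat.cast_id, pow_two]

variable [Fintype V]

lemma card_triples_ge (E : Finset (Finset V)) (P : Fin 3 → Finset V) {c : ℝ}
    (h : ∀ x ∈ P 0, c ≤ ((P 1 ×ˢ P 2).filter fun p => {x, p.1, p.2} ∈ E).card) :
    (P 0).card * c ≤ (Finset.univ.filter fun a : Fin 3 → V =>
      (∀ i, a i ∈ P i) ∧ Finset.univ.image a ∈ E).card := by
  have h1 : ((P 0).sigma fun x => (P 1 ×ˢ P 2).filter fun p => {x, p.1, p.2} ∈ E).card ≤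
      (Finset.univ.filter fun a : Fin 3 → V =>
        (∀ i, a i ∈ P i) ∧ Finset.univ.image a ∈ E).card := by
    refine Finset.card_le_card_of_injOn (fun s => ![s.1, s.2.1, s.2.2]) ?_ ?_
    · rintro ⟨x, a, b⟩ hs
      simp only [Finset.coe_sigma, Set.mem_sigma_iff, Finset.mem_coe, Finset.mem_filter,
        Finset.mem_product] at hs
      obtain ⟨hx, ⟨ha, hb⟩, hE⟩ := hs
      simp only [Finset.mem_coe, Finset.mem_filter, Finset.mem_univ, true_and]
      refine ⟨fun i => ?_, ?_⟩
      · fin_cases i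
        exacts [hx, ha, hb]
      · have := image_fin_three ![x, a, b] id
        simp only [id] at this
        rw [this]
        exact hE
    · rintro ⟨x, a, b⟩ - ⟨x', a', b'⟩ - heq
      have e0 : x = x' := congrFun heq 0
      have e1 : a = a' := congrFun heq 1
      have e2 : b = b' := congrFun heq 2
      rw [e0, e1, e2]
  rw [Finset.card_sigma] at h1
  have h2 : ((P 0).card : ℝ) * c ≤ ∑ x ∈ P 0,
      (((P 1 ×ˢ P 2).filter fun p => {x, p.1, p.2} ∈ E).card : ℝ) := by
    rw [← nsmul_eq_mul]
    exact Finset.card_nsmul_le_sum _ _ _ h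
  exact h2.trans (by exact_mod_cast h1)

lemma pairCount_univ_le (G : V → V → Prop) (Z : Finset V) :
    (pairCount G Finset.univ : ℝ) ≤
      pairCount G (Finset.univ \ Z) + 2 * Z.card * Fintype.card V := by
  have h1 := pairCount_le_sdiff_add G (Finset.subset_univ Z)
  have h2 : ∑ a ∈ Z, incidence G Finset.univ a ≤ Z.card * (2 * Fintype.card V) := by
    rw [← smul_eq_mul]
    exact Finset.sum_le_card_nsmul _ _ _ fun a _ => incidence_le _ _ _
  have h3 : pairCount G Finset.univ ≤
      pairCount G (Finset.univ \ Z) + 2 * Z.card * Fintype.card V := by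
    refine h1.trans (Nat.add_le_add_left (h2.trans (le_of_eq (by ring))) _)
  exact_mod_cast h3

/-- The degree conditions: `E` is a `3`-graph without isolated vertices in which the degrees of
adjacent vertices (counted by ordered pairs) have a large sum, and `W` is the set of vertices of
small degree, which has size at most a third. -/
structure DegreeCond (E : Finset (Finset V)) (γ : ℝ) (W : Finset V) : Prop where
  uniform : ∀ e ∈ E, e.card = 3
  adj : ∀ u v w, linkRel E u v w → (6 / 5 + γ) * (Fintype.card V : ℝ) ^ 2 ≤
    pairCount (linkRel E u) Finset.univ + pairCount (linkRel E v) Finset.univ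
  exists_link : ∀ v, ∃ a b, linkRel E v a b
  mem_iff : ∀ v, v ∈ W ↔
    (pairCount (linkRel E v) Finset.univ : ℝ) < (3 / 5 + γ / 2) * (Fintype.card V : ℝ) ^ 2
  card_le : 3 * W.card ≤ Fintype.card V

namespace DegreeCond

variable {E : Finset (Finset V)} {γ : ℝ} {W : Finset V}

lemma notMem_of_mem (h : DegreeCond E γ W) {u v w : V} (hl : linkRel E u v w) (hu : u ∈ W) :
    v ∉ W := by
  intro hv
  have h1 := h.adj _ _ _ hl
  have h2 := (h.mem_iff u).1 hu
  have h3 := (h.mem_iff v).1 hv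
  linarith

/-- Even a vertex of W has this degree, since a neighbour has degree at most n² and 6/5 - 1 = 1/5.
-/
lemma degree_ge (h : DegreeCond E γ W) (v : V) :
    (1 / 5 + γ) * (Fintype.card V : ℝ) ^ 2 ≤ pairCount (linkRel E v) Finset.univ := by
  obtain ⟨a, b, hab⟩ := h.exists_link v
  have h1 := h.adj _ _ _ hab
  have h2 : (pairCount (linkRel E a) Finset.univ : ℝ) ≤ (Fintype.card V : ℝ) ^ 2 := by
    exact_mod_cast pairCount_le_sq (linkRel E a) Finset.univ
  linarith

lemma inter_edge_card_le (h : DegreeCond E γ W) {e : Finset V} (he : e ∈ E) :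
    (W ∩ e).card ≤ 1 := by
  rw [Finset.card_le_one]
  intro u hu v hv
  by_contra hne
  obtain ⟨huW, hue⟩ := Finset.mem_inter.1 hu
  obtain ⟨hvW, hve⟩ := Finset.mem_inter.1 hv
  obtain ⟨a, b, c, hab, hac, hbc, rfl⟩ := Finset.card_eq_three.1 (h.uniform e he)
  have h1 : linkRel E a b c := he
  have h2 := linkRel_swap h1
  have h3 := linkRel_swap' h1
  have h4 := linkRel_swap' h2
  have h5 := linkRel_swap h3
  have h6 := linkRel_swap h4
  simp only [Finset.mem_insert, Finset.mem_singleton] at hue hve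
  rcases hue with rfl | rfl | rfl <;> rcases hve with rfl | rfl | rfl <;>
    first
    | exact hne rfl
    | exact h.notMem_of_mem h1 huW hvW
    | exact h.notMem_of_mem h2 huW hvW
    | exact h.notMem_of_mem h3 huW hvW
    | exact h.notMem_of_mem h4 huW hvW
    | exact h.notMem_of_mem h5 huW hvW
    | exact h.notMem_of_mem h6 huW hvW

lemma pairCount_le_compl_add (G : V → V → Prop) (W : Finset V) :
    (pairCount G Finset.univ : ℝ) ≤ pairCount G (Finset.univ \ W) +
      ((Fintype.card V : ℝ) ^ 2 - ((Fintype.card V : ℝ) - W.card) ^ 2) := by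
  classical
  have hcount : ∀ S : Finset V, pairCount G S = ((S ×ˢ S).filter fun p => G p.1 p.2).card := by
    intro S
    rw [Finset.card_filter, Finset.sum_product]
    refine Finset.sum_congr rfl fun a _ => Finset.sum_congr rfl fun b _ => ?_
    unfold ind
    congr
  set U := Finset.univ \ W with hU
  have hUc : (U.card : ℝ) = Fintype.card V - W.card := by
    rw [hU, Finset.card_sdiff_of_subset (Finset.subset_univ _),
      Finset.card_univ, Nat.cast_sub (Finset.card_le_univ _)]
  have h1 : ((Finset.univ ×ˢ Finset.univ : Finset (V × V)).filter fun p => G p.1 p.2) ⊆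
      ((U ×ˢ U).filter fun p => G p.1 p.2) ∪ (Finset.univ \ (U ×ˢ U)) := by
    intro p hp
    by_cases h : p ∈ U ×ˢ U
    · exact Finset.mem_union_left _ (Finset.mem_filter.2 ⟨h, (Finset.mem_filter.1 hp).2⟩)
    · exact Finset.mem_union_right _ (Finset.mem_sdiff.2 ⟨Finset.mem_univ _, h⟩)
  have h2 := (Finset.card_le_card h1).trans (Finset.card_union_le _ _)
  rw [← hcount, ← hcount] at h2
  have h3 : (((Finset.univ \ (U ×ˢ U) : Finset (V × V)).card : ℕ) : ℝ) =
      (Fintype.card V : ℝ) ^ 2 - ((Fintype.card V : ℝ) - W.card) ^ 2 := by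
    rw [Finset.card_sdiff_of_subset (Finset.subset_univ _),
      Finset.card_univ, Nat.cast_sub (Finset.card_le_univ _), Fintype.card_prod,
      Finset.card_product]
    push_cast
    rw [hUc]
    ring
  rw [← h3]
  exact_mod_cast h2

/-- As |W| ≤ n/3, at most 5n²/9 pairs meet W, and 3/5 - 5/9 = 2/45 > 1/25. -/
lemma pairCount_heavy (h : DegreeCond E γ W) (hγ : 0 < γ) {u : V} (hu : u ∉ W) :
    1 / 25 * (Fintype.card V : ℝ) ^ 2 ≤ pairCount (linkRel E u) (Finset.univ \ W) := by
  have h1 := pairCount_le_compl_add (linkRel E u) W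
  have h2 := not_lt.1 (mt (h.mem_iff u).2 hu)
  have h3 : (3 * W.card : ℝ) ≤ Fintype.card V := by exact_mod_cast h.card_le
  have h4 : (2 / 3 * (Fintype.card V : ℝ)) ^ 2 ≤ ((Fintype.card V : ℝ) - W.card) ^ 2 :=
    pow_le_pow_left₀ (by positivity) (by linarith) 2
  have h5 : 0 ≤ γ * (Fintype.card V : ℝ) ^ 2 := by positivity
  nlinarith

lemma pair_mem_compl (h : DegreeCond E γ W) {w a b : V} (hw : w ∈ W) (hl : linkRel E w a b) :
    a ∉ W ∧ b ∉ W :=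
  ⟨h.notMem_of_mem hl hw, h.notMem_of_mem (linkRel_swap' hl) hw⟩

end DegreeCond

/-- The link of w ∈ W lies entirely outside W and has at least n²/5 pairs, so the greedy selection
with τ = n²/10 finds disjoint pairs that serve all of W simultaneously. They later rescue the
uncovered vertices of W. -/
lemma exists_reserve {E : Finset (Finset V)} {γ : ℝ} {W : Finset V} (h : DegreeCond E γ W)
    (hγ : 0 < γ) (hn : 0 < Fintype.card V) (Z : Finset V) (m : ℕ)
    (hm : 20 * ((Z.card : ℝ) + 2 * m) ≤ Fintype.card V) :
    ∃ T : Finset (V × V), T.card ≤ m ∧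
      (T : Set (V × V)).PairwiseDisjoint (fun p => ({p.1, p.2} : Finset V)) ∧
      (∀ p ∈ T, p.1 ≠ p.2 ∧ p.1 ∉ W ∧ p.2 ∉ W ∧ p.1 ∉ Z ∧ p.2 ∉ Z) ∧
      ∀ w ∈ W, (m : ℝ) / 20 - Real.log (Fintype.card V) ≤
        (T.filter fun p => {w, p.1, p.2} ∈ E).card := by
  rcases W.eq_empty_or_nonempty with rfl | hWne
  · exact ⟨∅, by simp, by simp, by simp, by simp⟩
  have : Nonempty W := hWne.to_subtype
  set n : ℝ := (Fintype.card V : ℝ) with hndef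
  have hn0 : 0 < n := by rw [hndef]; exact_mod_cast hn
  set A : Finset (V × V) := Finset.univ.filter fun p => p.1 ≠ p.2 ∧ p.1 ∉ W ∧ p.2 ∉ W with hA
  obtain ⟨T, hTA, hTc, hTd, hTZ, hT⟩ := exists_disjoint_selection (I := W) A
    (fun p => ({p.1, p.2} : Finset V)) 2 (fun p _ => Finset.card_le_two)
    (fun p _ => by simp) Z (N := n ^ 2) (B := 2 * n) (τ := n ^ 2 / 10)
    (by
      have : A.card ≤ Fintype.card (V × V) := Finset.card_le_univ _
      rw [Fintype.card_prod, ← pow_two] at this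
      rw [hndef]
      exact_mod_cast this)
    (by positivity)
    (fun v => by
      have h1 : (A.filter fun p => v ∈ ({p.1, p.2} : Finset V)) ⊆
          ({v} ×ˢ Finset.univ) ∪ (Finset.univ ×ˢ {v}) := by
        intro p hp
        have := (Finset.mem_filter.1 hp).2
        simp only [Finset.mem_insert, Finset.mem_singleton] at this
        simp only [Finset.mem_union, Finset.mem_product, Finset.mem_singleton, Finset.mem_univ,
          and_true, true_and]
        rcases this with h | h
        exacts [.inl h.symm, .inr h.symm]
      have h2 := (Finset.card_le_card h1).trans (Finset.card_union_le _ _)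
      rw [Finset.card_product, Finset.card_product, Finset.card_singleton, Finset.card_univ,
        one_mul, mul_one, ← two_mul] at h2
      rw [hndef]
      exact_mod_cast h2)
    m
    (by
      push_cast
      nlinarith)
    (fun w => A.filter fun p => {(w : V), p.1, p.2} ∈ E) (fun w => Finset.filter_subset _ _)
    (fun w => by
      have h1 := h.degree_ge w
      rw [pairCount_link] at h1
      have h2 : ((Finset.univ ×ˢ Finset.univ).filter fun p : V × V => {(w : V), p.1, p.2} ∈ E) ⊆
          A.filter fun p => {(w : V), p.1, p.2} ∈ E := by
        intro p hp
        have hp := (Finset.mem_filter.1 hp).2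
        refine Finset.mem_filter.2 ⟨Finset.mem_filter.2 ⟨Finset.mem_univ _, ?_,
          h.pair_mem_compl w.2 hp⟩, hp⟩
        intro heq
        have := h.uniform _ hp
        rw [heq, Finset.pair_eq_singleton] at this
        have := Finset.card_le_two (a := (w : V)) (b := p.2)
        omega
      have h3 : (((Finset.univ ×ˢ Finset.univ).filter
          fun p : V × V => {(w : V), p.1, p.2} ∈ E).card : ℝ) ≤
          (A.filter fun p => {(w : V), p.1, p.2} ∈ E).card := by
        exact_mod_cast Finset.card_le_card h2
      have h4 : 0 ≤ γ * n ^ 2 := by positivity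
      linarith)
  refine ⟨T, hTc.le, hTd, fun p hp => ?_, fun w hw => ?_⟩
  · have h1 := (Finset.mem_filter.1 (hTA hp)).2
    have h2 := hTZ p hp
    rw [Finset.disjoint_left] at h2
    exact ⟨h1.1, h1.2.1, h1.2.2, h2 (by simp), h2 (by simp)⟩
  · have h1 := hT ⟨w, hw⟩
    have h2 : n ^ 2 / 10 / n ^ 2 * m / 2 = m / 20 := by
      field_simp
      ring
    rw [h2, Fintype.card_coe] at h1
    have h3 : Real.log W.card ≤ Real.log n := by
      refine Real.log_le_log (by exact_mod_cast hWne.card_pos) ?_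
      rw [hndef]
      exact_mod_cast Finset.card_le_univ _
    have h4 : (T ∩ A.filter fun p => {w, p.1, p.2} ∈ E).card ≤
        (T.filter fun p => {w, p.1, p.2} ∈ E).card := by
      refine Finset.card_le_card fun p hp => ?_
      obtain ⟨hp1, hp2⟩ := Finset.mem_inter.1 hp
      exact Finset.mem_filter.2 ⟨hp1, (Finset.mem_filter.1 hp2).2⟩
    have h5 : ((T ∩ A.filter fun p => {w, p.1, p.2} ∈ E).card : ℝ) ≤
        (T.filter fun p => {w, p.1, p.2} ∈ E).card := by exact_mod_cast h4
    linarith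

end Utilities

/-! ### Ingredients when W is clearly smaller than a third -/

section LightCase

variable {V : Type*} [DecidableEq V]

lemma exists_injective_of_card_le {κ β : Type*} [DecidableEq β] (s : Finset κ)
    (F : κ → Finset β) (h : ∀ w ∈ s, s.card ≤ (F w).card) :
    ∃ g : s → β, Function.Injective g ∧ ∀ w : s, g w ∈ F w := by
  refine (Finset.all_card_le_biUnion_card_iff_exists_injective fun w : s => F w).1 fun t => ?_
  rcases t.eq_empty_or_nonempty with rfl | ⟨w, hw⟩
  · simp
  · calc t.card ≤ s.card := by
          simpa using Finset.card_le_univ t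
      _ ≤ (F w).card := h w w.2
      _ ≤ _ := Finset.card_le_card (Finset.subset_biUnion_of_mem (fun w : s => F w) hw)

/-- Every vertex of R sees at least |R| of the reserved pairs, so Hall's theorem gives each its own
pair. -/
lemma exists_matchable_union_pairs {E : Finset (Finset V)} {T : Finset (V × V)}
    (hT : (T : Set (V × V)).PairwiseDisjoint (fun p => ({p.1, p.2} : Finset V)))
    {R : Finset V} (hR : ∀ p ∈ T, p.1 ∉ R ∧ p.2 ∉ R)
    (h : ∀ w ∈ R, R.card ≤ (T.filter fun p => {w, p.1, p.2} ∈ E).card) :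
    ∃ Q ⊆ T.biUnion (fun p => {p.1, p.2}), Matchable E (R ∪ Q) := by
  obtain ⟨g, hg, hgF⟩ := exists_injective_of_card_le R _ h
  have hgT : ∀ w, g w ∈ T := fun w => (Finset.mem_filter.1 (hgF w)).1
  refine ⟨Finset.univ.biUnion fun w : R => {(g w).1, (g w).2}, ?_, ?_⟩
  · refine Finset.biUnion_subset.2 fun w _ => ?_
    exact Finset.subset_biUnion_of_mem (fun p : V × V => ({p.1, p.2} : Finset V)) (hgT w)
  · have h1 : R ∪ (Finset.univ.biUnion fun w : R => {(g w).1, (g w).2}) =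
        Finset.univ.biUnion fun w : R => {(w : V), (g w).1, (g w).2} := by
      ext v
      simp only [Finset.mem_union, Finset.mem_biUnion, Finset.mem_univ, true_and,
        Finset.mem_insert, Finset.mem_singleton, Subtype.exists]
      constructor
      · rintro (hv | ⟨w, hw, hv⟩)
        exacts [⟨v, hv, .inl rfl⟩, ⟨w, hw, .inr hv⟩]
      · rintro ⟨w, hw, rfl | hv⟩
        exacts [.inl hw, .inr ⟨w, hw, hv⟩]
    rw [h1]
    refine Matchable.biUnion _ _
      (fun w _ => matchable_of_mem (Finset.mem_filter.1 (hgF w)).2) ?_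
    intro w _ w' _ hne
    have h2 := hT (hgT w) (hgT w') (hg.ne hne)
    have h3 := hR _ (hgT w)
    have h4 := hR _ (hgT w')
    have h5 : (w : V) ≠ w' := fun h => hne (Subtype.ext h)
    have a1 : (w : V) ≠ (g w').1 := fun h => h4.1 (h ▸ w.2)
    have a2 : (w : V) ≠ (g w').2 := fun h => h4.2 (h ▸ w.2)
    have a3 : (w' : V) ≠ (g w).1 := fun h => h3.1 (h ▸ w'.2)
    have a4 : (w' : V) ≠ (g w).2 := fun h => h3.2 (h ▸ w'.2)
    simp only [Function.onFun, Finset.disjoint_insert_left, Finset.disjoint_singleton_left,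
      Finset.mem_insert, Finset.mem_singleton, not_or] at h2 ⊢
    exact ⟨⟨h5, a1, a2⟩, ⟨a3.symm, h2.1⟩, a4.symm, h2.2⟩

lemma sq_le_density_notMem {W S : Finset V} {c : ℝ} (hc : 0 ≤ c) (hS : S.Nonempty)
    (h : c * (S.card : ℝ) ≤ (S \ W).card) : c ^ 2 ≤ density (fun a b => a ∉ W ∧ b ∉ W) S := by
  have hs : (0 : ℝ) < S.card := by exact_mod_cast hS.card_pos
  rw [density, pairCount_notMem, le_div_iff₀ (by positivity), ← mul_pow]
  push_cast
  exact pow_le_pow_left₀ (by positivity) h 2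

/-- 4/9 = (2/3)²: the density of pairs avoiding W is the square of the proportion outside W. -/
lemma three_mul_card_inter_le {W S : Finset V} {c : ℝ} (h0 : 4 / 9 ≤ c)
    (h : c ≤ density (fun a b => a ∉ W ∧ b ∉ W) S) (hS : S.Nonempty) :
    3 * (W ∩ S).card ≤ S.card := by
  have hs : (0 : ℝ) < S.card := by exact_mod_cast hS.card_pos
  rw [density, pairCount_notMem, le_div_iff₀ (by positivity)] at h
  push_cast at h
  have h1 : (2 / 3 * (S.card : ℝ)) ^ 2 ≤ ((S \ W).card : ℝ) ^ 2 := by nlinarith [sq_nonneg (S.card : ℝ)]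
  have h2 := (sq_le_sq₀ (by positivity) (by positivity)).1 h1
  have h3 : (((S \ W).card + (W ∩ S).card : ℕ) : ℝ) = S.card := by
    rw [Finset.inter_comm, Finset.card_sdiff_add_card_inter]
  push_cast at h3
  have h4 : (3 * (W ∩ S).card : ℝ) ≤ S.card := by linarith
  exact_mod_cast h4

variable [Fintype V]

/-- Deleting Z costs each degree at most 2|Z|n ≤ γn²/10, so slack of at least γ/4 ≥ γ₀ remains. The
second family E' allows the matching to be confined to special edges while degrees are still
measured in E. -/
lemma DegreeCond.exists_matching_missing_few {E E' : Finset (Finset V)} {γ γ₀ ε : ℝ}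
    {W : Finset V} (h : DegreeCond E γ W) (hγ : 0 < γ) (hγ1 : γ ≤ 1 / 100) (hγ₀ : 0 < γ₀)
    (hγ₀' : γ₀ ≤ γ / 4) (hε : 0 < ε) (hE' : ∀ e ∈ E', e.card = 3) {Z : Finset V}
    (hZ : (Z.card : ℝ) ≤ γ / 20 * Fintype.card V)
    (hn : 2 * guidedThreshold γ₀ ε ≤ Fintype.card V)
    (hW : ∀ S ⊆ Finset.univ \ Z, Matchable E' ((Finset.univ \ Z) \ S) →
      density (fun a b => a ∉ W ∧ b ∉ W) (Finset.univ \ Z) - γ₀ / 2 ≤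
        density (fun a b => a ∉ W ∧ b ∉ W) S →
      S.Nonempty → 3 * (W ∩ S).card ≤ S.card ∧ ∀ x : (Fin 3 → S) → ℝ,
        IsDecomposition {f : Fin 3 → S | Finset.univ.image (fun i => (f i : V)) ∈ E} x →
        IsDecomposition {f : Fin 3 → S | Finset.univ.image (fun i => (f i : V)) ∈ E'} x) :
    ∃ S ⊆ Finset.univ \ Z, Matchable E' ((Finset.univ \ Z) \ S) ∧
      (S.card : ℝ) ≤ ε * Fintype.card V := by
  set n : ℝ := (Fintype.card V : ℝ) with hndef
  have hn0 : 0 ≤ n := Nat.cast_nonneg _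
  have hV : ((Finset.univ \ Z).card : ℝ) = n - Z.card := by
    rw [Finset.card_sdiff_of_subset (Finset.subset_univ _), Finset.card_univ,
      Nat.cast_sub (Finset.card_le_univ _)]
  have hV1 : ((Finset.univ \ Z).card : ℝ) ≤ n := by
    rw [hV]
    linarith [(Nat.cast_nonneg Z.card : (0 : ℝ) ≤ Z.card)]
  have hsq : ((Finset.univ \ Z).card : ℝ) ^ 2 ≤ n ^ 2 := pow_le_pow_left₀ (by positivity) hV1 2
  have hZn : 2 * (Z.card : ℝ) * n ≤ γ / 10 * n ^ 2 := by nlinarith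
  have hdeg : ∀ v, (pairCount (linkRel E v) Finset.univ : ℝ) - γ / 10 * n ^ 2 ≤
      pairCount (linkRel E v) (Finset.univ \ Z) := fun v => by
    have := pairCount_univ_le (linkRel E v) Z
    linarith
  have hn2 : 0 ≤ n ^ 2 := by positivity
  have hscale : ∀ c : ℝ, 0 ≤ c → (c + γ₀) * ((Finset.univ \ Z).card : ℝ) ^ 2 ≤
      c * n ^ 2 + γ / 4 * n ^ 2 := fun c hc => by
    have h1 : (c + γ₀) * ((Finset.univ \ Z).card : ℝ) ^ 2 ≤ (c + γ₀) * n ^ 2 :=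
      mul_le_mul_of_nonneg_left hsq (by linarith)
    nlinarith
  have hγn : 0 ≤ γ * n ^ 2 := by positivity
  obtain ⟨S, hS, hM, hc⟩ := _root_.exists_matching_missing_few hγ₀ hε hE' (W := W)
    (V₀ := Finset.univ \ Z)
    (by
      rw [hV]
      nlinarith)
    (fun u _ v _ w _ hl => by
      have h1 := h.adj u v w hl
      have h2 := hdeg u
      have h3 := hdeg v
      have h4 := hscale (6 / 5) (by norm_num)
      linarith)
    (fun v _ => by
      have h1 := h.degree_ge v
      have h2 := hdeg v
      have h4 := hscale 0 le_rfl
      linarith)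
    (fun v _ hv => by
      have h1 := not_lt.1 (mt (h.mem_iff v).2 hv)
      have h2 := hdeg v
      have h4 := hscale (3 / 5) (by norm_num)
      linarith)
    hW
  exact ⟨S, hS, hM, hc.le.trans (mul_le_mul_of_nonneg_left hV1 hε.le)⟩

/-- All the requirements on the number of vertices in terms of the other parameters. -/
structure IsLarge (n γ₀ ε μ : ℝ) : Prop where
  log_le : Real.log n ≤ μ / 100 * n
  inv_le : 100 ≤ μ * n
  size_le : 162 * 10 ^ 8 ≤ n
  threshold_le : 2 * guidedThreshold γ₀ ε ≤ n

lemma exists_isLarge (γ₀ ε : ℝ) {μ : ℝ} (hμ : 0 < μ) : ∃ N : ℝ, ∀ n, N ≤ n → IsLarge n γ₀ ε μ := by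
  have h1 : ∀ᶠ n : ℝ in Filter.atTop, Real.log n ≤ μ / 100 * n := by
    have := Real.isLittleO_log_id_atTop.def (c := μ / 100) (by positivity)
    filter_upwards [this, Filter.eventually_ge_atTop 0] with n hn h0
    simp only [id, Real.norm_eq_abs, abs_of_nonneg h0] at hn
    exact (le_abs_self _).trans hn
  have h2 := Filter.eventually_ge_atTop (100 / μ)
  have h3 := Filter.eventually_ge_atTop (162 * 10 ^ 8 : ℝ)
  have h4 := Filter.eventually_ge_atTop (2 * guidedThreshold γ₀ ε)
  obtain ⟨N, hN⟩ := Filter.eventually_atTop.1 (h1.and (h2.and (h3.and h4)))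
  refine ⟨N, fun n hn => ?_⟩
  obtain ⟨a, b, c, d⟩ := hN n hn
  refine ⟨a, ?_, c, d⟩
  rwa [div_le_iff₀' hμ] at b

/-- Two vertices outside W have common link at least (2 · 3/5 - 1)n², and edges outside W are dense
by `pairCount_heavy`, so η = 1/100 works for all three parts equal to the complement of W. -/
lemma DegreeCond.exists_absorber_compl {E : Finset (Finset V)} {γ : ℝ} {W : Finset V}
    (h : DegreeCond E γ W) (hγ : 0 < γ) (hn : 162 * 10 ^ 8 ≤ (Fintype.card V : ℝ))
    (m : ℕ) (hm : 324 * 10 ^ 8 * (m : ℝ) ≤ Fintype.card V) :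
    ∃ A : Finset V, Matchable E A ∧ A.card ≤ 9 * m ∧ ∀ 𝒰 : Finset (Fin 3 → V),
      (𝒰.card : ℝ) ≤ (m : ℝ) / (8 * 10 ^ 8) - 3 * Real.log (Fintype.card V) →
      (∀ u ∈ 𝒰, Function.Injective u ∧ ∀ i, u i ∉ W ∧ u i ∉ A) →
      (𝒰 : Set (Fin 3 → V)).PairwiseDisjoint (fun u => Finset.univ.image u) →
      Matchable E (A ∪ 𝒰.biUnion fun u => Finset.univ.image u) := by
  set n : ℝ := (Fintype.card V : ℝ) with hndef
  have hW : (3 * W.card : ℝ) ≤ n := by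
    rw [hndef]
    exact_mod_cast h.card_le
  have hU : ((Finset.univ \ W).card : ℝ) = n - W.card := by
    rw [Finset.card_sdiff_of_subset (Finset.subset_univ _), Finset.card_univ,
      Nat.cast_sub (Finset.card_le_univ _)]
  obtain ⟨A, hA, hAc, hab⟩ := exists_absorber (E := E) (P := fun _ => Finset.univ \ W)
    (η := 1 / 100) (by norm_num)
    (by
      refine le_trans ?_ (card_triples_ge E (fun _ => Finset.univ \ W) (c := 1 / 25 * n ^ 2) ?_)
      · rw [hU, ← hndef]
        have : 2 / 3 * n ≤ n - W.card := by linarith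
        have h2 : 2 / 3 * n * (1 / 25 * n ^ 2) ≤ (n - W.card) * (1 / 25 * n ^ 2) :=
          mul_le_mul_of_nonneg_right this (by positivity)
        have h3 : 0 ≤ n ^ 3 := by positivity
        linarith [h2, h3, show 2 / 3 * n * (1 / 25 * n ^ 2) = 2 / 75 * n ^ 3 by ring]
      · intro x hx
        rw [← pairCount_link]
        exact h.pairCount_heavy hγ (Finset.mem_sdiff.1 hx).2)
    (fun _ x hx y hy => by
      have h1 := card_add_card_le_commonLink E x y Finset.univ Finset.univ
        (Finset.subset_univ _) (Finset.subset_univ _)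
      have h2 := not_lt.1 (mt (h.mem_iff x).2 (Finset.mem_sdiff.1 hx).2)
      have h3 := not_lt.1 (mt (h.mem_iff y).2 (Finset.mem_sdiff.1 hy).2)
      rw [Finset.card_univ, Fintype.card_prod, ← pow_two] at h1
      have h4 : ((Finset.univ ×ˢ Finset.univ).filter fun p : V × V =>
          {x, p.1, p.2} ∈ E ∧ {y, p.1, p.2} ∈ E).card = (commonLink E x y).card := by
        congr 1
      rw [h4] at h1
      have h5 : (pairCount (linkRel E x) Finset.univ : ℝ) +
          pairCount (linkRel E y) Finset.univ ≤ n ^ 2 + (commonLink E x y).card := by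
        rw [hndef]
        exact_mod_cast h1
      have h6 : 0 ≤ γ * n ^ 2 := by positivity
      have h7 : 0 ≤ n ^ 2 := by positivity
      linarith)
    (by rw [← hndef]; norm_num; linarith) m (by rw [← hndef]; norm_num; linarith)
  refine ⟨A, hA, hAc, fun 𝒰 h1 h2 h3 => hab 𝒰 ?_ (fun u hu => ⟨(h2 u hu).1, fun i => ⟨?_, ?_⟩⟩) h3⟩
  · refine h1.trans (le_of_eq ?_)
    norm_num
    ring
  · exact Finset.mem_sdiff.2 ⟨Finset.mem_univ _, ((h2 u hu).2 i).1⟩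
  · exact ((h2 u hu).2 i).2

end LightCase

/-- The absorber only accepts triples outside W, so the leftover vertices of W are first matched
into the reserve; the unused reserve joins what is absorbed. -/
theorem DegreeCond.matchable_of_card_le {γ : ℝ} (hγ : 0 < γ) (hγ1 : γ ≤ 1 / 100) :
    ∃ N : ℝ, ∀ {V : Type*} [Fintype V] [DecidableEq V] {E : Finset (Finset V)} {W : Finset V},
      DegreeCond E γ W → N ≤ Fintype.card V → 3 ∣ Fintype.card V →
      (W.card : ℝ) ≤ (1 / 3 - γ / 100) * Fintype.card V → Matchable E Finset.univ := by
  -- Hierarchy: the leftover (μ₂/40)n is small against the reserve of μ₂n pairs, and both are small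
  -- against the capacity m₁/(8 · 10⁸) of an absorber built from μ₁n gadgets.
  obtain ⟨μ₁, hμ₁⟩ : ∃ μ₁, μ₁ = γ / 10 ^ 11 := ⟨_, rfl⟩
  obtain ⟨μ₂, hμ₂⟩ : ∃ μ₂, μ₂ = μ₁ / 10 ^ 10 := ⟨_, rfl⟩
  have hμ₁0 : 0 < μ₁ := by rw [hμ₁]; positivity
  have hμ₂0 : 0 < μ₂ := by rw [hμ₂]; positivity
  obtain ⟨N, hN⟩ := exists_isLarge (γ / 200) (μ₂ / 40) hμ₂0
  refine ⟨N, fun {V _ _ E W} h hNV h3 hWc => ?_⟩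
  obtain ⟨hlog, hinv, hsize, hthr⟩ := hN _ hNV
  set n : ℝ := (Fintype.card V : ℝ) with hndef
  have hn0 : 0 < n := by linarith
  have hVpos : 0 < Fintype.card V := by
    rw [hndef] at hn0
    exact_mod_cast hn0
  obtain ⟨m₁, hm₁⟩ : ∃ m₁, m₁ = ⌊μ₁ * n⌋₊ := ⟨_, rfl⟩
  obtain ⟨m₂, hm₂⟩ : ∃ m₂, m₂ = ⌊μ₂ * n⌋₊ := ⟨_, rfl⟩
  have hm₁a : (m₁ : ℝ) ≤ μ₁ * n := by rw [hm₁]; exact Nat.floor_le (by positivity)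
  have hm₁b : μ₁ * n - 1 ≤ m₁ := by rw [hm₁]; exact (Nat.sub_one_lt_floor _).le
  have hm₂a : (m₂ : ℝ) ≤ μ₂ * n := by rw [hm₂]; exact Nat.floor_le (by positivity)
  have hm₂b : μ₂ * n - 1 ≤ m₂ := by rw [hm₂]; exact (Nat.sub_one_lt_floor _).le
  have hγn : γ * n ≤ n / 100 := by nlinarith
  have hγsq : 4 / 9 + γ / 200 / 2 ≤ (2 / 3 + γ / 200) ^ 2 := by nlinarith
  have e₁ : μ₁ * n = γ * n / 10 ^ 11 := by rw [hμ₁]; ring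
  have e₂ : μ₂ * n = μ₁ * n / 10 ^ 10 := by rw [hμ₂]; ring
  have hγn0 : 0 < γ * n := by positivity
  obtain ⟨A, hA, hAc, hab⟩ := h.exists_absorber_compl hγ hsize m₁ (by linarith)
  have hAc' : (A.card : ℝ) ≤ 9 * m₁ := by exact_mod_cast hAc
  obtain ⟨T, hTc, hTd, hTp, hTw⟩ := exists_reserve h hγ hVpos A m₂ (by linarith)
  set Q : Finset V := T.biUnion fun p => {p.1, p.2} with hQ
  have hQc : Q.card ≤ 2 * m₂ := by
    calc Q.card ≤ T.card * 2 := Finset.card_biUnion_le_card_mul _ _ _ fun p _ => Finset.card_le_two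
      _ ≤ 2 * m₂ := by omega
  have hQc' : (Q.card : ℝ) ≤ 2 * m₂ := by exact_mod_cast hQc
  have hQmem : ∀ v ∈ Q, v ∉ W ∧ v ∉ A := by
    intro v hv
    obtain ⟨p, hp, hv⟩ := Finset.mem_biUnion.1 hv
    obtain ⟨-, a, b, c, d⟩ := hTp p hp
    rcases Finset.mem_insert.1 hv with rfl | hv
    · exact ⟨a, c⟩
    · rw [Finset.mem_singleton.1 hv]
      exact ⟨b, d⟩
  have hZc : ((A ∪ Q).card : ℝ) ≤ 9 * m₁ + 2 * m₂ := by
    have : ((A ∪ Q).card : ℝ) ≤ A.card + Q.card := by exact_mod_cast Finset.card_union_le _ _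
    linarith
  have hZc' : ((A ∪ Q).card : ℝ) ≤ γ / 200 * n := by linarith
  have hV₀c : ((Finset.univ \ (A ∪ Q)).card : ℝ) = n - (A ∪ Q).card := by
    rw [Finset.card_sdiff_of_subset (Finset.subset_univ _), Finset.card_univ,
      Nat.cast_sub (Finset.card_le_univ _)]
  -- The gap γ/100 in |W| leaves at least 2/3 + γ/200 of the vertices outside `W`; squared, this
  -- tolerates the density loss γ/400 and stays above 4/9.
  have hdens : 4 / 9 ≤ density (fun a b => a ∉ W ∧ b ∉ W) (Finset.univ \ (A ∪ Q)) -
      γ / 200 / 2 := by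
    have hpos : (0 : ℝ) < (Finset.univ \ (A ∪ Q)).card := by rw [hV₀c]; linarith
    have h1 : (2 / 3 + γ / 200) * ((Finset.univ \ (A ∪ Q)).card : ℝ) ≤
        ((Finset.univ \ (A ∪ Q)) \ W).card := by
      have h2 : (Finset.univ \ (A ∪ Q)).card ≤ ((Finset.univ \ (A ∪ Q)) \ W).card + W.card :=
        Finset.card_le_card_sdiff_add_card
      have h3 : ((Finset.univ \ (A ∪ Q)).card : ℝ) ≤
        ((Finset.univ \ (A ∪ Q)) \ W).card + W.card := by exact_mod_cast h2
      rw [hV₀c] at h3 ⊢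
      have h4 : 0 ≤ γ * ((A ∪ Q).card : ℝ) := by positivity
      linarith
    have h2 := sq_le_density_notMem (by positivity) (Finset.card_pos.1 (by exact_mod_cast hpos)) h1
    linarith
  obtain ⟨S, hS, hM, hSc⟩ := h.exists_matching_missing_few hγ hγ1 (γ₀ := γ / 200) (E' := E)
    (by positivity) (by linarith) (ε := μ₂ / 40) (by positivity) h.uniform (Z := A ∪ Q)
    (by linarith) hthr
    (fun S _ _ hd hne => ⟨three_mul_card_inter_le hdens hd hne, fun x hx => hx⟩)
  have hSmem : ∀ v ∈ S, v ∉ A ∧ v ∉ Q := fun v hv => by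
    have := (Finset.mem_sdiff.1 (hS hv)).2
    rwa [Finset.mem_union, not_or] at this
  obtain ⟨Q', hQ', hMQ⟩ := exists_matchable_union_pairs (E := E) (T := T) hTd (R := W ∩ S)
    (fun p hp => ⟨fun hc => (hTp p hp).2.1 (Finset.mem_inter.1 hc).1,
      fun hc => (hTp p hp).2.2.1 (Finset.mem_inter.1 hc).1⟩)
    (fun w hw => by
      have h1 := hTw w (Finset.mem_inter.1 hw).1
      have h2 : ((W ∩ S).card : ℝ) ≤ S.card := by
        exact_mod_cast Finset.card_le_card Finset.inter_subset_right
      have h4 : ((W ∩ S).card : ℝ) ≤ (T.filter fun p => {w, p.1, p.2} ∈ E).card := by linarith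
      exact_mod_cast h4)
  have hd1 : Disjoint ((Finset.univ \ (A ∪ Q)) \ S) ((W ∩ S) ∪ Q') := by
    rw [Finset.disjoint_left]
    intro v hv hv'
    simp only [Finset.mem_sdiff, Finset.mem_union, Finset.mem_univ, true_and, not_or] at hv
    rcases Finset.mem_union.1 hv' with hv' | hv'
    · exact hv.2 (Finset.mem_inter.1 hv').2
    · exact hv.1.2 (hQ' hv')
  set Y : Finset V := ((Finset.univ \ (A ∪ Q)) \ S) ∪ ((W ∩ S) ∪ Q') with hY
  have hMY : Matchable E Y := hM.union hMQ hd1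
  have hd2 : Disjoint A Y := by
    rw [Finset.disjoint_left]
    intro v hv hv'
    simp only [hY, Finset.mem_union, Finset.mem_sdiff, Finset.mem_inter, Finset.mem_univ,
      true_and, not_or] at hv'
    rcases hv' with hv' | hv' | hv'
    exacts [hv'.1.1 hv, (hSmem v hv'.2).1 hv, (hQmem v (hQ' hv')).2 hv]
  have hAY := (hA.union hMY hd2).three_dvd_card h.uniform
  have hR3 : 3 ∣ (Finset.univ \ (A ∪ Y)).card := by
    rw [Finset.card_sdiff_of_subset (Finset.subset_univ _), Finset.card_univ]
    exact Nat.dvd_sub h3 hAY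
  have hRsub : Finset.univ \ (A ∪ Y) ⊆ S ∪ Q := by
    intro v hv
    simp only [hY, Finset.mem_union, Finset.mem_sdiff, Finset.mem_inter, Finset.mem_univ,
      true_and, not_or] at hv ⊢
    tauto
  have hRW : ∀ v ∈ Finset.univ \ (A ∪ Y), v ∉ W := by
    intro v hv hvW
    have h1 := Finset.mem_union.1 (hRsub hv)
    simp only [hY, Finset.mem_union, Finset.mem_sdiff, Finset.mem_inter, Finset.mem_univ,
      true_and, not_or] at hv
    rcases h1 with h1 | h1
    · exact hv.2.2.1 ⟨hvW, h1⟩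
    · exact (hQmem v h1).1 hvW
  have hRc : ((Finset.univ \ (A ∪ Y)).card : ℝ) ≤ S.card + Q.card := by
    exact_mod_cast (Finset.card_le_card hRsub).trans (Finset.card_union_le _ _)
  obtain ⟨𝒰, hUc, hU, hUd, hUR⟩ := exists_triples_of_dvd hR3
  have hUc' : (3 * 𝒰.card : ℝ) ≤ (Finset.univ \ (A ∪ Y)).card := by exact_mod_cast hUc
  have hfin := hab 𝒰 (by linarith)
    (fun u hu => ⟨(hU u hu).1, fun i => ⟨hRW _ ((hU u hu).2 i), fun hA' =>
      (Finset.mem_sdiff.1 ((hU u hu).2 i)).2 (Finset.mem_union_left _ hA')⟩⟩) hUd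
  rw [hUR] at hfin
  have hfinal := hfin.union hMY (by
    rw [Finset.disjoint_union_left]
    refine ⟨hd2, ?_⟩
    exact Finset.disjoint_of_subset_right Finset.subset_union_right Finset.sdiff_disjoint)
  convert hfinal using 1
  ext v
  simp only [Finset.mem_univ, Finset.mem_union, Finset.mem_sdiff, true_and, true_iff]
  tauto

/-! ### Ingredients when W is almost a third -/

section TightCase

variable {V : Type*} [DecidableEq V]

/-- The edges inside `T` that meet `W` in exactly one vertex. -/
def transversal (E : Finset (Finset V)) (W T : Finset V) : Finset (Finset V) :=
  E.filter fun e => e ⊆ T ∧ (W ∩ e).card = 1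

lemma transversal_subset (E : Finset (Finset V)) (W T : Finset V) : transversal E W T ⊆ E :=
  Finset.filter_subset _ _

/-- In a balanced set the average of |W ∩ e| over the fractional matching is 1, and no edge exceeds
1, so every edge in its support attains 1. -/
lemma IsDecomposition.card_inter_image_eq_one {E : Finset (Finset V)} {W S : Finset V}
    (hE : ∀ e ∈ E, e.card = 3) (hW : ∀ e ∈ E, (W ∩ e).card ≤ 1) (hS : S.Nonempty)
    (h : 3 * (W ∩ S).card = S.card) {x : (Fin 3 → S) → ℝ}
    (hx : IsDecomposition {f : Fin 3 → S | Finset.univ.image (fun i => (f i : V)) ∈ E} x)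
    {f : Fin 3 → S} (hf : x f ≠ 0) :
    (W ∩ Finset.univ.image fun i => (f i : V)).card = 1 := by
  have hs : (0 : ℝ) < S.card := by exact_mod_cast hS.card_pos
  have hm := hx.marginal fun v => if (v : V) ∈ W then 1 else 0
  have h1 : ∑ v : S, (if (v : V) ∈ W then (1 : ℝ) else 0) = (W ∩ S).card := by
    rw [Finset.sum_coe_sort S fun v => if v ∈ W then (1 : ℝ) else 0, Finset.sum_boole,
      Finset.filter_mem_eq_inter, Finset.inter_comm]
  have h2 : (3 * (W ∩ S).card : ℝ) = S.card := by exact_mod_cast h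
  have h3 : (3 : ℝ) / Fintype.card S * ∑ v : S, (if (v : V) ∈ W then (1 : ℝ) else 0) = 1 := by
    rw [h1, Fintype.card_coe, div_mul_eq_mul_div, h2, div_self hs.ne']
  replace hm := hm.trans (h3.trans hx.sum_eq_one.symm)
  have hcount : ∀ f : Fin 3 → S, x f ≠ 0 → ∑ i, (if (f i : V) ∈ W then (1 : ℝ) else 0) =
      (W ∩ Finset.univ.image fun i => (f i : V)).card := by
    intro f hf
    have hfE := hE _ (hx.mem f hf)
    have hinj : Set.InjOn (fun i => (f i : V)) (Finset.univ : Finset (Fin 3)) := by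
      rw [← Finset.card_image_iff, hfE]
      simp
    rw [Finset.inter_comm, ← Finset.filter_mem_eq_inter, Finset.card_filter,
      Finset.sum_image hinj]
    push_cast
    rfl
  have hle : ∀ f ∈ (Finset.univ : Finset (Fin 3 → S)),
      x f * ∑ i, (if (f i : V) ∈ W then (1 : ℝ) else 0) ≤ x f := by
    intro f _
    rcases eq_or_ne (x f) 0 with h0 | h0
    · simp [h0]
    · rw [hcount f h0]
      refine mul_le_of_le_one_right (hx.nonneg f) ?_
      exact_mod_cast hW _ (hx.mem f h0)
  have h4 := (Finset.sum_eq_sum_iff_of_le hle).1 hm f (Finset.mem_univ _)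
  rw [hcount f hf, mul_eq_left₀ hf] at h4
  exact_mod_cast h4

variable [Fintype V] {E : Finset (Finset V)} {γ : ℝ} {W : Finset V}

namespace DegreeCond

lemma mem_transversal (h : DegreeCond E γ W) {T e : Finset V} (he : e ∈ E) (heT : e ⊆ T) {v : V}
    (hv : v ∈ W) (hve : v ∈ e) : e ∈ transversal E W T := by
  refine Finset.mem_filter.2 ⟨he, heT, le_antisymm (h.inter_edge_card_le he) ?_⟩
  exact Finset.card_pos.2 ⟨v, Finset.mem_inter.2 ⟨hv, hve⟩⟩

/-- Greedy: a heavy vertex has n²/25 link pairs outside W, and at most n/100 used vertices destroy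
at most n²/50 of them. -/
lemma exists_matchable_compl (h : DegreeCond E γ W) (hγ : 0 < γ) (t : ℕ)
    (ht : 300 * t ≤ Fintype.card V) : ∃ Z : Finset V, Matchable E Z ∧ Z.card = 3 * t ∧
      Disjoint Z W := by
  induction t with
  | zero => exact ⟨∅, matchable_empty E, by simp, by simp⟩
  | succ t ih =>
    obtain ⟨Z, hZ, hZc, hZW⟩ := ih (by omega)
    have hZU : Z ⊆ Finset.univ \ W := fun v hv =>
      Finset.mem_sdiff.2 ⟨Finset.mem_univ _, Finset.disjoint_left.1 hZW hv⟩
    have hUc : (Finset.univ \ W).card = Fintype.card V - W.card := by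
      rw [Finset.card_sdiff_of_subset (Finset.subset_univ _), Finset.card_univ]
    have hWc := h.card_le
    obtain ⟨u, hu, huZ⟩ : ∃ u ∈ Finset.univ \ W, u ∉ Z :=
      Finset.exists_mem_notMem_of_card_lt_card (by omega)
    have h1 := h.pairCount_heavy hγ (Finset.mem_sdiff.1 hu).2
    have h2 := pairCount_le_sdiff_add (linkRel E u) hZU
    have h3 : ∑ a ∈ Z, incidence (linkRel E u) (Finset.univ \ W) a ≤
        Z.card * (2 * Fintype.card V) := by
      rw [← smul_eq_mul]
      refine Finset.sum_le_card_nsmul _ _ _ fun a _ => (incidence_le _ _ _).trans ?_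
      exact Nat.mul_le_mul_left 2 (Finset.card_le_univ _)
    have hn0 : (0 : ℝ) < Fintype.card V := by exact_mod_cast (by omega : 0 < Fintype.card V)
    have h4 : 0 < pairCount (linkRel E u) ((Finset.univ \ W) \ Z) := by
      by_contra hcon
      have h5 : (pairCount (linkRel E u) (Finset.univ \ W) : ℝ) ≤
          Z.card * (2 * Fintype.card V) := by
        exact_mod_cast (by omega :
          pairCount (linkRel E u) (Finset.univ \ W) ≤ Z.card * (2 * Fintype.card V))
      have h6 : (100 * Z.card : ℝ) ≤ Fintype.card V := by
        exact_mod_cast (by omega : 100 * Z.card ≤ Fintype.card V)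
      nlinarith [mul_pos hn0 hn0]
    rw [pairCount_link, Finset.card_pos] at h4
    obtain ⟨⟨a, b⟩, hab⟩ := h4
    obtain ⟨hab, he⟩ := Finset.mem_filter.1 hab
    obtain ⟨ha, hb⟩ := Finset.mem_product.1 hab
    obtain ⟨ha, haZ⟩ := Finset.mem_sdiff.1 ha
    obtain ⟨hb, hbZ⟩ := Finset.mem_sdiff.1 hb
    have hd : Disjoint Z {u, a, b} := by
      simp only [Finset.disjoint_insert_right, Finset.disjoint_singleton_right]
      exact ⟨huZ, haZ, hbZ⟩
    refine ⟨Z ∪ {u, a, b}, hZ.union (matchable_of_mem he) hd, ?_, ?_⟩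
    · rw [Finset.card_union_of_disjoint hd, h.uniform _ he, hZc]
      ring
    · rw [Finset.disjoint_union_left]
      simp only [Finset.disjoint_insert_left, Finset.disjoint_singleton_left]
      exact ⟨hZW, (Finset.mem_sdiff.1 hu).2, (Finset.mem_sdiff.1 ha).2, (Finset.mem_sdiff.1 hb).2⟩

lemma card_compl (W : Finset V) : ((Finset.univ \ W).card : ℝ) = Fintype.card V - W.card := by
  rw [Finset.card_sdiff_of_subset (Finset.subset_univ _), Finset.card_univ,
    Nat.cast_sub (Finset.card_le_univ _)]

lemma pairCount_le_of_mem (h : DegreeCond E γ W) {w : V} (hw : w ∈ W) :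
    (pairCount (linkRel E w) Finset.univ : ℝ) ≤ ((Fintype.card V : ℝ) - W.card) ^ 2 := by
  rw [pairCount_link, ← card_compl]
  have : ((Finset.univ ×ˢ Finset.univ).filter fun p : V × V => {w, p.1, p.2} ∈ E) ⊆
      (Finset.univ \ W) ×ˢ (Finset.univ \ W) := by
    intro p hp
    obtain ⟨h1, h2⟩ := h.pair_mem_compl hw (Finset.mem_filter.1 hp).2
    simp [h1, h2]
  have h1 := Finset.card_le_card this
  rw [Finset.card_product, ← pow_two] at h1
  exact_mod_cast h1

lemma pairCount_le_sq_sub_sq (h : DegreeCond E γ W) (v : V) :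
    (pairCount (linkRel E v) Finset.univ : ℝ) ≤ (Fintype.card V : ℝ) ^ 2 - (W.card : ℝ) ^ 2 := by
  rw [pairCount_link]
  have : ((Finset.univ ×ˢ Finset.univ).filter fun p : V × V => {v, p.1, p.2} ∈ E) ⊆
      Finset.univ \ (W ×ˢ W) := by
    intro p hp
    refine Finset.mem_sdiff.2 ⟨Finset.mem_univ _, fun hW => ?_⟩
    obtain ⟨h1, h2⟩ := Finset.mem_product.1 hW
    have h3 : linkRel E v p.1 p.2 := (Finset.mem_filter.1 hp).2
    exact h.notMem_of_mem (linkRel_swap' (linkRel_swap h3)) h1 h2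
  have h1 := Finset.card_le_card this
  rw [← Nat.cast_le (α := ℝ), card_compl, Finset.card_product, Fintype.card_prod] at h1
  push_cast at h1
  linarith

/-- No link contains a pair from W × W, so a neighbour has degree at most n² - |W|²; this improves
on `degree_ge`. -/
lemma degree_ge_of_mem (h : DegreeCond E γ W) (hγ : 0 < γ) (w : V) :
    1 / 5 * (Fintype.card V : ℝ) ^ 2 + (W.card : ℝ) ^ 2 ≤
      pairCount (linkRel E w) Finset.univ := by
  obtain ⟨a, b, hab⟩ := h.exists_link w
  have h1 := h.adj _ _ _ hab
  have h2 := h.pairCount_le_sq_sub_sq a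
  have h3 : 0 ≤ γ * (Fintype.card V : ℝ) ^ 2 := by positivity
  linarith

/-- A degree above 3n²/5 cannot fit into pairs outside W, so u has a neighbour in W, whose degree is
at most (n - |W|)². -/
lemma degree_ge_of_notMem (h : DegreeCond E γ W) (hγ : 0 < γ)
    (hW : ((Fintype.card V : ℝ) - W.card) ^ 2 ≤ 9 / 20 * (Fintype.card V : ℝ) ^ 2)
    (hn : 0 < (Fintype.card V : ℝ)) {u : V} (hu : u ∉ W) :
    6 / 5 * (Fintype.card V : ℝ) ^ 2 - ((Fintype.card V : ℝ) - W.card) ^ 2 ≤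
      pairCount (linkRel E u) Finset.univ := by
  have h1 := not_lt.1 (mt (h.mem_iff u).2 hu)
  have h3 : 0 < (Fintype.card V : ℝ) ^ 2 := by positivity
  have h4 : 0 < γ * (Fintype.card V : ℝ) ^ 2 := by positivity
  obtain ⟨w, b, hw, hl⟩ : ∃ w b, w ∈ W ∧ linkRel E u w b := by
    by_contra hcon
    push Not at hcon
    have h2 : ((Finset.univ ×ˢ Finset.univ).filter fun p : V × V => {u, p.1, p.2} ∈ E) ⊆
        (Finset.univ \ W) ×ˢ (Finset.univ \ W) := by
      intro p hp
      have hl : linkRel E u p.1 p.2 := (Finset.mem_filter.1 hp).2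
      simp only [Finset.mem_product, Finset.mem_sdiff, Finset.mem_univ, true_and]
      exact ⟨fun h => hcon _ _ h hl, fun h => hcon _ _ h (linkRel_swap' hl)⟩
    have h5 := Finset.card_le_card h2
    rw [← pairCount_link, Finset.card_product, ← pow_two, ← Nat.cast_le (α := ℝ)] at h5
    push_cast at h5
    rw [card_compl] at h5
    linarith
  have h5 := h.adj _ _ _ hl
  have h6 := h.pairCount_le_of_mem hw
  linarith

lemma transversal_degree_of_mem (h : DegreeCond E γ W) {Z : Finset V} (hZ : Disjoint Z W)
    {w : V} (hw : w ∈ W) :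
    (pairCount (linkRel E w) Finset.univ : ℝ) ≤
      pairCount (linkRel (transversal E W (Finset.univ \ Z)) w) Finset.univ +
        2 * Z.card * Fintype.card V := by
  have h1 := pairCount_univ_le (linkRel E w) Z
  have h2 : pairCount (linkRel E w) (Finset.univ \ Z) ≤
      pairCount (linkRel (transversal E W (Finset.univ \ Z)) w) Finset.univ := by
    rw [pairCount_link, pairCount_link]
    refine Finset.card_le_card fun p hp => ?_
    obtain ⟨hp1, hp2⟩ := Finset.mem_filter.1 hp
    obtain ⟨h3, h4⟩ := Finset.mem_product.1 hp1
    refine Finset.mem_filter.2 ⟨by simp, h.mem_transversal hp2 ?_ hw (by simp)⟩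
    intro v hv
    simp only [Finset.mem_insert, Finset.mem_singleton] at hv
    rcases hv with rfl | rfl | rfl
    · exact Finset.mem_sdiff.2 ⟨Finset.mem_univ _, fun h => Finset.disjoint_left.1 hZ h hw⟩
    · exact h3
    · exact h4
  have h3 : (pairCount (linkRel E w) (Finset.univ \ Z) : ℝ) ≤
      pairCount (linkRel (transversal E W (Finset.univ \ Z)) w) Finset.univ := by
    exact_mod_cast h2
  linarith

lemma transversal_degree_of_notMem (h : DegreeCond E γ W) {Z : Finset V} {u : V} (hu : u ∉ Z) :
    (pairCount (linkRel E u) Finset.univ : ℝ) ≤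
      pairCount (linkRel (transversal E W (Finset.univ \ Z)) u) Finset.univ +
        2 * Z.card * Fintype.card V + ((Fintype.card V : ℝ) - W.card) ^ 2 := by
  have h1 := pairCount_univ_le (linkRel E u) Z
  have h2 : pairCount (linkRel E u) (Finset.univ \ Z) ≤
      pairCount (linkRel (transversal E W (Finset.univ \ Z)) u) Finset.univ +
        (Finset.univ \ W).card ^ 2 := by
    rw [pairCount_link, pairCount_link, pow_two, ← Finset.card_product]
    refine (Finset.card_le_card fun p hp => ?_).trans (Finset.card_union_le _ _)
    obtain ⟨hp1, hp2⟩ := Finset.mem_filter.1 hp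
    obtain ⟨h3, h4⟩ := Finset.mem_product.1 hp1
    have hsub : {u, p.1, p.2} ⊆ Finset.univ \ Z := by
      intro v hv
      simp only [Finset.mem_insert, Finset.mem_singleton] at hv
      rcases hv with rfl | rfl | rfl
      · exact Finset.mem_sdiff.2 ⟨Finset.mem_univ _, hu⟩
      · exact h3
      · exact h4
    by_cases ha : p.1 ∈ W
    · exact Finset.mem_union_left _ (Finset.mem_filter.2
        ⟨by simp, h.mem_transversal hp2 hsub ha (by simp)⟩)
    by_cases hb : p.2 ∈ W
    · exact Finset.mem_union_left _ (Finset.mem_filter.2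
        ⟨by simp, h.mem_transversal hp2 hsub hb (by simp)⟩)
    · exact Finset.mem_union_right _ (by simp [ha, hb])
  have h3 : (pairCount (linkRel E u) (Finset.univ \ Z) : ℝ) ≤
      pairCount (linkRel (transversal E W (Finset.univ \ Z)) u) Finset.univ +
        ((Finset.univ \ W).card : ℝ) ^ 2 := by
    exact_mod_cast h2
  rw [card_compl] at h3
  linarith

lemma transversal_link_subset (h : DegreeCond E γ W) (T : Finset V) {u : V} (hu : u ∉ W) :
    ((Finset.univ ×ˢ Finset.univ).filter fun p : V × V => {u, p.1, p.2} ∈ transversal E W T) ⊆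
      (W ×ˢ (Finset.univ \ W)) ∪ ((Finset.univ \ W) ×ˢ W) := by
  intro p hp
  obtain ⟨hE, hT, hc⟩ := Finset.mem_filter.1 (Finset.mem_filter.1 hp).2
  obtain ⟨v, hv⟩ := Finset.card_pos.1 (by omega : 0 < (W ∩ {u, p.1, p.2}).card)
  obtain ⟨hvW, hv⟩ := Finset.mem_inter.1 hv
  have hl : linkRel E u p.1 p.2 := hE
  have hl1 := linkRel_swap' (linkRel_swap hl)
  simp only [Finset.mem_insert, Finset.mem_singleton] at hv
  simp only [Finset.mem_union, Finset.mem_product, Finset.mem_sdiff, Finset.mem_univ, true_and]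
  rcases hv with rfl | rfl | rfl
  · exact absurd hvW hu
  · exact .inl ⟨hvW, h.notMem_of_mem hl1 hvW⟩
  · exact .inr ⟨h.notMem_of_mem (linkRel_swap hl1) hvW, hvW⟩

lemma transversal_link_subset_of_mem (h : DegreeCond E γ W) (T : Finset V) {w : V} (hw : w ∈ W) :
    ((Finset.univ ×ˢ Finset.univ).filter fun p : V × V => {w, p.1, p.2} ∈ transversal E W T) ⊆
      ((Finset.univ \ W) ∩ T) ×ˢ ((Finset.univ \ W) ∩ T) := by
  intro p hp
  obtain ⟨hE, hT, hc⟩ := Finset.mem_filter.1 (Finset.mem_filter.1 hp).2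
  obtain ⟨h1, h2⟩ := h.pair_mem_compl hw hE
  have h3 : p.1 ∈ T := hT (by simp)
  have h4 : p.2 ∈ T := hT (by simp)
  simp [h1, h2, h3, h4]

/-- For |W| near n/3 every vertex outside Z keeps about (6/5 - 8/9)n² = 14n²/45 or more transversal
link pairs. Links on the same side lie in a common container of about 4n²/9 pairs, hence overlap;
here 3/10 + 3/10 > 9/20. -/
lemma exists_absorber_transversal (h : DegreeCond E γ W) (hγ : 0 < γ)
    (hn : 162 * 10 ^ 8 ≤ (Fintype.card V : ℝ))
    (hW : 333 / 1000 * (Fintype.card V : ℝ) ≤ W.card) {Z : Finset V} (hZ : Disjoint Z W)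
    (hZc : (Z.card : ℝ) ≤ 1 / 2000 * Fintype.card V)
    (m : ℕ) (hm : 324 * 10 ^ 8 * (m : ℝ) ≤ Fintype.card V) :
    ∃ A : Finset V, Matchable (transversal E W (Finset.univ \ Z)) A ∧ A.card ≤ 9 * m ∧
      ∀ 𝒰 : Finset (Fin 3 → V),
      (𝒰.card : ℝ) ≤ (m : ℝ) / (8 * 10 ^ 8) - 3 * Real.log (Fintype.card V) →
      (∀ u ∈ 𝒰, Function.Injective u ∧
        ∀ i, u i ∈ ![W, (Finset.univ \ W) ∩ (Finset.univ \ Z),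
          (Finset.univ \ W) ∩ (Finset.univ \ Z)] i ∧ u i ∉ A) →
      (𝒰 : Set (Fin 3 → V)).PairwiseDisjoint (fun u => Finset.univ.image u) →
      Matchable (transversal E W (Finset.univ \ Z))
        (A ∪ 𝒰.biUnion fun u => Finset.univ.image u) := by
  set n : ℝ := (Fintype.card V : ℝ) with hndef
  set E' := transversal E W (Finset.univ \ Z) with hE'
  have hn0 : 0 < n := by linarith
  have hW3 : (3 * W.card : ℝ) ≤ n := by
    rw [hndef]
    exact_mod_cast h.card_le
  have hn2 : 0 < n ^ 2 := by positivity
  have hUsq : (n - W.card) ^ 2 ≤ 89 / 200 * n ^ 2 := by nlinarith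
  have hWsq : 11 / 100 * n ^ 2 ≤ (W.card : ℝ) ^ 2 := by nlinarith
  have hWU : (W.card : ℝ) * (n - W.card) ≤ 9 / 40 * n ^ 2 := by nlinarith
  have hZn : 2 * (Z.card : ℝ) * n ≤ 1 / 1000 * n ^ 2 := by nlinarith
  have hw : ∀ w ∈ W, 3 / 10 * n ^ 2 ≤ pairCount (linkRel E' w) Finset.univ := fun w hw => by
    have h1 := h.degree_ge_of_mem hγ w
    have h2 := h.transversal_degree_of_mem hZ hw
    linarith
  have hu : ∀ u, u ∉ W → u ∉ Z → 3 / 10 * n ^ 2 ≤ pairCount (linkRel E' u) Finset.univ :=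
    fun u hu huZ => by
    have h1 := h.degree_ge_of_notMem hγ (by linarith) hn0 hu
    have h2 := h.transversal_degree_of_notMem huZ
    linarith
  have hcommon : ∀ x y (Ω : Finset (V × V)), (Ω.card : ℝ) ≤ 9 / 20 * n ^ 2 →
      ((Finset.univ ×ˢ Finset.univ).filter fun p : V × V => {x, p.1, p.2} ∈ E') ⊆ Ω →
      ((Finset.univ ×ˢ Finset.univ).filter fun p : V × V => {y, p.1, p.2} ∈ E') ⊆ Ω →
      3 / 10 * n ^ 2 ≤ pairCount (linkRel E' x) Finset.univ →
      3 / 10 * n ^ 2 ≤ pairCount (linkRel E' y) Finset.univ →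
      1 / 100 * n ^ 2 ≤ (commonLink E' x y).card := by
    intro x y Ω hΩ hx hy hx' hy'
    have h1 := card_add_card_le_commonLink E' x y Finset.univ Ω hx hy
    have h4 : ((Finset.univ ×ˢ Finset.univ).filter fun p : V × V =>
        {x, p.1, p.2} ∈ E' ∧ {y, p.1, p.2} ∈ E').card = (commonLink E' x y).card := by
      congr 1
    rw [h4] at h1
    have h5 : (pairCount (linkRel E' x) Finset.univ : ℝ) +
        pairCount (linkRel E' y) Finset.univ ≤ Ω.card + (commonLink E' x y).card := by
      exact_mod_cast h1
    linarith
  have hUU : ∀ x ∈ (Finset.univ \ W) ∩ (Finset.univ \ Z),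
      ∀ y ∈ (Finset.univ \ W) ∩ (Finset.univ \ Z),
      1 / 100 * n ^ 2 ≤ (commonLink E' x y).card := by
    intro x hx y hy
    simp only [Finset.mem_inter, Finset.mem_sdiff, Finset.mem_univ, true_and] at hx hy
    refine hcommon x y _ ?_ (h.transversal_link_subset _ hx.1) (h.transversal_link_subset _ hy.1)
      (hu x hx.1 hx.2) (hu y hy.1 hy.2)
    have h1 := Finset.card_union_le (W ×ˢ (Finset.univ \ W)) ((Finset.univ \ W) ×ˢ W)
    rw [Finset.card_product, Finset.card_product, ← Nat.cast_le (α := ℝ)] at h1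
    push_cast at h1
    rw [card_compl] at h1
    linarith
  obtain ⟨A, hA, hAc, hab⟩ := exists_absorber (E := E')
    (P := ![W, (Finset.univ \ W) ∩ (Finset.univ \ Z), (Finset.univ \ W) ∩ (Finset.univ \ Z)])
    (η := 1 / 100) (by norm_num)
    (by
      refine le_trans ?_ (card_triples_ge E' _ (c := 3 / 10 * n ^ 2) ?_)
      · change 1 / 100 * n ^ 3 ≤ (W.card : ℝ) * (3 / 10 * n ^ 2)
        have h2 : 333 / 1000 * n * (3 / 10 * n ^ 2) ≤ W.card * (3 / 10 * n ^ 2) :=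
          mul_le_mul_of_nonneg_right hW (by positivity)
        have h3 : 0 ≤ n ^ 3 := by positivity
        linarith [show 333 / 1000 * n * (3 / 10 * n ^ 2) = 999 / 10000 * n ^ 3 by ring]
      · intro w hw'
        refine (hw w hw').trans ?_
        rw [pairCount_link]
        refine Nat.cast_le.2 (Finset.card_le_card fun p hp => ?_)
        exact Finset.mem_filter.2
          ⟨h.transversal_link_subset_of_mem _ hw' hp, (Finset.mem_filter.1 hp).2⟩)
    (fun i x hx y hy => by
      fin_cases i
      · refine hcommon x y _ ?_ (h.transversal_link_subset_of_mem _ hx)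
          (h.transversal_link_subset_of_mem _ hy) (hw x hx) (hw y hy)
        have h1 : (((Finset.univ \ W) ∩ (Finset.univ \ Z)).card : ℝ) ≤ n - W.card := by
          rw [← card_compl]
          exact_mod_cast Finset.card_le_card Finset.inter_subset_left
        rw [Finset.card_product]
        push_cast
        rw [← pow_two]
        have h2 := pow_le_pow_left₀ (by positivity) h1 2
        linarith
      · exact hUU x hx y hy
      · exact hUU x hx y hy)
    (by rw [← hndef]; norm_num; linarith) m (by rw [← hndef]; norm_num; linarith)
  refine ⟨A, hA, hAc, fun 𝒰 h1 h2 h3 => hab 𝒰 ?_ h2 h3⟩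
  refine h1.trans (le_of_eq ?_)
  norm_num
  ring

end DegreeCond

end TightCase

/-- Near the extremal size there is no room to use many edges missing W, so exactly as many as the
vertex count requires are used first; everything afterwards is transversal and stays balanced. -/
theorem DegreeCond.matchable_of_le_card {γ : ℝ} (hγ : 0 < γ) (hγ1 : γ ≤ 1 / 100) :
    ∃ N : ℝ, ∀ {V : Type*} [Fintype V] [DecidableEq V] {E : Finset (Finset V)} {W : Finset V},
      DegreeCond E γ W → N ≤ Fintype.card V → 3 ∣ Fintype.card V →
      (1 / 3 - γ / 100) * Fintype.card V ≤ W.card → Matchable E Finset.univ := by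
  obtain ⟨μ₁, hμ₁⟩ : ∃ μ₁, μ₁ = γ / 10 ^ 11 := ⟨_, rfl⟩
  obtain ⟨μ₂, hμ₂⟩ : ∃ μ₂, μ₂ = μ₁ / 10 ^ 10 := ⟨_, rfl⟩
  have hμ₁0 : 0 < μ₁ := by rw [hμ₁]; positivity
  have hμ₂0 : 0 < μ₂ := by rw [hμ₂]; positivity
  obtain ⟨N, hN⟩ := exists_isLarge (γ / 4) (μ₂ / 40) hμ₂0
  refine ⟨N, fun {V _ _ E W} h hNV h3 hWc => ?_⟩
  obtain ⟨hlog, hinv, hsize, hthr⟩ := hN _ hNV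
  set n : ℝ := (Fintype.card V : ℝ) with hndef
  have hn0 : 0 < n := by linarith
  obtain ⟨m₁, hm₁⟩ : ∃ m₁, m₁ = ⌊μ₁ * n⌋₊ := ⟨_, rfl⟩
  have hm₁a : (m₁ : ℝ) ≤ μ₁ * n := by rw [hm₁]; exact Nat.floor_le (by positivity)
  have hm₁b : μ₁ * n - 1 ≤ m₁ := by rw [hm₁]; exact (Nat.sub_one_lt_floor _).le
  have hγn : γ * n ≤ n / 100 := by nlinarith
  have e₁ : μ₁ * n = γ * n / 10 ^ 11 := by rw [hμ₁]; ring
  have e₂ : μ₂ * n = μ₁ * n / 10 ^ 10 := by rw [hμ₂]; ring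
  have hγn0 : 0 < γ * n := by positivity
  have hW3 := h.card_le
  -- A perfect matching has n/3 edges, |W| of which meet `W`; the other t are chosen now.
  obtain ⟨t, ht⟩ : ∃ t, Fintype.card V = 3 * (W.card + t) := by
    obtain ⟨k, hk⟩ := h3
    exact ⟨k - W.card, by omega⟩
  have htn : n = 3 * ((W.card : ℝ) + t) := by rw [hndef]; exact_mod_cast ht
  obtain ⟨Z, hZ, hZc, hZW⟩ := h.exists_matchable_compl hγ t (by
    have : (300 * t : ℝ) ≤ n := by linarith
    rw [hndef] at this
    exact_mod_cast this)
  have hZc' : (Z.card : ℝ) = 3 * t := by exact_mod_cast hZc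
  have hWT : W ⊆ Finset.univ \ Z := fun v hv =>
    Finset.mem_sdiff.2 ⟨Finset.mem_univ _, fun hvZ => Finset.disjoint_left.1 hZW hvZ hv⟩
  obtain ⟨A, hA, hAc, hab⟩ := h.exists_absorber_transversal hγ hsize (by linarith) hZW
    (by linarith) m₁ (by linarith)
  set E' := transversal E W (Finset.univ \ Z) with hE'
  have hE'3 : ∀ e ∈ E', e.card = 3 ∧ (W ∩ e).card = 1 := fun e he =>
    ⟨h.uniform e (transversal_subset _ _ _ he), (Finset.mem_filter.1 he).2.2⟩
  have hAc' : (A.card : ℝ) ≤ 9 * m₁ := by exact_mod_cast hAc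
  have hAT : A ⊆ Finset.univ \ Z := hA.subset fun e he => (Finset.mem_filter.1 he).2.1
  have hZAc : ((Z ∪ A).card : ℝ) ≤ Z.card + A.card := by exact_mod_cast Finset.card_union_le _ _
  have hbal : ∀ S ⊆ Finset.univ \ (Z ∪ A), Matchable E' ((Finset.univ \ (Z ∪ A)) \ S) →
      3 * (W ∩ S).card = S.card := by
    intro S hS hM
    have hd : Disjoint A ((Finset.univ \ (Z ∪ A)) \ S) := by
      rw [Finset.disjoint_left]
      intro v hv hv'
      exact (Finset.mem_sdiff.1 (Finset.mem_sdiff.1 hv').1).2 (Finset.mem_union_right _ hv)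
    have h1 := (hA.union hM hd).card_inter hE'3
    have h2 : A ∪ ((Finset.univ \ (Z ∪ A)) \ S) = (Finset.univ \ Z) \ S := by
      ext v
      have h3 := @hS v
      have h4 := @hAT v
      simp only [Finset.mem_union, Finset.mem_sdiff, Finset.mem_univ, true_and] at h3 h4 ⊢
      tauto
    rw [h2] at h1
    have hST : S ⊆ Finset.univ \ Z := hS.trans
      (Finset.sdiff_subset_sdiff subset_rfl Finset.subset_union_left)
    have h5 : W ∩ ((Finset.univ \ Z) \ S) = W \ (W ∩ S) := by
      ext v
      have := @hWT v
      simp only [Finset.mem_inter, Finset.mem_sdiff, Finset.mem_univ, true_and] at this ⊢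
      tauto
    rw [h5, Finset.card_sdiff_of_subset Finset.inter_subset_left,
      Finset.card_sdiff_of_subset hST, Finset.card_sdiff_of_subset (Finset.subset_univ _),
      Finset.card_univ, hZc] at h1
    have h6 := Finset.card_le_card (Finset.inter_subset_left : W ∩ S ⊆ W)
    have h7 := Finset.card_le_card hST
    rw [Finset.card_sdiff_of_subset (Finset.subset_univ _), Finset.card_univ, hZc] at h7
    omega
  obtain ⟨S, hS, hM, hSc⟩ := h.exists_matching_missing_few hγ hγ1 (γ₀ := γ / 4) (E' := E')
    (by positivity) le_rfl (ε := μ₂ / 40) (by positivity) (fun e he => (hE'3 e he).1) (Z := Z ∪ A)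
    (by linarith) hthr
    -- Balance replaces the density of pairs avoiding `W`, and it also forces the fractional
    -- matching into `E'`.
    (fun S hS hM _ hne => by
      have h1 := hbal S hS hM
      refine ⟨h1.le, fun x hx => ⟨hx.nonneg, fun f hf => ?_, hx.sum_eq_one, hx.marginal⟩⟩
      refine Finset.mem_filter.2 ⟨hx.mem f hf, ?_, hx.card_inter_image_eq_one h.uniform
        (fun e he => h.inter_edge_card_le he) hne h1 hf⟩
      refine Finset.image_subset_iff.2 fun i _ => ?_
      exact Finset.sdiff_subset_sdiff subset_rfl Finset.subset_union_left (hS (f i).2))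
  have hk := hbal S hS hM
  have hSW : (S \ W).card = 2 * (W ∩ S).card := by
    have := Finset.card_sdiff_add_card_inter S W
    rw [Finset.inter_comm] at this
    omega
  -- The balanced leftover is divided into three equal parts, giving triples of type (W, U, U) for
  -- the absorber.
  obtain ⟨R, hR, hRc⟩ := Finset.exists_subset_card_eq (s := S \ W) (n := (W ∩ S).card) (by omega)
  have hRc' : ((S \ W) \ R).card = (W ∩ S).card := by
    rw [Finset.card_sdiff_of_subset hR]
    omega
  have d01 : Disjoint (W ∩ S) (S \ W) := by
    rw [Finset.disjoint_left]
    intro v hv hv'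
    exact (Finset.mem_sdiff.1 hv').2 (Finset.mem_inter.1 hv).1
  have d1 : Disjoint (W ∩ S) R := Finset.disjoint_of_subset_right hR d01
  have d2 : Disjoint (W ∩ S) ((S \ W) \ R) :=
    Finset.disjoint_of_subset_right Finset.sdiff_subset d01
  have d3 : Disjoint R ((S \ W) \ R) := Finset.disjoint_sdiff
  obtain ⟨𝒰, hUc, hU, hUd, hUR⟩ := exists_triples ![W ∩ S, R, (S \ W) \ R] (W ∩ S).card
    (fun i => by fin_cases i; exacts [rfl, hRc, hRc'])
    (fun i j hij => by
      fin_cases i <;> fin_cases j <;>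
        first
        | exact absurd rfl hij
        | exact d1
        | exact d2
        | exact d3
        | exact d1.symm
        | exact d2.symm
        | exact d3.symm)
  have hRS : (Finset.univ : Finset (Fin 3)).biUnion ![W ∩ S, R, (S \ W) \ R] = S := by
    ext v
    have := @hR v
    simp only [Finset.mem_biUnion, Finset.mem_univ, true_and, Fin.exists_fin_succ,
      Matrix.cons_val_zero, Matrix.cons_val_succ, IsEmpty.exists_iff, or_false,
      Finset.mem_sdiff, Finset.mem_inter] at this ⊢
    tauto
  have hmemS : ∀ u ∈ 𝒰, ∀ i, u i ∈ S := fun u hu i => by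
    rw [← hRS]
    exact Finset.mem_biUnion.2 ⟨i, Finset.mem_univ _, (hU u hu).2 i⟩
  have hSmem : ∀ v ∈ S, v ∉ Z ∧ v ∉ A := fun v hv => by
    have := (Finset.mem_sdiff.1 (hS hv)).2
    rwa [Finset.mem_union, not_or] at this
  have hUmem : ∀ v ∈ S \ W, v ∈ (Finset.univ \ W) ∩ (Finset.univ \ Z) := fun v hv => by
    obtain ⟨h1, h2⟩ := Finset.mem_sdiff.1 hv
    simp [h2, (hSmem v h1).1]
  have hUc' : (𝒰.card : ℝ) ≤ S.card := by
    exact_mod_cast hUc.trans (Finset.card_le_card Finset.inter_subset_right)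
  have hfin := hab 𝒰 (by linarith)
    (fun u hu => ⟨(hU u hu).1, fun i => ⟨?_, (hSmem _ (hmemS u hu i)).2⟩⟩) hUd
  swap
  · have h1 := (hU u hu).2 i
    fin_cases i
    · exact (Finset.mem_inter.1 h1).1
    · exact hUmem _ (hR h1)
    · exact hUmem _ (Finset.sdiff_subset h1)
  rw [hUR, hRS] at hfin
  have hE'E : E' ⊆ E := transversal_subset _ _ _
  have hd : Disjoint (A ∪ S) ((Finset.univ \ (Z ∪ A)) \ S) := by
    rw [Finset.disjoint_left]
    intro v hv hv'
    simp only [Finset.mem_union, Finset.mem_sdiff, Finset.mem_univ, true_and] at hv hv'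
    tauto
  have hd' : Disjoint Z ((A ∪ S) ∪ ((Finset.univ \ (Z ∪ A)) \ S)) := by
    rw [Finset.disjoint_left]
    intro v hv hv'
    have h1 := @hAT v
    have h2 := hSmem v
    simp only [Finset.mem_union, Finset.mem_sdiff, Finset.mem_univ, true_and] at hv' h1
    tauto
  have hfinal := hZ.union ((hfin.union hM hd).mono hE'E) hd'
  convert hfinal using 1
  ext v
  simp only [Finset.mem_univ, Finset.mem_union, Finset.mem_sdiff, true_and, true_iff]
  tauto

/-! ### From hypergraphs to finite families of triples; the extremal graph -/

section Translation

open Classical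

lemma Matchable.two_mul_card_le {V : Type*} [DecidableEq V] {E : Finset (Finset V)} {A S : Finset V}
    (hE : ∀ e ∈ E, e.card = 3 ∧ 2 ≤ (A ∩ e).card) (h : Matchable E S) :
    2 * S.card ≤ 3 * (A ∩ S).card := by
  obtain ⟨M, h1, h2, rfl⟩ := h
  rw [Finset.inter_biUnion, Finset.card_biUnion fun e he f hf hne => h2 he hf hne,
    Finset.card_biUnion fun e he f hf hne => ?_, Finset.mul_sum, Finset.mul_sum]
  · refine Finset.sum_le_sum fun e he => ?_
    have := hE e (h1 he)
    simp only [id]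
    omega
  · exact Finset.disjoint_of_subset_left Finset.inter_subset_right
      (Finset.disjoint_of_subset_right Finset.inter_subset_right (h2 he hf hne))

namespace Hypergraph

variable {α : Type*} (H : Hypergraph α)

section FintypeVertices

variable [Fintype H.vertexSet]

/-- The edges of `H` as finite sets of vertices. -/
noncomputable def edgeFinset : Finset (Finset H.vertexSet) :=
  Finset.univ.filter fun s => Subtype.val '' (s : Set H.vertexSet) ∈ H.edgeSet

variable {H}

lemma mem_edgeFinset {s : Finset H.vertexSet} :
    s ∈ H.edgeFinset ↔ Subtype.val '' (s : Set H.vertexSet) ∈ H.edgeSet := by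
  simp [edgeFinset]

lemma exists_mem_edgeFinset {e : Set α} (he : e ∈ H.edgeSet) :
    ∃ s ∈ H.edgeFinset, Subtype.val '' (s : Set H.vertexSet) = e := by
  have h : Subtype.val '' (((Subtype.val ⁻¹' e : Set H.vertexSet).toFinset :
      Finset H.vertexSet) : Set H.vertexSet) = e := by
    rw [Set.coe_toFinset, Subtype.image_preimage_coe, Set.inter_eq_right]
    exact subset_vertexSet_of_mem_edgeSet he
  exact ⟨_, mem_edgeFinset.2 (by rwa [h]), h⟩

lemma IsUniform.card_eq (hH : H.IsUniform 3) {s : Finset H.vertexSet} (hs : s ∈ H.edgeFinset) :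
    s.card = 3 := by
  have := hH _ (mem_edgeFinset.1 hs)
  rwa [Set.ncard_image_of_injective _ Subtype.val_injective, Set.ncard_coe_finset] at this

lemma degree_le (v : H.vertexSet) :
    H.degree v ≤ (H.edgeFinset.filter fun s => v ∈ s).card := by
  have h1 : {e | e ∈ H.edgeSet ∧ (v : α) ∈ e} ⊆
      (fun s : Finset H.vertexSet => Subtype.val '' (s : Set H.vertexSet)) ''
        (H.edgeFinset.filter fun s => v ∈ s : Finset _) := by
    rintro e ⟨he, hv⟩
    obtain ⟨s, hs, rfl⟩ := exists_mem_edgeFinset he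
    refine ⟨s, ?_, rfl⟩
    obtain ⟨w, hw, hwv⟩ := hv
    rw [← Subtype.ext hwv]
    simpa using ⟨hs, hw⟩
  refine (Set.ncard_le_ncard h1 (Set.toFinite _)).trans ?_
  refine (Set.ncard_image_le (Set.toFinite _)).trans ?_
  rw [Set.ncard_coe_finset]

/-- Each edge through v yields two ordered pairs; hence 3/5 becomes 6/5. -/
lemma IsUniform.two_mul_degree_le (hH : H.IsUniform 3) (v : H.vertexSet) :
    2 * H.degree v ≤ pairCount (linkRel H.edgeFinset v) Finset.univ := by
  refine (Nat.mul_le_mul_left 2 (degree_le v)).trans ?_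
  rw [pairCount_link]
  have hmaps : Set.MapsTo (fun p : H.vertexSet × H.vertexSet => ({v, p.1, p.2} : Finset _))
      ((Finset.univ ×ˢ Finset.univ).filter fun p : H.vertexSet × H.vertexSet =>
        {v, p.1, p.2} ∈ H.edgeFinset : Finset _)
      (H.edgeFinset.filter fun s => v ∈ s : Finset _) := by
    intro p hp
    have := (Finset.mem_filter.1 (Finset.mem_coe.1 hp)).2
    simpa using this
  refine le_of_le_of_eq ?_ (Finset.card_eq_sum_card_fiberwise hmaps).symm
  · rw [mul_comm, ← smul_eq_mul]
    refine Finset.card_nsmul_le_sum _ _ _ fun s hs => ?_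
    obtain ⟨hs, hv⟩ := Finset.mem_filter.1 hs
    have h1 : (s.erase v).card = 2 := by
      rw [Finset.card_erase_of_mem hv, hH.card_eq hs]
    obtain ⟨a, b, hab, hsab⟩ := Finset.card_eq_two.1 h1
    have h2 : {v, a, b} = s := by rw [← hsab, Finset.insert_erase hv]
    have h3 : {(a, b), (b, a)} ⊆ ((Finset.univ ×ˢ Finset.univ).filter fun p :
        H.vertexSet × H.vertexSet => {v, p.1, p.2} ∈ H.edgeFinset).filter
        fun p => {v, p.1, p.2} = s := by
      intro p hp
      simp only [Finset.mem_insert, Finset.mem_singleton] at hp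
      rcases hp with rfl | rfl
      · simp [h2, hs]
      · simp [Finset.pair_comm b a, h2, hs]
    refine le_trans ?_ (Finset.card_le_card h3)
    rw [Finset.card_pair]
    simp [hab]

lemma exists_isPerfectMatching_iff :
    (∃ M, H.IsPerfectMatching M) ↔ Matchable H.edgeFinset Finset.univ := by
  constructor
  · rintro ⟨M, ⟨hM, hd⟩, hu⟩
    refine ⟨H.edgeFinset.filter fun s => Subtype.val '' (s : Set H.vertexSet) ∈ M,
      Finset.filter_subset _ _, ?_, ?_⟩
    · intro s hs t ht hne
      have hs := (Finset.mem_filter.1 (Finset.mem_coe.1 hs)).2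
      have ht := (Finset.mem_filter.1 (Finset.mem_coe.1 ht)).2
      have h1 := hd hs ht fun h => hne (by
        exact_mod_cast Subtype.val_injective.image_injective h)
      simp only [Function.onFun, id] at h1 ⊢
      rw [Set.disjoint_image_iff Subtype.val_injective] at h1
      exact_mod_cast h1
    · ext v
      simp only [Finset.mem_biUnion, Finset.mem_filter, id, Finset.mem_univ, iff_true]
      have hv : (v : α) ∈ ⋃₀ M := by
        rw [hu]
        exact v.2
      obtain ⟨e, he, hve⟩ := hv
      obtain ⟨s, hs, rfl⟩ := exists_mem_edgeFinset (hM he)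
      obtain ⟨w, hw, hwv⟩ := hve
      refine ⟨s, ⟨hs, he⟩, ?_⟩
      rw [← Subtype.ext hwv]
      exact hw
  · rintro ⟨M, hM, hd, hu⟩
    refine ⟨(fun s : Finset H.vertexSet => Subtype.val '' (s : Set H.vertexSet)) '' M,
      ⟨?_, ?_⟩, ?_⟩
    · rintro _ ⟨s, hs, rfl⟩
      exact mem_edgeFinset.1 (hM hs)
    · rintro _ ⟨s, hs, rfl⟩ _ ⟨t, ht, rfl⟩ hne
      have h1 := hd hs ht fun h => hne (by rw [h])
      simp only [Function.onFun, id] at h1 ⊢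
      rw [Set.disjoint_image_iff Subtype.val_injective]
      exact_mod_cast h1
    · ext v
      constructor
      · rintro ⟨_, ⟨s, hs, rfl⟩, w, hw, rfl⟩
        exact w.2
      · intro hv
        have h1 : (⟨v, hv⟩ : H.vertexSet) ∈ M.biUnion id := hu ▸ Finset.mem_univ _
        obtain ⟨s, hs, hvs⟩ := Finset.mem_biUnion.1 h1
        exact ⟨_, ⟨s, hs, rfl⟩, ⟨v, hv⟩, hvs, rfl⟩

lemma ncard_extremal_core {k : ℕ} (hk : 0 < k) :
    (Finset.univ.filter fun i : Fin (3 * k) => (i : ℕ) < 3 * k / 3 * 2 - 1).card = 2 * k - 1 := by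
  have h : 3 * k / 3 * 2 - 1 = 2 * k - 1 := by omega
  rw [h, Fin.card_filter_val_lt]
  omega

/-- The k edges of a perfect matching would use 2k vertices mapped into T, which has only 2k - 1. -/
lemma IsUniform.not_isSubgraphOf_extremal (hH : H.IsUniform 3) {k : ℕ} (hk : 0 < k)
    (hc : Fintype.card H.vertexSet = 3 * k) (hM : Matchable H.edgeFinset Finset.univ) :
    ¬ H.IsSubgraphOf (extremal 2 (3 * k) (3 * k / 3)) := by
  rintro ⟨f, hf, -, hfE⟩
  set A : Finset H.vertexSet :=
    Finset.univ.filter fun v => (f v : ℕ) < 3 * k / 3 * 2 - 1 with hA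
  have hAc : A.card ≤ 2 * k - 1 := by
    rw [← ncard_extremal_core hk]
    refine Finset.card_le_card_of_injOn (fun v => f v) ?_ ?_
    · intro v hv
      simpa [hA] using hv
    · intro v _ w _ h
      exact Subtype.ext (hf v.2 w.2 h)
  have h1 := hM.two_mul_card_le (A := A) fun s hs => by
    refine ⟨hH.card_eq hs, ?_⟩
    have h2 := (hfE ⟨_, mem_edgeFinset.1 hs, rfl⟩).2
    refine h2.trans ?_
    have h3 : f '' (Subtype.val '' (s : Set H.vertexSet)) ∩
        {i : Fin (3 * k) | (i : ℕ) < 3 * k / 3 * 2 - 1} ⊆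
        (fun v : H.vertexSet => f v) '' ((A ∩ s : Finset _) : Set H.vertexSet) := by
      rintro _ ⟨⟨_, ⟨v, hv, rfl⟩, rfl⟩, hi⟩
      refine ⟨v, ?_, rfl⟩
      exact Finset.mem_coe.2 (Finset.mem_inter.2 ⟨Finset.mem_filter.2 ⟨Finset.mem_univ _, hi⟩, hv⟩)
    refine (Set.ncard_le_ncard h3 (Set.toFinite _)).trans ?_
    refine (Set.ncard_image_le (Set.toFinite _)).trans ?_
    rw [Set.ncard_coe_finset]
  rw [Finset.inter_univ, Finset.card_univ, hc] at h1
  omega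

/-- Send k + 1 vertices of W to S and all others to T; an edge loses at most one vertex to S. -/
lemma IsUniform.isSubgraphOf_extremal (hH : H.IsUniform 3) {k : ℕ} (hk : 0 < k)
    (hc : Fintype.card H.vertexSet = 3 * k) {W : Finset H.vertexSet} (hW : k < W.card)
    (hWE : ∀ s ∈ H.edgeFinset, (W ∩ s).card ≤ 1) :
    H.IsSubgraphOf (extremal 2 (3 * k) (3 * k / 3)) := by
  obtain ⟨W₀, hW₀, hW₀c⟩ := Finset.exists_subset_card_eq (s := W) (n := k + 1) hW
  let p : H.vertexSet → Prop := fun v => v ∉ W₀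
  let q : Fin (3 * k) → Prop := fun i => (i : ℕ) < 3 * k / 3 * 2 - 1
  have hp : Fintype.card {v // p v} = 2 * k - 1 := by
    rw [Fintype.card_subtype, Finset.filter_notMem_eq_sdiff,
      Finset.card_sdiff_of_subset (Finset.subset_univ _), Finset.card_univ, hc, hW₀c]
    omega
  have hq : Fintype.card {i // q i} = 2 * k - 1 := by
    rw [Fintype.card_subtype]
    exact ncard_extremal_core hk
  have hpn : Fintype.card {v // ¬ p v} = Fintype.card {i // ¬ q i} := by
    refine (Fintype.card_subtype_compl p).trans (Eq.trans ?_ (Fintype.card_subtype_compl q).symm)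
    rw [hp, hq, hc, Fintype.card_fin]
  let e : H.vertexSet ≃ Fin (3 * k) := (Equiv.sumCompl p).symm.trans
    ((Equiv.sumCongr (Fintype.equivOfCardEq (hp.trans hq.symm))
      (Fintype.equivOfCardEq hpn)).trans (Equiv.sumCompl q))
  have he : ∀ v, v ∉ W₀ → (e v : ℕ) < 3 * k / 3 * 2 - 1 := by
    intro v hv
    have h1 : (Equiv.sumCompl p).symm v = Sum.inl ⟨v, hv⟩ :=
      Equiv.sumCompl_symm_apply_of_pos (p := p) hv
    simp only [e, Equiv.trans_apply, h1, Equiv.sumCongr_apply, Sum.map_inl,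
      Equiv.sumCompl_apply_inl]
    exact (Fintype.equivOfCardEq (hp.trans hq.symm) ⟨v, hv⟩).2
  -- The value outside the vertex set is irrelevant.
  let f : α → Fin (3 * k) := fun x =>
    if h : x ∈ H.vertexSet then e ⟨x, h⟩ else ⟨0, by omega⟩
  have hf : ∀ v : H.vertexSet, f v = e v := fun v => by simp [f]
  have hinj : Set.InjOn f H.vertexSet := by
    intro x hx y hy h
    have h1 := hf ⟨x, hx⟩
    have h2 := hf ⟨y, hy⟩
    exact congrArg Subtype.val (e.injective (h1.symm.trans (h.trans h2)))
  refine ⟨f, hinj, Set.subset_univ _, ?_⟩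
  rintro _ ⟨d, hd, rfl⟩
  obtain ⟨s, hs, rfl⟩ := exists_mem_edgeFinset hd
  refine ⟨?_, ?_⟩
  · rw [(hinj.mono (subset_vertexSet_of_mem_edgeSet hd)).ncard_image]
    exact hH _ hd
  · have h1 : (e '' ((s \ W₀ : Finset _) : Set H.vertexSet)) ⊆
        f '' (Subtype.val '' (s : Set H.vertexSet)) ∩
          {i : Fin (3 * k) | (i : ℕ) < 3 * k / 3 * 2 - 1} := by
      rintro _ ⟨v, hv, rfl⟩
      obtain ⟨hv, hvW⟩ := Finset.mem_sdiff.1 (Finset.mem_coe.1 hv)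
      exact ⟨⟨v, ⟨v, hv, rfl⟩, hf v⟩, he v hvW⟩
    refine le_trans ?_ (Set.ncard_le_ncard h1 (Set.toFinite _))
    rw [Set.ncard_image_of_injective _ e.injective, Set.ncard_coe_finset]
    have h2 := Finset.card_sdiff_add_card_inter s W₀
    have h3 : (s ∩ W₀).card ≤ (W ∩ s).card := Finset.card_le_card fun v hv =>
      Finset.mem_inter.2 ⟨hW₀ (Finset.mem_inter.1 hv).2, (Finset.mem_inter.1 hv).1⟩
    have h4 := hWE s hs
    have h5 := hH.card_eq hs
    omega

end FintypeVertices

end Hypergraph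

end Translation

/-! ### The main theorem -/

theorem theorem1p6 (γ : ℝ) (hγ : 0 < γ) :
    ∃ n₀ : ℕ, ∀ n : ℕ, n₀ ≤ n → 3 ∣ n →
      ∀ {α : Type*} (H : Hypergraph α),
        H.vertexSet.Finite → H.vertexSet.ncard = n →
        H.IsUniform 3 →
        (∀ v ∈ H.vertexSet, ¬ H.IsIsolated v) →
        (∀ u v : α, u ≠ v → H.Adj u v →
          (3 / 5 + γ) * (n : ℝ) ^ 2 < (H.degree u : ℝ) + (H.degree v : ℝ)) →
        ((∃ M : Set (Set α), H.IsPerfectMatching M) ↔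
          ¬ H.IsSubgraphOf (Hypergraph.extremal 2 n (n / 3))) := by
  classical
  obtain ⟨δ, hδ, hδ1, hδγ⟩ : ∃ δ : ℝ, 0 < δ ∧ δ ≤ 1 / 100 ∧ δ ≤ γ :=
    ⟨min γ (1 / 100), lt_min hγ (by norm_num), min_le_right _ _, min_le_left _ _⟩
  obtain ⟨N₁, hN₁⟩ := DegreeCond.matchable_of_card_le hδ hδ1
  obtain ⟨N₂, hN₂⟩ := DegreeCond.matchable_of_le_card hδ hδ1
  refine ⟨⌈max (max N₁ N₂) 1⌉₊, fun n hn h3 α H hfin hcard hH hiso hdeg => ?_⟩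
  have hn' : max (max N₁ N₂) 1 ≤ (n : ℝ) := Nat.ceil_le.1 hn
  have hn1 : N₁ ≤ n := (le_max_left _ _).trans ((le_max_left _ _).trans hn')
  have hn2 : N₂ ≤ n := (le_max_right _ _).trans ((le_max_left _ _).trans hn')
  have hn0 : 1 ≤ n := by exact_mod_cast (le_max_right _ _).trans hn'
  have : Fintype H.vertexSet := hfin.fintype
  have hc : Fintype.card H.vertexSet = n := by
    rw [← hcard, ← Nat.card_coe_set_eq, Nat.card_eq_fintype_card]
  have hdeg' : ∀ s ∈ H.edgeFinset, ∀ u ∈ s, ∀ v ∈ s, u ≠ v →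
      (6 / 5 + δ) * (Fintype.card H.vertexSet : ℝ) ^ 2 ≤
        pairCount (linkRel H.edgeFinset u) Finset.univ +
          pairCount (linkRel H.edgeFinset v) Finset.univ := by
    intro s hs u hu v hv hne
    have h1 := hdeg u v (fun h => hne (Subtype.ext h))
      ⟨_, Hypergraph.mem_edgeFinset.1 hs, ⟨u, hu, rfl⟩, ⟨v, hv, rfl⟩⟩
    have h2 : (2 * H.degree u : ℝ) ≤ pairCount (linkRel H.edgeFinset u) Finset.univ := by
      exact_mod_cast hH.two_mul_degree_le u
    have h3 : (2 * H.degree v : ℝ) ≤ pairCount (linkRel H.edgeFinset v) Finset.univ := by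
      exact_mod_cast hH.two_mul_degree_le v
    have h4 : δ * (n : ℝ) ^ 2 ≤ γ * (n : ℝ) ^ 2 :=
      mul_le_mul_of_nonneg_right hδγ (by positivity)
    have h5 : 0 ≤ γ * (n : ℝ) ^ 2 := by positivity
    rw [hc]
    linarith
  set W : Finset H.vertexSet := Finset.univ.filter fun v =>
    (pairCount (linkRel H.edgeFinset v) Finset.univ : ℝ) <
      (3 / 5 + δ / 2) * (Fintype.card H.vertexSet : ℝ) ^ 2 with hW
  have hWE : ∀ s ∈ H.edgeFinset, (W ∩ s).card ≤ 1 := by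
    intro s hs
    rw [Finset.card_le_one]
    intro u hu v hv
    by_contra hne
    obtain ⟨huW, hus⟩ := Finset.mem_inter.1 hu
    obtain ⟨hvW, hvs⟩ := Finset.mem_inter.1 hv
    have h1 := hdeg' s hs u hus v hvs hne
    have h2 := (Finset.mem_filter.1 huW).2
    have h3 := (Finset.mem_filter.1 hvW).2
    linarith
  obtain ⟨k, rfl⟩ := h3
  rw [Hypergraph.exists_isPerfectMatching_iff]
  refine ⟨fun hM => hH.not_isSubgraphOf_extremal (by omega) hc hM, fun hsub => ?_⟩
  -- This is the only use of the assumption that H does not embed in the extremal graph.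
  have hWk : 3 * W.card ≤ Fintype.card H.vertexSet := by
    by_contra hcon
    exact hsub (hH.isSubgraphOf_extremal (by omega) hc (by omega) hWE)
  have hcond : DegreeCond H.edgeFinset δ W := by
    refine ⟨fun s hs => hH.card_eq hs, fun u v w hl => ?_, fun v => ?_, fun v => by simp [hW], hWk⟩
    · refine hdeg' _ hl u (by simp) v (by simp) ?_
      rintro rfl
      have h1 := hH.card_eq hl
      rw [Finset.insert_eq_of_mem (by simp)] at h1
      have := Finset.card_le_two (a := u) (b := w)
      omega
    · have h1 := hiso v v.2
      unfold Hypergraph.IsIsolated at h1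
      push Not at h1
      obtain ⟨e, he, hve⟩ := h1
      obtain ⟨s, hs, rfl⟩ := Hypergraph.exists_mem_edgeFinset he
      obtain ⟨w, hw, hwv⟩ := hve
      rw [Finset.mem_coe, Subtype.ext hwv] at hw
      have h1 : (s.erase v).card = 2 := by
        rw [Finset.card_erase_of_mem hw, hH.card_eq hs]
      obtain ⟨a, b, -, hsab⟩ := Finset.card_eq_two.1 h1
      refine ⟨a, b, ?_⟩
      rw [linkRel, ← hsab, Finset.insert_erase hw]
      exact hs
  rcases le_total (W.card : ℝ) ((1 / 3 - δ / 100) * Fintype.card H.vertexSet) with h | h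
  · exact hN₁ hcond (by rw [hc]; exact hn1) ⟨k, hc⟩ h
  · exact hN₂ hcond (by rw [hc]; exact hn2) ⟨k, hc⟩ h
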